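/- Let $\Omega\subset\mathbb{R}^2\cong\mathbb{C}$ be a bounded strongly convex domain whose boundary is a smooth ($C^\infty$) simple closed curve of length $\ell$ with strictly positive curvature, and let $\gamma:\mathbb{R}/\ell\mathbb{Z}\to\partial\Omega$ be a counterclockwise arc-length parametrization, with radius of curvature $\rho(s)$. Let $f:(s,\varphi)\mapsto(s',\varphi')$ be the billiard map on $\mathbb{R}/\ell\mathbb{Z}\times[0,\pi]$, where $\varphi$ is the angle between the outgoing ray at $\gamma(s)$ and the positively oriented tangent. Write $\mathbb{T}=\mathbb{R}/\mathbb{Z}$. (i) A Lazutkin change of coordinates of order $k$ is a diffeomorphism $\Psi=(X,Y)$ of the form $X(s,\varphi)=\sum_{j=0}^{k-1}X_j(s)\varphi^{2j}$, $Y(s,\varphi)=\sum_{j=0}^{k}Y_j(s)\varphi^{2j+1}$ with smooth coefficients, from a neighbourhood of $\{\varphi=0\}$ onto a neighbourhood of $\mathbb{T}\times\{0\}$ in $\mathbb{T}\times[0,\infty)$, that conjugates $f$ with a map $(x,y)\mapsto(x+y,y)+O(y^{2k+2})$. There is exactly one function $X_1$ that is the $\varphi^2$ coefficient of $X$ for some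 Lazutkin change of coordinates of some order $k\ge2$ normalized by $X(0,\varphi)=0$ for all $\varphi$; and $\Omega$ is a disc if and only if $X_1\equiv0$. (ii) A normalized angular function of order $k$ is a smooth map $Z_{\mathrm{al}}:\mathbb{T}\times(-\varepsilon,\varepsilon)\to\mathbb{R}/\ell\mathbb{Z}$, for some $\varepsilon>0$, that is even in $\eta$, such that $Z_{\mathrm{al}}(\cdot,\eta)$ is an orientation-preserving diffeomorphism with $Z_{\mathrm{al}}(0,\eta)=0$ for every $\eta$, and such that for the points $z_\pm=\gamma(Z_{\mathrm{al}}(\xi\pm\eta,\eta))$, $z_0=\gamma(Z_{\mathrm{al}}(\xi,\eta))$, $\eta\ne0$, the angle between $z_+-z_0$ and the positive tangent at $z_0$ and the angle between $z_--z_0$ and the negative tangent at $z_0$ differ by $O(\eta^{2k+2})$ as $\eta\to0$, uniformly in $\xi$. There is exactly one function $Z_{\mathrm{al},1}$ such that $Z_{\mathrm{al}}(\xi,\eta)=Z_{\mathrm{al}}(\xi,0)+Z_{\mathrm{al},1}(\xi)\eta^2+O(\eta^4)$ for some normalized angular function of some order $k\ge2$; and $\Omega$ is a disc if and only if $Z_{\mathrm{al},1}\equiv0$.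 (iii) Suppose in addition that $\Omega$ is symmetric with respect to a line through $\gamma(0)$. Let $X_0(s)=\bigl(\int_0^\ell\rho^{-2/3}\bigr)^{-1}\int_0^s\rho^{-2/3}$ be the Lazutkin parameter. There is exactly one smooth function $\alpha:\mathbb{T}\to\mathbb{R}$ such that, for all large $q$ and for every periodic billiard orbit of rotation number $1/q$ with successive collision points $\gamma(s_0),\dots,\gamma(s_{q-1})$, $0=s_0<s_1<\dots<s_{q-1}<\ell$, one has $X_0(s_k)=\frac kq+\frac{\alpha(k/q)}{q^2}+O(q^{-4})$, uniformly in $k$ and in the orbit; and $\Omega$ is a disc if and only if $\alpha\equiv0$. -/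

import Mathlib

namespace Billiard

open Set Filter Topology Asymptotics
open scoped ContDiff

/-- The signed curvature of a plane curve `γ` parametrized by arc length (the plane is `ℂ`). -/
noncomputable def curvature (γ : ℝ → ℂ) (s : ℝ) : ℝ :=
  ((starRingEnd ℂ) (deriv γ s) * deriv (deriv γ) s).im

/-- `Ω` is a smooth strongly convex billiard domain, and the `ℓ`-periodic map `γ` is an
arc-length parametrization of its boundary, a simple closed curve of length `ℓ`.
Positivity of the signed curvature also says that `γ` runs counterclockwise. -/
structure IsBilliardDomain (Ω : Set ℂ) (ℓ : ℝ) (γ : ℝ → ℂ) : Prop where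
  isOpen : IsOpen Ω
  nonempty : Ω.Nonempty
  bounded : Bornology.IsBounded Ω
  convex : Convex ℝ Ω
  length_pos : 0 < ℓ
  smooth : ContDiff ℝ ∞ γ
  periodic : Function.Periodic γ ℓ
  unit_speed : ∀ s, ‖deriv γ s‖ = 1
  simple : InjOn γ (Ico 0 ℓ)
  boundary : frontier Ω = range γ
  curvature_pos : ∀ s, 0 < curvature γ s

/-- `Ω` is a round disc. -/
def IsDisc (Ω : Set ℂ) : Prop :=
  ∃ (c : ℂ) (r : ℝ), 0 < r ∧ Ω = Metric.ball c r

/-- The graph of the billiard map `(s, φ) ↦ (s', φ')` for `0 < φ < π`, in the universal cover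
`s ∈ ℝ` of the circle `ℝ / ℓℤ`, with the lift that extends to `(s, 0) ↦ (s, 0)`.
The chord from `γ s` to `γ s'` makes the angle `φ` with the tangent at `γ s`; by the law of
reflection, the angle `φ'` of the outgoing ray with the tangent at `γ s'` equals
the angle between the incoming chord and that tangent. -/
def IsBilliardStep (ℓ : ℝ) (γ : ℝ → ℂ) (s φ s' φ' : ℝ) : Prop :=
  s < s' ∧ s' < s + ℓ ∧
    φ = InnerProductGeometry.angle (γ s' - γ s) (deriv γ s) ∧
    φ' = InnerProductGeometry.angle (γ s' - γ s) (deriv γ s')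

/-! ### Lazutkin changes of coordinates -/

/-- `X(s, φ) = ∑_{j < k} X_j(s) φ^{2j}`. -/
def evenSum (k : ℕ) (X : ℕ → ℝ → ℝ) (s φ : ℝ) : ℝ :=
  ∑ j ∈ Finset.range k, X j s * φ ^ (2 * j)

/-- `Y(s, φ) = ∑_{j ≤ k} Y_j(s) φ^{2j+1}`. -/
def oddSum (k : ℕ) (Y : ℕ → ℝ → ℝ) (s φ : ℝ) : ℝ :=
  ∑ j ∈ Finset.range (k + 1), Y j s * φ ^ (2 * j + 1)

/-- `Ψ` restricts to a diffeomorphism from a neighbourhood `ℝ × [0, δ)` of the boundary line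
`{φ = 0}` of a half plane onto a neighbourhood of the boundary line `{y = 0}`, with smoothness up
to the boundary on both sides. -/
def IsBoundaryDiffeo (Ψ : ℝ × ℝ → ℝ × ℝ) : Prop :=
  ∃ δ > 0, ∃ ε > 0, ∃ G : ℝ × ℝ → ℝ × ℝ,
    ContDiffOn ℝ ∞ Ψ (univ ×ˢ Ico 0 δ) ∧
    ContDiffOn ℝ ∞ G (Ψ '' (univ ×ˢ Ico 0 δ)) ∧
    LeftInvOn G Ψ (univ ×ˢ Ico 0 δ) ∧
    Ψ '' (univ ×ˢ Ico 0 δ) ⊆ univ ×ˢ Ici 0 ∧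
    univ ×ˢ Ico 0 ε ⊆ Ψ '' (univ ×ˢ Ico 0 δ)

/-- The coefficients `X_j` (`j < k`) and `Y_j` (`j ≤ k`) define a Lazutkin change of coordinates
`Ψ = (X, Y)` of order `k`: a diffeomorphism near `{φ = 0}` that conjugates the billiard map with
`(x, y) ↦ (x + y, y) + O(y^{2k+2})`. All maps of circles are lifted to `ℝ`; since the billiard
map moves `s` forward and `y ≥ 0`, the circle map `X_0` has degree `1`. -/
structure IsLazutkinChange (ℓ : ℝ) (γ : ℝ → ℂ) (k : ℕ) (X Y : ℕ → ℝ → ℝ) : Prop where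
  smooth_X : ∀ j < k, ContDiff ℝ ∞ (X j)
  smooth_Y : ∀ j ≤ k, ContDiff ℝ ∞ (Y j)
  degree_X : ∀ s, X 0 (s + ℓ) = X 0 s + 1
  periodic_X : ∀ j, 0 < j → j < k → Function.Periodic (X j) ℓ
  periodic_Y : ∀ j ≤ k, Function.Periodic (Y j) ℓ
  diffeo : IsBoundaryDiffeo (fun p => (evenSum k X p.1 p.2, oddSum k Y p.1 p.2))
  conjugates : ∃ δ > 0, ∃ C : ℝ, ∀ s φ s' φ', 0 < φ → φ < δ → IsBilliardStep ℓ γ s φ s' φ' →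
    |evenSum k X s' φ' - (evenSum k X s φ + oddSum k Y s φ)| ≤ C * oddSum k Y s φ ^ (2 * k + 2) ∧
    |oddSum k Y s' φ' - oddSum k Y s φ| ≤ C * oddSum k Y s φ ^ (2 * k + 2)

/-- `X₁` is the coefficient of `φ²` of the first component of a Lazutkin change of coordinates of
some order `k ≥ 2`, normalized by `X(0, φ) = 0`. -/
def IsLazutkinX1 (ℓ : ℝ) (γ : ℝ → ℂ) (X₁ : ℝ → ℝ) : Prop :=
  ∃ k ≥ 2, ∃ X Y : ℕ → ℝ → ℝ, IsLazutkinChange ℓ γ k X Y ∧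
    (∀ φ, evenSum k X 0 φ = 0) ∧ X 1 = X₁

/-! ### Angular functions -/

/-- `|φ⁺ - φ⁻|` for the triple `(γ sm, γ s, γ sp)`, where `φ⁺` (resp. `φ⁻`) is the angle of the
chord from `γ s` to `γ sp` (resp. `γ sm`) with the positively (resp. negatively) oriented tangent
at `γ s`. The triple is an `ε`-pseudocollision when this is less than `ε`. -/
noncomputable def collisionDefect (γ : ℝ → ℂ) (sm s sp : ℝ) : ℝ :=
  |InnerProductGeometry.angle (γ sp - γ s) (deriv γ s) -
    InnerProductGeometry.angle (γ sm - γ s) (-deriv γ s)|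

/-- `Z`, defined for `|η| < ε`, is (the lift to `ℝ` of) the arc-length coordinate of an angular
function of order `k`, normalized by `Z(0, η) = 0`. -/
structure IsAngularFunction (ℓ : ℝ) (γ : ℝ → ℂ) (k : ℕ) (ε : ℝ) (Z : ℝ → ℝ → ℝ) : Prop where
  smooth : ContDiffOn ℝ ∞ (fun p : ℝ × ℝ => Z p.1 p.2) (univ ×ˢ Ioo (-ε) ε)
  even : ∀ ξ, ∀ η ∈ Ioo (-ε) ε, Z ξ (-η) = Z ξ η
  degree : ∀ ξ, ∀ η ∈ Ioo (-ε) ε, Z (ξ + 1) η = Z ξ η + ℓ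
  deriv_pos : ∀ ξ, ∀ η ∈ Ioo (-ε) ε, 0 < deriv (fun x => Z x η) ξ
  normalized : ∀ η ∈ Ioo (-ε) ε, Z 0 η = 0
  pseudocollision : ∃ δ > 0, δ ≤ ε ∧ ∃ C : ℝ, ∀ ξ η, 0 < |η| → |η| < δ →
    collisionDefect γ (Z (ξ - η) η) (Z ξ η) (Z (ξ + η) η) ≤ C * |η| ^ (2 * k + 2)

/-- `Z₁` is the coefficient of `η²` in the expansion at `η = 0` of the arc-length coordinate of a
normalized angular function of some order `k ≥ 2`. -/
def IsAngularZ1 (ℓ : ℝ) (γ : ℝ → ℂ) (Z₁ : ℝ → ℝ) : Prop :=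
  ∃ k ≥ 2, ∃ ε > 0, ∃ Z : ℝ → ℝ → ℝ, IsAngularFunction ℓ γ k ε Z ∧
    ∀ ξ, (fun η => Z ξ η - (Z ξ 0 + Z₁ ξ * η ^ 2)) =O[𝓝 0] fun η => η ^ 4

/-! ### Periodic orbits of axially symmetric domains -/

/-- The boundary curve is symmetric with respect to a line through `γ 0` (with direction `u`). -/
def IsAxiallySymmetric (γ : ℝ → ℂ) : Prop :=
  ∃ u : ℂ, ‖u‖ = 1 ∧ ∀ s, γ (-s) = γ 0 + u ^ 2 * (starRingEnd ℂ) (γ s - γ 0)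

/-- The Lazutkin parameter of the boundary point with arc-length coordinate `s`
(the radius of curvature is the inverse of the curvature). -/
noncomputable def lazutkinParam (ℓ : ℝ) (γ : ℝ → ℂ) (s : ℝ) : ℝ :=
  (∫ t in (0 : ℝ)..ℓ, ((curvature γ t)⁻¹) ^ (-(2 / 3) : ℝ))⁻¹ *
    ∫ t in (0 : ℝ)..s, ((curvature γ t)⁻¹) ^ (-(2 / 3) : ℝ)

/-- `σ` lists the lifted arc-length coordinates of the collision points of a periodic billiard
orbit of rotation number `1/q` (`q` collisions and one turn around the boundary per period). -/
def IsPeriodicOrbit (ℓ : ℝ) (γ : ℝ → ℂ) (q : ℕ) (σ : ℤ → ℝ) : Prop :=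
  2 ≤ q ∧ (∀ k, σ (k + q) = σ k + ℓ) ∧
    ∃ φ : ℤ → ℝ, ∀ k, IsBilliardStep ℓ γ (σ k) (φ k) (σ (k + 1)) (φ (k + 1))

/-- `α` is a smooth function on the circle `ℝ / ℤ` such that the collision points of the periodic
orbits of rotation number `1/q` through `γ 0` are, in the Lazutkin parameter,
`k/q + α(k/q)/q² + O(q⁻⁴)`. -/
def IsOrbitCorrection (ℓ : ℝ) (γ : ℝ → ℂ) (α : ℝ → ℝ) : Prop :=
  ContDiff ℝ ∞ α ∧ Function.Periodic α 1 ∧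
    ∃ (C : ℝ) (q₀ : ℕ), ∀ q ≥ q₀, ∀ σ : ℤ → ℝ, IsPeriodicOrbit ℓ γ q σ → σ 0 = 0 →
      ∀ k : ℕ, k < q →
        |lazutkinParam ℓ γ (σ k) - ((k : ℝ) / q + α ((k : ℝ) / q) / (q : ℝ) ^ 2)|
          ≤ C / (q : ℝ) ^ 4

end Billiard

/-! Parametrize the boundary by the Lazutkin parameter `x`. With `r` the cube root of the radius of
curvature, the speed is `c r²` and the tangent turns at the rate `c / r`. In this parameter the
angle `T x h` between the chord from `x` to `x + h` and the tangent at `x` has no quadratic term: `T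
x h = A₁ h + A₃ h³ + A₁ B' h⁴ + A₅ h⁵ + O(h⁶)` with `A₁ = c / (2 r)` and an explicit function `B`,
the `potential` (`exists_chordAngle_expansion`).

A ray that arrives from `x - m` and leaves towards `x + p` satisfies `T x p + T x (-m) = 0`. The odd
terms only contribute multiples of `p - m`, so the law becomes the difference equation `(p - m) +
B'(x) (p⁴ + m⁴) ≈ 0` (`exists_reflection_bound`). All three invariants are therefore governed by one
function, the `1`-periodic solution `a` of `a'' = -2 B'` with `a 0 = 0` (`correction`): (i)
conjugating the billiard map to a twist map up to order `6` forces `(A₁² X₁)'' = 2 B'`, hence `X₁ =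
-a / A₁²` (`isLazutkinX1`, `eq_of_isLazutkinX1`); (ii) the triple with Lazutkin parameters `ξ ± η +
a(ξ ± η) η²` and `ξ + a(ξ) η²` obeys the reflection law up to `O(η⁶)`, and no other `η²` coefficient
does, hence `Z₁ = c r² a` (`isAngularZ1`, `eq_of_isAngularZ1`); (iii) along an orbit of rotation
number `1/q` the second differences of the parameter are `-2 B' / q⁴ + O(q⁻⁶)`, hence `α = a`
(`isOrbitCorrection_correction`). Uniqueness of `α` needs orbits through `γ 0`: symmetric ones of
rotation number `1/(2m)` are found by maximizing length (`exists_periodicOrbit`).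

Each invariant is a nowhere vanishing factor times `a`, so it vanishes exactly when `B` is constant.
Rigidity then finishes the proof (`r_eq_of_potential_const`): as a function of the tangent angle
`τ`, constancy of `B` is the linear equation `4 u'' + u = const` for `u = 1 / r²`. Its non-constant
solutions change sign around their mean when `τ` grows by `2π`, whereas `u` has period `2π` because
the tangent of a simple convex curve turns once. So the curvature is constant and the domain is a
disc. -/

namespace Billiard

open Set Filter Topology Asymptotics
open scoped ContDiff

/-! ### Smooth periodic functions -/

section SmoothPeriodic

variable {F : Type*} [NormedAddCommGroup F] [NormedSpace ℝ F]

/-- Smooth functions of period `1`. -/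
def SmoothPeriodic (f : ℝ → F) : Prop := ContDiff ℝ ∞ f ∧ Function.Periodic f 1

theorem SmoothPeriodic.differentiable {f : ℝ → F} (hf : SmoothPeriodic f) : Differentiable ℝ f :=
  hf.1.differentiable (by simp)

theorem SmoothPeriodic.hasDerivAt {f : ℝ → F} (hf : SmoothPeriodic f) (x : ℝ) :
    HasDerivAt f (deriv f x) x :=
  (hf.differentiable x).hasDerivAt

theorem SmoothPeriodic.continuous {f : ℝ → F} (hf : SmoothPeriodic f) : Continuous f :=
  hf.1.continuous

theorem SmoothPeriodic.deriv {f : ℝ → F} (hf : SmoothPeriodic f) : SmoothPeriodic (deriv f) := by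
  refine ⟨(contDiff_infty_iff_deriv.1 hf.1).2, fun x => ?_⟩
  have h : (fun y => f (y + 1)) = f := funext hf.2
  rw [← deriv_comp_add_const, h]

theorem SmoothPeriodic.bounded {f : ℝ → F} (hf : SmoothPeriodic f) :
    ∃ C, 0 < C ∧ ∀ x, ‖f x‖ ≤ C := by
  obtain ⟨C, hC⟩ := (isCompact_Icc (a := (0 : ℝ)) (b := 1)).exists_bound_of_continuousOn
    hf.continuous.continuousOn
  refine ⟨max C 1, by positivity, fun x => ?_⟩
  obtain ⟨y, hy, hxy⟩ := hf.2.exists_mem_Ico₀ one_pos x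
  rw [hxy]
  exact (hC y ⟨hy.1, hy.2.le⟩).trans (le_max_left _ _)

theorem SmoothPeriodic.add {f g : ℝ → F} (hf : SmoothPeriodic f) (hg : SmoothPeriodic g) :
    SmoothPeriodic (fun x => f x + g x) :=
  ⟨hf.1.add hg.1, fun x => by simp only [hf.2 x, hg.2 x]⟩

theorem SmoothPeriodic.sub {f g : ℝ → F} (hf : SmoothPeriodic f) (hg : SmoothPeriodic g) :
    SmoothPeriodic (fun x => f x - g x) :=
  ⟨hf.1.sub hg.1, fun x => by simp only [hf.2 x, hg.2 x]⟩

theorem SmoothPeriodic.neg {f : ℝ → F} (hf : SmoothPeriodic f) :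
    SmoothPeriodic (fun x => -f x) :=
  ⟨hf.1.neg, fun x => by simp only [hf.2 x]⟩

theorem smoothPeriodic_const (c : F) : SmoothPeriodic (fun _ => c) :=
  ⟨contDiff_const, fun _ => rfl⟩

theorem SmoothPeriodic.mul {A : Type*} [NormedRing A] [NormedAlgebra ℝ A] {f g : ℝ → A}
    (hf : SmoothPeriodic f) (hg : SmoothPeriodic g) : SmoothPeriodic (fun x => f x * g x) :=
  ⟨hf.1.mul hg.1, fun x => by simp only [hf.2 x, hg.2 x]⟩

theorem SmoothPeriodic.pow {f : ℝ → ℝ} (hf : SmoothPeriodic f) (n : ℕ) :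
    SmoothPeriodic (fun x => f x ^ n) :=
  ⟨hf.1.pow n, fun x => by simp only [hf.2 x]⟩

theorem SmoothPeriodic.div {f g : ℝ → ℝ} (hf : SmoothPeriodic f) (hg : SmoothPeriodic g)
    (h0 : ∀ x, g x ≠ 0) : SmoothPeriodic (fun x => f x / g x) :=
  ⟨hf.1.div hg.1 h0, fun x => by simp only [hf.2 x, hg.2 x]⟩

theorem SmoothPeriodic.clm_comp {G : Type*} [NormedAddCommGroup G] [NormedSpace ℝ G] {f : ℝ → F}
    (hf : SmoothPeriodic f) (L : F →L[ℝ] G) : SmoothPeriodic (fun x => L (f x)) :=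
  ⟨L.contDiff.comp hf.1, fun x => by simp only [hf.2 x]⟩

theorem SmoothPeriodic.re {f : ℝ → ℂ} (hf : SmoothPeriodic f) :
    SmoothPeriodic (fun x => (f x).re) :=
  hf.clm_comp Complex.reCLM

theorem SmoothPeriodic.im {f : ℝ → ℂ} (hf : SmoothPeriodic f) :
    SmoothPeriodic (fun x => (f x).im) :=
  hf.clm_comp Complex.imCLM

theorem SmoothPeriodic.exists_pos_le {f : ℝ → ℝ} (hf : SmoothPeriodic f) (h0 : ∀ x, 0 < f x) :
    ∃ c, 0 < c ∧ ∀ x, c ≤ f x := by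
  obtain ⟨x₀, -, h₀⟩ := (isCompact_Icc (a := (0 : ℝ)) (b := 1)).exists_isMinOn ⟨0, by simp⟩
    hf.continuous.continuousOn
  refine ⟨f x₀, h0 _, fun x => ?_⟩
  obtain ⟨y, hy, hxy⟩ := hf.2.exists_mem_Ico₀ one_pos x
  rw [hxy]
  exact h₀ ⟨hy.1, hy.2.le⟩

theorem SmoothPeriodic.iteratedDeriv {f : ℝ → F} (hf : SmoothPeriodic f) (n : ℕ) :
    SmoothPeriodic (iteratedDeriv n f) := by
  induction n with
  | zero => simpa using hf
  | succ n ih => rw [iteratedDeriv_succ]; exact ih.deriv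

/-- Taylor's formula, with a remainder that is uniform in the base point. -/
theorem SmoothPeriodic.taylor (n : ℕ) : ∀ {f : ℝ → F}, SmoothPeriodic f → ∃ C, 0 < C ∧ ∀ x h : ℝ,
    ‖f (x + h) - ∑ j ∈ Finset.range n, (h ^ j / j.factorial) • _root_.iteratedDeriv j f x‖
      ≤ C * |h| ^ n := by
  induction n with
  | zero =>
    intro f hf
    obtain ⟨C, h0, hC⟩ := hf.bounded
    exact ⟨C, h0, fun x h => by simpa using hC (x + h)⟩
  | succ n ih =>
    intro f hf
    obtain ⟨C, h0, hC⟩ := ih hf.deriv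
    refine ⟨C, h0, fun x h => ?_⟩
    set R : ℝ → F := fun h => f (x + h) -
      ∑ j ∈ Finset.range (n + 1), (h ^ j / j.factorial) • _root_.iteratedDeriv j f x with hR
    -- The derivative in `h` of the remainder of order `n + 1` of `f` is the remainder of order `n`
    -- of `f'`, so the mean value inequality transfers the bound with the same constant.
    have hd : ∀ t, HasDerivAt R (_root_.deriv f (x + t) - ∑ j ∈ Finset.range n,
        (t ^ j / j.factorial) • _root_.iteratedDeriv j (_root_.deriv f) x) t := by
      intro t
      refine HasDerivAt.sub ?_ ?_
      · simpa using (hf.hasDerivAt (x + t)).comp_const_add x t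
      · have : ∀ j ∈ Finset.range (n + 1), HasDerivAt
            (fun h : ℝ => (h ^ j / j.factorial) • _root_.iteratedDeriv j f x)
            (((j : ℝ) * t ^ (j - 1) / j.factorial) • _root_.iteratedDeriv j f x) t := by
          intro j _
          exact ((hasDerivAt_pow j t).div_const _).smul_const _
        convert HasDerivAt.fun_sum this using 1
        rw [Finset.sum_range_succ']
        simp only [Nat.cast_zero, zero_mul, zero_div, zero_smul, add_zero]
        refine Finset.sum_congr rfl fun j _ => ?_
        rw [iteratedDeriv_succ', Nat.factorial_succ]
        congr 1
        push_cast
        have : (j.factorial : ℝ) ≠ 0 := by positivity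
        field_simp
    have key := (convex_uIcc (0 : ℝ) h).norm_image_sub_le_of_norm_hasDerivWithin_le
      (f := R) (C := C * |h| ^ n) (fun t _ => (hd t).hasDerivWithinAt)
      (fun t ht => (hC x t).trans ?_) left_mem_uIcc right_mem_uIcc
    · have hR0 : R 0 = 0 := by
        simp [hR, Finset.sum_range_succ']
      rw [hR0, sub_zero, sub_zero, Real.norm_eq_abs, mul_assoc, ← pow_succ] at key
      exact key
    · have : |t| ≤ |h| := by
        simpa using abs_sub_left_of_mem_uIcc ht
      gcongr

end SmoothPeriodic

/-! ### Bounded functions along a filter -/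

section Bounded

variable {α : Type*} {l : Filter α} {f g : α → ℝ}

/-- The function `f` is bounded along the filter `l`. -/
def Bdd (l : Filter α) (f : α → ℝ) : Prop := f =O[l] fun _ => (1 : ℝ)

/-- Remainders are carried as exact terms `h ^ n * R (x, h)` with `R` bounded. Identities between
expansions then become ring identities, and the closure rules below bound the remainders that they
produce. -/
theorem Bdd.add (hf : Bdd l f) (hg : Bdd l g) : Bdd l fun a => f a + g a := IsBigO.add hf hg
theorem Bdd.sub (hf : Bdd l f) (hg : Bdd l g) : Bdd l fun a => f a - g a := IsBigO.sub hf hg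
theorem Bdd.mul (hf : Bdd l f) (hg : Bdd l g) : Bdd l fun a => f a * g a := by
  simpa [Bdd] using IsBigO.mul hf hg
theorem bdd_const (c : ℝ) : Bdd l fun _ => c := isBigO_const_const c one_ne_zero l
theorem Bdd.pow (hf : Bdd l f) (n : ℕ) : Bdd l fun a => f a ^ n := by
  simpa [Bdd] using IsBigO.pow hf n
theorem Bdd.div_const (hf : Bdd l f) (c : ℝ) : Bdd l fun a => f a / c := by
  simpa only [div_eq_mul_inv] using hf.mul (bdd_const c⁻¹)
theorem Bdd.comp {β : Type*} {m : Filter β} {u : β → α} (hf : Bdd l f) (hu : Tendsto u m l) :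
    Bdd m fun b => f (u b) := IsBigO.comp_tendsto hf hu

theorem Bdd.sum {ι : Type*} {f : ι → α → ℝ} {s : Finset ι} (h : ∀ i ∈ s, Bdd l (f i)) :
    Bdd l fun a => ∑ i ∈ s, f i a := IsBigO.fun_sum h
theorem Bdd.congr (hf : Bdd l f) (h : ∀ᶠ a in l, f a = g a) : Bdd l g :=
  IsBigO.congr' hf h EventuallyEq.rfl

theorem bdd_of_le {C : ℝ} (h : ∀ᶠ a in l, |f a| ≤ C) : Bdd l f :=
  IsBigO.of_bound C (by simpa using h)

theorem Bdd.div (hf : Bdd l f) {c : ℝ} (hc : 0 < c) (hg : ∀ᶠ a in l, c ≤ g a) :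
    Bdd l fun a => f a / g a := by
  have : Bdd l fun a => (g a)⁻¹ := by
    refine bdd_of_le (C := c⁻¹) ?_
    filter_upwards [hg] with a ha
    rw [abs_of_pos (inv_pos.2 (hc.trans_le ha))]
    exact inv_anti₀ hc ha
  simpa only [div_eq_mul_inv] using hf.mul this

/-- The filter of pairs `(x, h)` with `h → 0`, `h ≠ 0`, uniformly in `x`. -/
def stripFilter : Filter (ℝ × ℝ) := ⊤ ×ˢ 𝓝[≠] (0 : ℝ)

theorem eventually_stripFilter {p : ℝ × ℝ → Prop} :
    (∀ᶠ a in stripFilter, p a) ↔ ∃ δ > 0, ∀ x h, h ≠ 0 → |h| < δ → p (x, h) := by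
  rw [stripFilter, ((hasBasis_top (α := ℝ)).prod
    (nhdsWithin_hasBasis Metric.nhds_basis_ball _)).eventually_iff]
  constructor
  · rintro ⟨⟨_, δ⟩, ⟨-, hδ⟩, h⟩
    exact ⟨δ, hδ, fun x t h0 ht => h ⟨trivial, by simpa using ht, h0⟩⟩
  · rintro ⟨δ, hδ, h⟩
    exact ⟨⟨(), δ⟩, ⟨trivial, hδ⟩, fun {a} ha => h a.1 a.2 ha.2.2 (by simpa using ha.2.1)⟩

theorem SmoothPeriodic.bdd_fst {p : ℝ → ℝ} (hp : SmoothPeriodic p) :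
    Bdd stripFilter fun a => p a.1 := by
  obtain ⟨C, -, hC⟩ := hp.bounded
  exact bdd_of_le (C := C) (Eventually.of_forall fun a => hC a.1)

theorem SmoothPeriodic.bdd_comp {p : ℝ → ℝ} (hp : SmoothPeriodic p) (u : α → ℝ) :
    Bdd l fun a => p (u a) := by
  obtain ⟨C, -, hC⟩ := hp.bounded
  exact bdd_of_le (C := C) (Eventually.of_forall fun a => hC (u a))

theorem bdd_snd : Bdd stripFilter fun a => a.2 :=
  bdd_of_le (C := 1) (eventually_stripFilter.2 ⟨1, one_pos, fun _ _ _ h => h.le⟩)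

/-- Allows substitutions such as `(x, h) ↦ (x + h, -h)`, which reverses a chord: the base point may
move arbitrarily, since the filter is uniform in it. -/
theorem tendsto_stripFilter_of_le {u : ℝ × ℝ → ℝ × ℝ} {C : ℝ}
    (h : ∀ᶠ a in stripFilter, (u a).2 ≠ 0 ∧ |(u a).2| ≤ C * |a.2|) :
    Tendsto u stripFilter stripFilter := by
  intro s hs
  obtain ⟨δ, hδ, H⟩ := eventually_stripFilter.1 hs
  obtain ⟨ε, hε, H'⟩ := eventually_stripFilter.1 h
  have hC : 0 < |C| + 1 := by positivity
  refine eventually_stripFilter.2 ⟨min ε (δ / (|C| + 1)), by positivity, fun x t h0 ht => ?_⟩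
  have h1 := H' x t h0 (ht.trans_le (min_le_left _ _))
  refine H _ _ h1.1 (h1.2.trans_lt ?_)
  have h2 := ht.trans_le (min_le_right _ _)
  rw [lt_div_iff₀ hC] at h2
  refine lt_of_le_of_lt ?_ h2
  rw [mul_comm]
  have := le_abs_self C
  gcongr
  linarith

/-- A function that agrees with a polynomial up to order `n` has a bounded remainder quotient. -/
theorem bdd_div_pow_of_le {f : ℝ × ℝ → ℝ} {n : ℕ} {C : ℝ}
    (h : ∀ᶠ a in stripFilter, |f a| ≤ C * |a.2| ^ n) : Bdd stripFilter fun a => f a / a.2 ^ n := by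
  refine bdd_of_le (C := C) ?_
  have h0 : ∀ᶠ a in stripFilter, a.2 ≠ 0 :=
    eventually_stripFilter.2 ⟨1, one_pos, fun _ _ h _ => h⟩
  filter_upwards [h, h0] with a ha ha0
  have : 0 < |a.2| := abs_pos.2 ha0
  rw [abs_div, abs_pow, div_le_iff₀ (by positivity)]
  exact ha

theorem Bdd.exists_bound {f : ℝ × ℝ → ℝ} (hf : Bdd stripFilter f) :
    ∃ C > 0, ∃ δ > 0, ∀ x h, h ≠ 0 → |h| < δ → |f (x, h)| ≤ C := by
  obtain ⟨C, hC0, hC⟩ := IsBigO.exists_pos hf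
  obtain ⟨δ, hδ, H⟩ := eventually_stripFilter.1 hC.bound
  exact ⟨C, hC0, δ, hδ, fun x h h0 hh => by simpa using H x h h0 hh⟩

/-- If a polynomial of degree at most `4` is `O(t⁵)` as `t ↓ 0`, then it vanishes. -/
theorem coeff_eq_zero_of_bdd {c₁ c₂ c₃ c₄ : ℝ} {R : ℝ → ℝ} (hR : Bdd (𝓝[>] 0) R)
    (h : ∀ᶠ t in 𝓝[>] (0 : ℝ), c₁ * t + c₂ * t ^ 2 + c₃ * t ^ 3 + c₄ * t ^ 4 = t ^ 5 * R t) :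
    c₁ = 0 ∧ c₂ = 0 ∧ c₃ = 0 ∧ c₄ = 0 := by
  have hid : Tendsto (fun t : ℝ => t) (𝓝[>] 0) (𝓝 0) := tendsto_id.mono_left nhdsWithin_le_nhds
  have hpos : ∀ᶠ t in 𝓝[>] (0 : ℝ), 0 < t := self_mem_nhdsWithin
  have hidO : (fun t : ℝ => t) =o[𝓝[>] 0] fun _ => (1 : ℝ) := (isLittleO_one_iff ℝ).2 hid
  have hbt : Bdd (𝓝[>] 0) fun t : ℝ => t := hidO.isBigO
  -- The coefficients are peeled off one at a time: after division by the leading power, a constant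
  -- equals `t` times a bounded function and so is zero.
  have main : ∀ (c : ℝ) (Q : ℝ → ℝ), Bdd (𝓝[>] 0) Q → (∀ᶠ t in 𝓝[>] (0 : ℝ), c = t * Q t) →
      c = 0 := by
    intro c Q hQ hc
    have h1 : Tendsto (fun t => t * Q t) (𝓝[>] 0) (𝓝 0) := by
      refine (isLittleO_one_iff ℝ).1 ?_
      simpa using hidO.mul_isBigO hQ
    have h2 : Tendsto (fun t => t * Q t) (𝓝[>] 0) (𝓝 c) :=
      tendsto_const_nhds.congr' hc
    exact tendsto_nhds_unique h2 h1
  have e1 : c₁ = 0 := main c₁ (fun t => t ^ 3 * R t - c₂ - c₃ * t - c₄ * t ^ 2)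
    (by
      repeat' (first | with_reducible assumption | with_reducible exact bdd_const _ |
        apply Bdd.pow | with_reducible apply Bdd.add | with_reducible apply Bdd.sub |
        with_reducible apply Bdd.mul)) (by
      filter_upwards [h, hpos] with t ht h0
      have := h0.ne'
      apply mul_left_cancel₀ this; linear_combination ht)
  subst e1
  have e2 : c₂ = 0 := main c₂ (fun t => t ^ 2 * R t - c₃ - c₄ * t)
    (by
      repeat' (first | with_reducible assumption | with_reducible exact bdd_const _ |
        apply Bdd.pow | with_reducible apply Bdd.add | with_reducible apply Bdd.sub |
        with_reducible apply Bdd.mul)) (by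
      filter_upwards [h, hpos] with t ht h0
      have := (pow_pos h0 2).ne'
      apply mul_left_cancel₀ this; linear_combination ht)
  subst e2
  have e3 : c₃ = 0 := main c₃ (fun t => t * R t - c₄)
    (by
      repeat' (first | with_reducible assumption | with_reducible exact bdd_const _ |
        apply Bdd.pow | with_reducible apply Bdd.add | with_reducible apply Bdd.sub |
        with_reducible apply Bdd.mul)) (by
      filter_upwards [h, hpos] with t ht h0
      have := (pow_pos h0 3).ne'
      apply mul_left_cancel₀ this; linear_combination ht)
  subst e3
  have e4 : c₄ = 0 := main c₄ R hR (by
      filter_upwards [h, hpos] with t ht h0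
      have := (pow_pos h0 4).ne'
      apply mul_left_cancel₀ this; linear_combination ht)
  exact ⟨rfl, rfl, rfl, e4⟩

end Bounded

/-- The difference has derivative `-u⁶ / (1 + u²)`, of absolute value at most `u⁶`. -/
theorem abs_arctan_sub_le (t : ℝ) :
    |Real.arctan t - (t - t ^ 3 / 3 + t ^ 5 / 5)| ≤ |t| ^ 7 := by
  have hd : ∀ u, HasDerivAt (fun t : ℝ => Real.arctan t - (t - t ^ 3 / 3 + t ^ 5 / 5))
      (-(u ^ 6 / (1 + u ^ 2))) u := by
    intro u
    have h1 := (Real.hasDerivAt_arctan u).sub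
      (((hasDerivAt_id u).sub ((hasDerivAt_pow 3 u).div_const 3)).add
        ((hasDerivAt_pow 5 u).div_const 5))
    refine h1.congr_deriv ?_
    have : (1 + u ^ 2) ≠ 0 := by positivity
    field_simp
    ring
  have key := (convex_uIcc (0 : ℝ) t).norm_image_sub_le_of_norm_hasDerivWithin_le
      (C := |t| ^ 6) (fun u _ => (hd u).hasDerivWithinAt) (fun u hu => ?_)
      left_mem_uIcc right_mem_uIcc
  · simpa [← pow_succ] using key
  · have : |u| ≤ |t| := by simpa using abs_sub_left_of_mem_uIcc hu
    rw [norm_neg, norm_div, norm_pow, Real.norm_eq_abs]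
    refine (div_le_self (by positivity) ?_).trans (by gcongr)
    rw [Real.norm_of_nonneg (by positivity)]
    nlinarith [sq_nonneg u]

/-! ### Curves in the Lazutkin parametrization -/

/-- A closed curve `Γ` with unit tangent `E`, parametrized so that its speed is `c r²`
and its curvature `r⁻³`. -/
structure LazutkinCurve (c : ℝ) (r : ℝ → ℝ) (Γ E : ℝ → ℂ) : Prop where
  c_pos : 0 < c
  smooth_r : SmoothPeriodic r
  r_pos : ∀ x, 0 < r x
  smooth_Γ : SmoothPeriodic Γ
  smooth_E : SmoothPeriodic E
  hasDerivAt_Γ : ∀ x, HasDerivAt Γ ((c * r x ^ 2 : ℝ) * E x) x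
  hasDerivAt_E : ∀ x, HasDerivAt E (Complex.I * (c / r x : ℝ) * E x) x
  norm_E : ∀ x, ‖E x‖ = 1

/-- The potential whose derivative governs the fourth order term of the chord angle. -/
noncomputable def potential (c : ℝ) (r : ℝ → ℝ) (x : ℝ) : ℝ :=
  (1 / 60) * (2 * deriv (deriv r) x / r x - 4 * deriv r x ^ 2 / r x ^ 2 - c ^ 2 / (4 * r x ^ 2))

/-- The chord from `Γ x` to `Γ (x + h)`, in the frame of the tangent at `Γ x`. -/
noncomputable def frameChord (Γ E : ℝ → ℂ) (x h : ℝ) : ℂ :=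
  (starRingEnd ℂ) (E x) * (Γ (x + h) - Γ x)

/-- The signed angle between the chord from `Γ x` to `Γ (x + h)` and the tangent at `Γ x`. -/
noncomputable def chordAngle (Γ E : ℝ → ℂ) (x h : ℝ) : ℝ :=
  Real.arctan ((frameChord Γ E x h).im / (frameChord Γ E x h).re)

/-- The `j`-th derivative of `Γ`, in the frame of its tangent. -/
noncomputable def frameDeriv (Γ E : ℝ → ℂ) (j : ℕ) (x : ℝ) : ℂ :=
  (starRingEnd ℂ) (E x) * iteratedDeriv j Γ x

theorem smoothPeriodic_potential {c : ℝ} {r : ℝ → ℝ} (hr : SmoothPeriodic r)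
    (hpos : ∀ x, 0 < r x) : SmoothPeriodic (potential c r) := by
  have h0 : ∀ x, r x ≠ 0 := fun x => (hpos x).ne'
  have h1 : ∀ x, r x ^ 2 ≠ 0 := fun x => pow_ne_zero _ (h0 x)
  exact (smoothPeriodic_const _).mul (((((smoothPeriodic_const 2).mul hr.deriv.deriv).div hr h0).sub
    (((smoothPeriodic_const 4).mul (hr.deriv.pow 2)).div (hr.pow 2) h1)).sub
    ((smoothPeriodic_const (c ^ 2)).div ((smoothPeriodic_const 4).mul (hr.pow 2))
      fun x => mul_ne_zero four_ne_zero (h1 x)))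

theorem deriv_potential {c : ℝ} {r : ℝ → ℝ} (hr : SmoothPeriodic r) (hpos : ∀ x, 0 < r x)
    (x : ℝ) : deriv (potential c r) x = (1 / 60) * (2 * deriv (deriv (deriv r)) x / r x
      - 10 * deriv r x * deriv (deriv r) x / r x ^ 2 + 8 * deriv r x ^ 3 / r x ^ 3
      + c ^ 2 * deriv r x / (2 * r x ^ 3)) := by
  have h0 : r x ≠ 0 := (hpos x).ne'
  have d0 := hr.hasDerivAt x
  have d1 := hr.deriv.hasDerivAt x
  have d2 := hr.deriv.deriv.hasDerivAt x
  have := ((((d2.const_mul 2).div d0 h0).sub (((d1.pow 2).const_mul 4).div (d0.pow 2)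
    (pow_ne_zero _ h0))).sub ((hasDerivAt_const x (c ^ 2)).div ((d0.pow 2).const_mul 4)
      (by simpa using h0))).const_mul (1 / 60)
  refine this.deriv.trans ?_
  simp only [Pi.pow_apply]
  field_simp
  ring

namespace LazutkinCurve

variable {c : ℝ} {r : ℝ → ℝ} {Γ E : ℝ → ℂ}

/-- The conjugate tangent rotates at the rate `-c / r`. Read backwards, this is a recursion that
expresses the derivatives of the curve, in the moving frame, through `r` and its derivatives; it
yields the Taylor coefficients of the chord. -/
theorem hasDerivAt_frameDeriv (H : LazutkinCurve c r Γ E) (j : ℕ) (x : ℝ) :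
    HasDerivAt (frameDeriv Γ E j)
      (frameDeriv Γ E (j + 1) x - Complex.I * (c / r x : ℝ) * frameDeriv Γ E j x) x := by
  have h1 : HasDerivAt (fun x => (starRingEnd ℂ) (E x))
      ((starRingEnd ℂ) (Complex.I * (c / r x : ℝ) * E x)) x := (H.hasDerivAt_E x).star
  have h2 := (H.smooth_Γ.iteratedDeriv j).hasDerivAt x
  refine (h1.mul h2).congr_deriv ?_
  simp only [frameDeriv, iteratedDeriv_succ, map_mul, Complex.conj_I, Complex.conj_ofReal]
  ring

theorem smoothPeriodic_frameDeriv (H : LazutkinCurve c r Γ E) (j : ℕ) :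
    SmoothPeriodic (frameDeriv Γ E j) :=
  (H.smooth_E.clm_comp (Complex.conjCLE : ℂ →L[ℝ] ℂ)).mul (H.smooth_Γ.iteratedDeriv j)

theorem frameDeriv_succ_of_hasDerivAt (H : LazutkinCurve c r Γ E) {j : ℕ} {p q : ℝ → ℝ}
    {x p' q' : ℝ}
    (hp : ∀ x, (frameDeriv Γ E j x).re = p x) (hq : ∀ x, (frameDeriv Γ E j x).im = q x)
    (hp' : HasDerivAt p p' x) (hq' : HasDerivAt q q' x) :
    (frameDeriv Γ E (j + 1) x).re = p' - c / r x * q x ∧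
      (frameDeriv Γ E (j + 1) x).im = q' + c / r x * p x := by
  have h := H.hasDerivAt_frameDeriv j x
  have hre : HasDerivAt (fun x => (frameDeriv Γ E j x).re) _ x :=
    Complex.reCLM.hasFDerivAt.comp_hasDerivAt x h
  have him : HasDerivAt (fun x => (frameDeriv Γ E j x).im) _ x :=
    Complex.imCLM.hasFDerivAt.comp_hasDerivAt x h
  rw [funext hp] at hre
  rw [funext hq] at him
  have e1 := hp'.unique hre
  have e2 := hq'.unique him
  simp only [Complex.reCLM_apply, Complex.imCLM_apply, Complex.sub_re, Complex.sub_im,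
    Complex.mul_re, Complex.mul_im, Complex.I_re, Complex.I_im, Complex.ofReal_re,
    Complex.ofReal_im, hp, hq] at e1 e2
  constructor <;> linarith

theorem frameDeriv_one (H : LazutkinCurve c r Γ E) (x : ℝ) :
    (frameDeriv Γ E 1 x).re = c * r x ^ 2 ∧ (frameDeriv Γ E 1 x).im = 0 := by
  have : frameDeriv Γ E 1 x = ((c * r x ^ 2 : ℝ) : ℂ) := by
    have h : (starRingEnd ℂ) (E x) * E x = 1 := by
      rw [mul_comm, Complex.mul_conj, Complex.normSq_eq_norm_sq, H.norm_E]; simp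
    rw [frameDeriv, iteratedDeriv_one, (H.hasDerivAt_Γ x).deriv, mul_left_comm, h, mul_one]
  rw [this]
  exact ⟨Complex.ofReal_re _, Complex.ofReal_im _⟩

theorem frameDeriv_two (H : LazutkinCurve c r Γ E) (x : ℝ) :
    (frameDeriv Γ E 2 x).re = 2 * c * r x * deriv r x ∧ (frameDeriv Γ E 2 x).im = c ^ 2 * r x := by
  have h0 : r x ≠ 0 := (H.r_pos x).ne'
  have d0 := H.smooth_r.hasDerivAt x
  obtain ⟨h1, h2⟩ := H.frameDeriv_succ_of_hasDerivAt (fun x => (H.frameDeriv_one x).1)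
    (fun x => (H.frameDeriv_one x).2) ((d0.pow 2).const_mul c) (hasDerivAt_const x (0 : ℝ))
  constructor
  · rw [h1]; simp; ring
  · rw [h2]; field_simp; ring

theorem frameDeriv_three (H : LazutkinCurve c r Γ E) (x : ℝ) :
    (frameDeriv Γ E 3 x).re = 2 * c * (deriv r x ^ 2 + r x * deriv (deriv r) x) - c ^ 3 ∧
      (frameDeriv Γ E 3 x).im = 3 * c ^ 2 * deriv r x := by
  have h0 : r x ≠ 0 := (H.r_pos x).ne'
  have d0 := H.smooth_r.hasDerivAt x
  have d1 := H.smooth_r.deriv.hasDerivAt x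
  obtain ⟨h1, h2⟩ := H.frameDeriv_succ_of_hasDerivAt (fun x => (H.frameDeriv_two x).1)
    (fun x => (H.frameDeriv_two x).2) ((d0.const_mul (2 * c)).mul d1) (d0.const_mul (c ^ 2))
  constructor
  · rw [h1]; field_simp
  · rw [h2]; field_simp; ring

theorem frameDeriv_four (H : LazutkinCurve c r Γ E) (x : ℝ) :
    (frameDeriv Γ E 4 x).re = 2 * c * (3 * deriv r x * deriv (deriv r) x
        + r x * deriv (deriv (deriv r)) x) - 3 * c ^ 3 * deriv r x / r x ∧
      (frameDeriv Γ E 4 x).im = c ^ 2 * (5 * deriv (deriv r) x + 2 * (deriv r x ^ 2 / r x))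
        - c ^ 4 / r x := by
  have h0 : r x ≠ 0 := (H.r_pos x).ne'
  have d0 := H.smooth_r.hasDerivAt x
  have d1 := H.smooth_r.deriv.hasDerivAt x
  have d2 := H.smooth_r.deriv.deriv.hasDerivAt x
  obtain ⟨h1, h2⟩ := H.frameDeriv_succ_of_hasDerivAt (fun x => (H.frameDeriv_three x).1)
    (fun x => (H.frameDeriv_three x).2)
    ((((d1.pow 2).add (d0.mul d2)).const_mul (2 * c)).sub_const (c ^ 3))
    (d1.const_mul (3 * c ^ 2))
  constructor
  · rw [h1]; field_simp; ring
  · rw [h2]; field_simp; ring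

/-- The real part of order five and both parts of order six only enter the coefficient `A₅` of the
chord angle, for which no formula is needed. -/
theorem frameDeriv_five_im (H : LazutkinCurve c r Γ E) (x : ℝ) :
    (frameDeriv Γ E 5 x).im = c ^ 2 * (7 * deriv (deriv (deriv r)) x
      + 10 * deriv r x * deriv (deriv r) x / r x - 2 * deriv r x ^ 3 / r x ^ 2)
        - 2 * c ^ 4 * deriv r x / r x ^ 2 := by
  have h0 : r x ≠ 0 := (H.r_pos x).ne'
  have d0 := H.smooth_r.hasDerivAt x
  have d1 := H.smooth_r.deriv.hasDerivAt x
  have d2 := H.smooth_r.deriv.deriv.hasDerivAt x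
  have d3 := H.smooth_r.deriv.deriv.deriv.hasDerivAt x
  have hre := H.smoothPeriodic_frameDeriv 4 |>.re.hasDerivAt x
  rw [funext fun x => (H.frameDeriv_four x).1] at hre
  obtain ⟨-, h2⟩ := H.frameDeriv_succ_of_hasDerivAt (fun x => (H.frameDeriv_four x).1)
    (fun x => (H.frameDeriv_four x).2) hre
    ((((d2.const_mul 5).add (((d1.pow 2).div d0 h0).const_mul 2)).const_mul (c ^ 2)).sub
      ((hasDerivAt_const x (c ^ 4)).div d0 h0))
  rw [h2]
  simp only [Pi.pow_apply]
  field_simp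
  ring

/-- Uniform Taylor expansion of the chord. -/
theorem exists_frameChord_taylor (H : LazutkinCurve c r Γ E) (n : ℕ) : ∃ C, 0 < C ∧ ∀ x h : ℝ,
    ‖frameChord Γ E x h - ∑ j ∈ Finset.range n,
      ((h ^ (j + 1) / (j + 1).factorial : ℝ) : ℂ) * frameDeriv Γ E (j + 1) x‖
        ≤ C * |h| ^ (n + 1) := by
  obtain ⟨C, hC, h⟩ := H.smooth_Γ.taylor (n + 1)
  refine ⟨C, hC, fun x t => le_of_eq_of_le ?_ (h x t)⟩
  have e : frameChord Γ E x t - ∑ j ∈ Finset.range n,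
      ((t ^ (j + 1) / (j + 1).factorial : ℝ) : ℂ) * frameDeriv Γ E (j + 1) x
      = (starRingEnd ℂ) (E x) * (Γ (x + t) - ∑ j ∈ Finset.range (n + 1),
        (t ^ j / j.factorial) • iteratedDeriv j Γ x) := by
    rw [Finset.sum_range_succ']
    simp only [frameChord, frameDeriv, Complex.real_smul, pow_zero, Nat.factorial_zero,
      Nat.cast_one, div_one, Complex.ofReal_one, one_mul, iteratedDeriv_zero]
    rw [mul_sub, mul_sub, mul_add, Finset.mul_sum, Finset.sum_congr rfl fun j _ =>
      mul_left_comm ((t ^ (j + 1) / (j + 1).factorial : ℝ) : ℂ) ((starRingEnd ℂ) (E x))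
        (iteratedDeriv (j + 1) Γ x)]
    ring
  rw [e, norm_mul, RCLike.norm_conj, H.norm_E, one_mul]

end LazutkinCurve

/-! ### Fourth order expansion of the chord angle -/

theorem eventually_snd_ne_zero : ∀ᶠ a in stripFilter, a.2 ≠ 0 :=
  eventually_stripFilter.2 ⟨1, one_pos, fun _ _ h _ => h⟩

theorem tendsto_stripFilter_neg :
    Tendsto (fun a : ℝ × ℝ => (a.1, -a.2)) stripFilter stripFilter :=
  tendsto_stripFilter_of_le (C := 1) (by
    filter_upwards [eventually_snd_ne_zero] with a ha
    simpa using ha)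

theorem tendsto_stripFilter_reverse :
    Tendsto (fun a : ℝ × ℝ => (a.1 + a.2, -a.2)) stripFilter stripFilter :=
  tendsto_stripFilter_of_le (C := 1) (by
    filter_upwards [eventually_snd_ne_zero] with a ha
    simpa using ha)

theorem Bdd.eventually_abs_snd_mul_lt {f : ℝ × ℝ → ℝ} (hf : Bdd stripFilter f) {ε : ℝ}
    (hε : 0 < ε) : ∀ᶠ a in stripFilter, |a.2 * f a| < ε := by
  obtain ⟨C, hC, δ, hδ, h⟩ := hf.exists_bound
  refine eventually_stripFilter.2 ⟨min δ (ε / C), by positivity, fun x t h0 ht => ?_⟩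
  have h1 := h x t h0 (ht.trans_le (min_le_left _ _))
  have h2 := ht.trans_le (min_le_right _ _)
  rw [lt_div_iff₀ hC] at h2
  rw [abs_mul]
  calc |t| * |f (x, t)| ≤ |t| * C := by gcongr
    _ < ε := h2

/-- Expansion of `arctan (N / M)` from expansions of the quotients `N / h` and `M / h`. -/
theorem bdd_arctan_expansion {Nq Mq : ℝ × ℝ → ℝ} {m₁ m₂ m₃ m₄ m₅ n₂ n₃ n₄ n₅ n₆ : ℝ → ℝ}
    {μ ν : ℝ × ℝ → ℝ} {t₁ t₃ t₄ t₅ : ℝ → ℝ} {k : ℝ} (hk : 0 < k)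
    (hm : ∀ᶠ a in stripFilter, k ≤ Mq a)
    (hM : ∀ᶠ a in stripFilter, Mq a = m₁ a.1 + m₂ a.1 * a.2 + m₃ a.1 * a.2 ^ 2 + m₄ a.1 * a.2 ^ 3
      + m₅ a.1 * a.2 ^ 4 + a.2 ^ 5 * μ a)
    (hN : ∀ᶠ a in stripFilter, Nq a = n₂ a.1 * a.2 + n₃ a.1 * a.2 ^ 2 + n₄ a.1 * a.2 ^ 3
      + n₅ a.1 * a.2 ^ 4 + n₆ a.1 * a.2 ^ 5 + a.2 ^ 6 * ν a)
    (hμ : Bdd stripFilter μ) (hν : Bdd stripFilter ν)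
    (hm₂ : SmoothPeriodic m₂) (hm₃ : SmoothPeriodic m₃)
    (hm₄ : SmoothPeriodic m₄) (hm₅ : SmoothPeriodic m₅)
    (ht₁ : SmoothPeriodic t₁) (ht₃ : SmoothPeriodic t₃) (ht₄ : SmoothPeriodic t₄)
    (ht₅ : SmoothPeriodic t₅)
    (e₂ : ∀ x, n₂ x = t₁ x * m₁ x) (e₃ : ∀ x, n₃ x = t₁ x * m₂ x)
    (e₄ : ∀ x, n₄ x = t₁ x * m₃ x + t₃ x * m₁ x)
    (e₅ : ∀ x, n₅ x = t₁ x * m₄ x + t₃ x * m₂ x + t₄ x * m₁ x)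
    (e₆ : ∀ x, n₆ x = t₁ x * m₅ x + t₃ x * m₃ x + t₄ x * m₂ x + t₅ x * m₁ x) :
    Bdd stripFilter fun a => (Real.arctan (Nq a / Mq a) - (t₁ a.1 * a.2
      + (t₃ a.1 - t₁ a.1 ^ 3 / 3) * a.2 ^ 3 + t₄ a.1 * a.2 ^ 4
      + (t₅ a.1 - t₁ a.1 ^ 2 * t₃ a.1 + t₁ a.1 ^ 5 / 5) * a.2 ^ 5)) / a.2 ^ 6 := by
  have bm₂ := hm₂.bdd_fst
  have bm₃ := hm₃.bdd_fst
  have bm₄ := hm₄.bdd_fst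
  have bm₅ := hm₅.bdd_fst
  have bt₁ := ht₁.bdd_fst
  have bt₃ := ht₃.bdd_fst
  have bt₄ := ht₄.bdd_fst
  have bt₅ := ht₅.bdd_fst
  have bh := bdd_snd
  -- `K` is the remainder of the polynomial division: `N / M = t₁ h + t₃ h³ + t₄ h⁴ + t₅ h⁵ + h⁶ K`.
  -- The missing `h²` term is the content of the hypothesis `e₃`.
  obtain ⟨K, hK⟩ : ∃ K : ℝ × ℝ → ℝ, K = fun a => (ν a - t₁ a.1 * μ a
    - t₃ a.1 * (m₄ a.1 + m₅ a.1 * a.2 + a.2 ^ 2 * μ a)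
    - t₄ a.1 * (m₃ a.1 + m₄ a.1 * a.2 + m₅ a.1 * a.2 ^ 2 + a.2 ^ 3 * μ a)
    - t₅ a.1 * (m₂ a.1 + m₃ a.1 * a.2 + m₄ a.1 * a.2 ^ 2 + m₅ a.1 * a.2 ^ 3 + a.2 ^ 4 * μ a)) / Mq a
    := ⟨_, rfl⟩
  have bK : Bdd stripFilter K := by
    rw [hK]
    refine Bdd.div ?_ hk hm
    repeat' first | with_reducible assumption | with_reducible exact bdd_const _ | apply Bdd.pow |
      with_reducible apply Bdd.add | with_reducible apply Bdd.sub | with_reducible apply Bdd.mul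
  obtain ⟨ρ, hρ⟩ : ∃ ρ : ℝ × ℝ → ℝ, ρ = fun a =>
    t₃ a.1 + t₄ a.1 * a.2 + t₅ a.1 * a.2 ^ 2 + a.2 ^ 3 * K a := ⟨_, rfl⟩
  have bρ : Bdd stripFilter ρ := by
    rw [hρ]
    repeat' first | with_reducible assumption | with_reducible exact bdd_const _ | apply Bdd.pow |
      with_reducible apply Bdd.add | with_reducible apply Bdd.sub | with_reducible apply Bdd.mul
  have hq : ∀ᶠ a in stripFilter, Nq a / Mq a = a.2 * (t₁ a.1 + a.2 ^ 2 * ρ a) := by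
    filter_upwards [hM, hN, hm] with a hMa hNa hma
    have h0 : Mq a ≠ 0 := (hk.trans_le hma).ne'
    have hKa : Mq a * K a = ν a - t₁ a.1 * μ a
      - t₃ a.1 * (m₄ a.1 + m₅ a.1 * a.2 + a.2 ^ 2 * μ a)
      - t₄ a.1 * (m₃ a.1 + m₄ a.1 * a.2 + m₅ a.1 * a.2 ^ 2 + a.2 ^ 3 * μ a)
      - t₅ a.1 * (m₂ a.1 + m₃ a.1 * a.2 + m₄ a.1 * a.2 ^ 2 + m₅ a.1 * a.2 ^ 3
        + a.2 ^ 4 * μ a) := by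
      rw [hK]; field_simp
    rw [div_eq_iff h0]
    have : a.2 * (t₁ a.1 + a.2 ^ 2 * ρ a) * Mq a = (a.2 * t₁ a.1 + a.2 ^ 3 * t₃ a.1
        + a.2 ^ 4 * t₄ a.1 + a.2 ^ 5 * t₅ a.1) * Mq a + a.2 ^ 6 * (Mq a * K a) := by
      rw [hρ]; ring
    rw [this, hKa, hNa, hMa, e₂, e₃, e₄, e₅, e₆]
    ring
  obtain ⟨κ, hκ⟩ : ∃ κ : ℝ × ℝ → ℝ, κ = fun a => t₁ a.1 + a.2 ^ 2 * ρ a := ⟨_, rfl⟩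
  have bκ : Bdd stripFilter κ := by
    rw [hκ]
    repeat' first | with_reducible assumption | with_reducible exact bdd_const _ | apply Bdd.pow |
      with_reducible apply Bdd.add | with_reducible apply Bdd.sub | with_reducible apply Bdd.mul
  have b7 : Bdd stripFilter fun a => (Real.arctan (a.2 * κ a) - (a.2 * κ a
      - (a.2 * κ a) ^ 3 / 3 + (a.2 * κ a) ^ 5 / 5)) / a.2 ^ 6 := by
    obtain ⟨C, hC, δ, hδ, h⟩ := bκ.exists_bound
    refine bdd_div_pow_of_le (C := C ^ 7) (eventually_stripFilter.2
      ⟨min δ 1, by positivity, fun x t h0 ht => (abs_arctan_sub_le _).trans ?_⟩)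
    have h1 := h x t h0 (ht.trans_le (min_le_left _ _))
    have h2 := ht.trans_le (min_le_right _ _)
    rw [abs_mul, mul_pow, mul_comm]
    have h3 : |t| ^ 7 ≤ |t| ^ 6 := pow_le_pow_of_le_one (abs_nonneg _) h2.le (by norm_num)
    have h4 : |κ (x, t)| ^ 7 ≤ C ^ 7 := by gcongr
    exact mul_le_mul h4 h3 (by positivity) (by positivity)
  -- What is left at order `h⁶` and beyond when the cube and the fifth power of `N / M = h (t₁ + h²
  -- ρ)` are expanded in `ρ`.
  have b8 : Bdd stripFilter fun a => K a - (3 * t₁ a.1 ^ 2 * (t₄ a.1 + t₅ a.1 * a.2 + a.2 ^ 2 * K a)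
      + 3 * t₁ a.1 * a.2 * ρ a ^ 2 + a.2 ^ 3 * ρ a ^ 3) / 3
      + (5 * t₁ a.1 ^ 4 * a.2 * ρ a + 10 * t₁ a.1 ^ 3 * a.2 ^ 3 * ρ a ^ 2
        + 10 * t₁ a.1 ^ 2 * a.2 ^ 5 * ρ a ^ 3 + 5 * t₁ a.1 * a.2 ^ 7 * ρ a ^ 4
        + a.2 ^ 9 * ρ a ^ 5) / 5 := by
    repeat' first | with_reducible assumption | with_reducible exact bdd_const _ | apply Bdd.pow |
      with_reducible apply Bdd.add | with_reducible apply Bdd.sub | with_reducible apply Bdd.mul |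
      with_reducible apply Bdd.div_const
  refine IsBigO.congr' (b7.add b8) ?_ EventuallyEq.rfl
  filter_upwards [hq, eventually_snd_ne_zero] with a ha h0
  rw [ha]
  simp only [hκ]
  have h6 : a.2 ^ 6 ≠ 0 := pow_ne_zero _ h0
  rw [div_add' _ _ _ h6]
  congr 1
  rw [hρ]
  ring

/-- The chord angle has the expansion `A₁ h + A₃ h³ + A₁ B' h⁴ + A₅ h⁵ + O(h⁶)`
with `A₁ = c / (2 r)` and `B` the potential. -/
theorem LazutkinCurve.exists_chordAngle_expansion {c : ℝ} {r : ℝ → ℝ} {Γ E : ℝ → ℂ}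
    (H : LazutkinCurve c r Γ E) :
    (∀ᶠ a in stripFilter, 0 < (frameChord Γ E a.1 a.2).re / a.2 ∧
      0 < (frameChord Γ E a.1 a.2).im) ∧
    ∃ A₃ A₅ : ℝ → ℝ, SmoothPeriodic A₃ ∧ SmoothPeriodic A₅ ∧
      Bdd stripFilter fun a => (chordAngle Γ E a.1 a.2 - (c / (2 * r a.1) * a.2 + A₃ a.1 * a.2 ^ 3
        + c / (2 * r a.1) * deriv (potential c r) a.1 * a.2 ^ 4 + A₅ a.1 * a.2 ^ 5)) / a.2 ^ 6 := by
  have hc := H.c_pos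
  have sm : ∀ j : ℕ, SmoothPeriodic fun x => (frameDeriv Γ E j x).re / j.factorial := fun j =>
    (H.smoothPeriodic_frameDeriv j).re.div (smoothPeriodic_const _) fun _ => by positivity
  have sn : ∀ j : ℕ, SmoothPeriodic fun x => (frameDeriv Γ E j x).im / j.factorial := fun j =>
    (H.smoothPeriodic_frameDeriv j).im.div (smoothPeriodic_const _) fun _ => by positivity
  set m : ℕ → ℝ → ℝ := fun j x => (frameDeriv Γ E j x).re / j.factorial with hmdef
  set n : ℕ → ℝ → ℝ := fun j x => (frameDeriv Γ E j x).im / j.factorial with hndef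
  have hm1 : ∀ x, m 1 x = c * r x ^ 2 := fun x => by simp [hmdef, (H.frameDeriv_one x).1]
  have hm1pos : ∀ x, 0 < m 1 x := fun x => by
    rw [hm1]; have := H.r_pos x; positivity
  have hn1 : ∀ x, n 1 x = 0 := fun x => by simp [hndef, (H.frameDeriv_one x).2]
  have hn2 : ∀ x, n 2 x = c ^ 2 * r x / 2 := fun x => by simp [hndef, (H.frameDeriv_two x).2]
  have hn2pos : ∀ x, 0 < n 2 x := fun x => by
    rw [hn2]; have := H.r_pos x; positivity
  set Mq : ℝ × ℝ → ℝ := fun a => (frameChord Γ E a.1 a.2).re / a.2 with hMq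
  set Nq : ℝ × ℝ → ℝ := fun a => (frameChord Γ E a.1 a.2).im / a.2 with hNq
  set μ : ℝ × ℝ → ℝ := fun a => ((frameChord Γ E a.1 a.2).re - (m 1 a.1 * a.2 + m 2 a.1 * a.2 ^ 2
    + m 3 a.1 * a.2 ^ 3 + m 4 a.1 * a.2 ^ 4 + m 5 a.1 * a.2 ^ 5)) / a.2 ^ 6 with hμ
  set ν : ℝ × ℝ → ℝ := fun a => ((frameChord Γ E a.1 a.2).im - (n 2 a.1 * a.2 ^ 2
    + n 3 a.1 * a.2 ^ 3 + n 4 a.1 * a.2 ^ 4 + n 5 a.1 * a.2 ^ 5 + n 6 a.1 * a.2 ^ 6)) / a.2 ^ 7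
    with hν
  have bμ : Bdd stripFilter μ := by
    obtain ⟨C, -, hC⟩ := H.exists_frameChord_taylor 5
    refine bdd_div_pow_of_le (C := C) (Eventually.of_forall fun a => ?_)
    refine le_trans (le_of_eq_of_le ?_ (Complex.abs_re_le_norm _)) (hC a.1 a.2)
    congr 1
    simp only [Finset.sum_range_succ, Finset.sum_range_zero, Complex.sub_re, Complex.add_re,
      Complex.re_ofReal_mul, Complex.zero_re, hmdef]
    ring
  have bν : Bdd stripFilter ν := by
    obtain ⟨C, -, hC⟩ := H.exists_frameChord_taylor 6
    refine bdd_div_pow_of_le (C := C) (Eventually.of_forall fun a => ?_)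
    refine le_trans (le_of_eq_of_le ?_ (Complex.abs_im_le_norm _)) (hC a.1 a.2)
    congr 1
    simp only [Finset.sum_range_succ, Finset.sum_range_zero, Complex.sub_im, Complex.add_im,
      Complex.im_ofReal_mul, hndef, (H.frameDeriv_one a.1).2, zero_add]
    ring
  have hM : ∀ᶠ a in stripFilter, Mq a = m 1 a.1 + m 2 a.1 * a.2 + m 3 a.1 * a.2 ^ 2
      + m 4 a.1 * a.2 ^ 3 + m 5 a.1 * a.2 ^ 4 + a.2 ^ 5 * μ a := by
    filter_upwards [eventually_snd_ne_zero] with a h0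
    simp only [hMq, hμ]
    field_simp
    ring
  have hN : ∀ᶠ a in stripFilter, Nq a = n 2 a.1 * a.2 + n 3 a.1 * a.2 ^ 2 + n 4 a.1 * a.2 ^ 3
      + n 5 a.1 * a.2 ^ 4 + n 6 a.1 * a.2 ^ 5 + a.2 ^ 6 * ν a := by
    filter_upwards [eventually_snd_ne_zero] with a h0
    simp only [hNq, hν]
    field_simp
    ring
  have bh := bdd_snd
  obtain ⟨k, hk, hkm⟩ := (sm 1).exists_pos_le hm1pos
  obtain ⟨k', hk', hkn⟩ := (sn 2).exists_pos_le hn2pos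
  -- The leading coefficient `c r²` is bounded below by periodicity; half of that bound survives the
  -- remainder for short chords. The positive imaginary part below comes from `c² r / 2` in the same
  -- way.
  have hMk : ∀ᶠ a in stripFilter, k / 2 ≤ Mq a := by
    have b : Bdd stripFilter fun a => m 2 a.1 + m 3 a.1 * a.2 + m 4 a.1 * a.2 ^ 2
        + m 5 a.1 * a.2 ^ 3 + a.2 ^ 4 * μ a := by
      have b2 := (sm 2).bdd_fst
      have b3 := (sm 3).bdd_fst
      have b4 := (sm 4).bdd_fst
      have b5 := (sm 5).bdd_fst
      repeat' first | with_reducible assumption | with_reducible exact bdd_const _ | apply Bdd.pow |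
        with_reducible apply Bdd.add | with_reducible apply Bdd.sub | with_reducible apply Bdd.mul
    filter_upwards [hM, b.eventually_abs_snd_mul_lt (half_pos hk)] with a ha hb
    have h1 : k ≤ m 1 a.1 := hkm a.1
    have h2 := (abs_lt.1 hb).1
    rw [ha]
    nlinarith
  have hNk : ∀ᶠ a in stripFilter, 0 < (frameChord Γ E a.1 a.2).im := by
    have b : Bdd stripFilter fun a => n 3 a.1 + n 4 a.1 * a.2 + n 5 a.1 * a.2 ^ 2
        + n 6 a.1 * a.2 ^ 3 + a.2 ^ 4 * ν a := by
      have b2 := (sn 6).bdd_fst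
      have b3 := (sn 3).bdd_fst
      have b4 := (sn 4).bdd_fst
      have b5 := (sn 5).bdd_fst
      repeat' first | with_reducible assumption | with_reducible exact bdd_const _ | apply Bdd.pow |
        with_reducible apply Bdd.add | with_reducible apply Bdd.sub | with_reducible apply Bdd.mul
    filter_upwards [hN, b.eventually_abs_snd_mul_lt hk', eventually_snd_ne_zero] with a ha hb h0
    have h1 : k' ≤ n 2 a.1 := hkn a.1
    have h2 := (abs_lt.1 hb).1
    have h3 : (frameChord Γ E a.1 a.2).im = a.2 ^ 2 * (n 2 a.1 + a.2 * (n 3 a.1 + n 4 a.1 * a.2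
        + n 5 a.1 * a.2 ^ 2 + n 6 a.1 * a.2 ^ 3 + a.2 ^ 4 * ν a)) := by
      have : (frameChord Γ E a.1 a.2).im = Nq a * a.2 := by simp only [hNq]; field_simp
      rw [this, ha]; ring
    rw [h3]
    have : 0 < a.2 ^ 2 := by positivity
    exact mul_pos this (by linarith)
  refine ⟨?_, ?_⟩
  · filter_upwards [hMk, hNk] with a h1 h2
    exact ⟨(half_pos hk).trans_le h1, h2⟩
  have hr0 : ∀ x, r x ≠ 0 := fun x => (H.r_pos x).ne'
  have hm10 : ∀ x, m 1 x ≠ 0 := fun x => (hm1pos x).ne'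
  have st₁ : SmoothPeriodic fun x => c / (2 * r x) := (smoothPeriodic_const c).div
    ((smoothPeriodic_const 2).mul H.smooth_r) fun x => mul_ne_zero two_ne_zero (hr0 x)
  set t₁ : ℝ → ℝ := fun x => c / (2 * r x) with ht₁
  have st₃ : SmoothPeriodic fun x => (n 4 x - t₁ x * m 3 x) / m 1 x :=
    ((sn 4).sub (st₁.mul (sm 3))).div (sm 1) hm10
  set t₃ : ℝ → ℝ := fun x => (n 4 x - t₁ x * m 3 x) / m 1 x with ht₃
  have st₄ : SmoothPeriodic fun x => t₁ x * deriv (potential c r) x :=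
    st₁.mul (smoothPeriodic_potential H.smooth_r H.r_pos).deriv
  set t₄ : ℝ → ℝ := fun x => t₁ x * deriv (potential c r) x with ht₄
  have st₅ : SmoothPeriodic fun x => (n 6 x - t₁ x * m 5 x - t₃ x * m 3 x - t₄ x * m 2 x) / m 1 x :=
    ((((sn 6).sub (st₁.mul (sm 5))).sub (st₃.mul (sm 3))).sub (st₄.mul (sm 2))).div (sm 1) hm10
  set t₅ : ℝ → ℝ := fun x => (n 6 x - t₁ x * m 5 x - t₃ x * m 3 x - t₄ x * m 2 x) / m 1 x with ht₅
  have key := bdd_arctan_expansion (half_pos hk) hMk hM hN bμ bν (sm 2) (sm 3) (sm 4) (sm 5)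
    st₁ st₃ st₄ st₅
    (fun x => by
      have := hr0 x
      rw [hn2, hm1]; simp only [ht₁]; field_simp)
    -- The quadratic term of the angle cancels here, which is the reason for the speed `c r²`: both
    -- sides equal `c² r' / 2`.
    (fun x => by
      have := hr0 x
      simp only [ht₁, hmdef, hndef, (H.frameDeriv_two x).1, (H.frameDeriv_three x).2,
        Nat.factorial]
      push_cast
      field_simp
      ring)
    (fun x => by
      have := hm10 x
      simp only [ht₃]; field_simp; ring)
    -- The computation that produces `potential`: the coefficient of `h⁴` is `t₁` times a total
    -- derivative.
    (fun x => by
      have := hr0 x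
      have hc0 := hc.ne'
      simp only [ht₄, ht₃, ht₁, hm1]
      simp only [hmdef, hndef, (H.frameDeriv_two x).1, (H.frameDeriv_three x).1,
        (H.frameDeriv_four x).1, (H.frameDeriv_four x).2, H.frameDeriv_five_im x,
        deriv_potential H.smooth_r H.r_pos, Nat.factorial]
      push_cast
      field_simp
      ring)
    (fun x => by
      have := hm10 x
      simp only [ht₅]; field_simp; ring)
  refine ⟨_, _, st₃.sub ((st₁.pow 3).div (smoothPeriodic_const 3) fun _ => three_ne_zero),
    (st₅.sub ((st₁.pow 2).mul st₃)).add ((st₁.pow 5).div (smoothPeriodic_const 5)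
      fun _ => by norm_num), ?_⟩
  refine IsBigO.congr' key ?_ EventuallyEq.rfl
  filter_upwards [eventually_snd_ne_zero] with a h0
  congr 3
  simp only [hNq, hMq]
  rw [div_div_div_cancel_right₀ h0]

/-! ### The Lazutkin chart of a billiard domain -/

/-- Unit speed makes the product of `γ''` with the conjugate of `γ'` purely imaginary, and its
imaginary part is the curvature. -/
theorem IsBilliardDomain.deriv_deriv_eq {Ω : Set ℂ} {ℓ : ℝ} {γ : ℝ → ℂ}
    (hΩ : IsBilliardDomain Ω ℓ γ) (s : ℝ) :
    deriv (deriv γ) s = Complex.I * curvature γ s * deriv γ s := by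
  have hd : ContDiff ℝ ∞ (deriv γ) := (contDiff_infty_iff_deriv.1 hΩ.smooth).2
  have h1 : HasDerivAt (deriv γ) (deriv (deriv γ) s) s :=
    (hd.differentiable (by simp) s).hasDerivAt
  have h2 : HasDerivAt (fun s => (starRingEnd ℂ) (deriv γ s))
      ((starRingEnd ℂ) (deriv (deriv γ) s)) s :=
    h1.star
  have hone : ∀ s, (starRingEnd ℂ) (deriv γ s) * deriv γ s = 1 := fun s => by
    rw [mul_comm, Complex.mul_conj, Complex.normSq_eq_norm_sq, hΩ.unit_speed]; simp
  have h3 := h2.mul h1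
  have h4 : (fun s => (starRingEnd ℂ) (deriv γ s)) * deriv γ = fun _ => (1 : ℂ) := funext hone
  rw [h4] at h3
  have h5 := h3.unique (hasDerivAt_const s (1 : ℂ))
  have h6 : ((starRingEnd ℂ) (deriv γ s) * deriv (deriv γ) s).re = 0 := by
    have := congrArg Complex.re h5
    simp at this ⊢
    linarith
  have h7 : (starRingEnd ℂ) (deriv γ s) * deriv (deriv γ) s = Complex.I * curvature γ s := by
    apply Complex.ext
    · rw [h6]; simp
    · simp [curvature]
  rw [← h7, mul_right_comm, hone, one_mul]

/-- `S` is the inverse of the Lazutkin parameter, and `γ ∘ S` is the boundary curve in the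
Lazutkin parametrization. -/
structure LazutkinChart (ℓ : ℝ) (γ : ℝ → ℂ) (c : ℝ) (r S : ℝ → ℝ) : Prop where
  curve : LazutkinCurve c r (fun x => γ (S x)) (fun x => deriv γ (S x))
  smooth_param : ContDiff ℝ ∞ (lazutkinParam ℓ γ)
  param_add : ∀ s, lazutkinParam ℓ γ (s + ℓ) = lazutkinParam ℓ γ s + 1
  smooth : ContDiff ℝ ∞ S
  param_apply : ∀ x, lazutkinParam ℓ γ (S x) = x
  apply_param : ∀ s, S (lazutkinParam ℓ γ s) = s
  strictMono : StrictMono S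
  strictMono_param : StrictMono (lazutkinParam ℓ γ)
  add_one : ∀ x, S (x + 1) = S x + ℓ
  zero : S 0 = 0
  hasDerivAt : ∀ x, HasDerivAt S (c * r x ^ 2) x
  curvature_eq : ∀ x, curvature γ (S x) = ((r x)⁻¹) ^ 3

theorem LazutkinChart.param_zero {ℓ : ℝ} {γ : ℝ → ℂ} {c : ℝ} {r S : ℝ → ℝ}
    (H : LazutkinChart ℓ γ c r S) : lazutkinParam ℓ γ 0 = 0 := by
  have := H.param_apply 0
  rwa [H.zero] at this

/-- The Lazutkin parameter has derivative `κ^{2/3} / c > 0`, with `c` the integral of `κ^{2/3}` over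
one period, so it is a diffeomorphism of the line that commutes with the periods. Take `S` to be its
inverse and `r = κ^{-1/3}` along `S`. -/
theorem IsBilliardDomain.exists_lazutkinChart {Ω : Set ℂ} {ℓ : ℝ} {γ : ℝ → ℂ}
    (hΩ : IsBilliardDomain Ω ℓ γ) : ∃ c r S, LazutkinChart ℓ γ c r S := by
  have hℓ := hΩ.length_pos
  have hdiff : Differentiable ℝ γ := hΩ.smooth.differentiable (by simp)
  have hd : ContDiff ℝ ∞ (deriv γ) := (contDiff_infty_iff_deriv.1 hΩ.smooth).2
  have hdd : ContDiff ℝ ∞ (deriv (deriv γ)) := (contDiff_infty_iff_deriv.1 hd).2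
  have hper : ∀ {f : ℝ → ℂ}, Function.Periodic f ℓ → Function.Periodic (deriv f) ℓ := by
    intro f hf x
    have h : (fun y => f (y + ℓ)) = f := funext hf
    rw [← deriv_comp_add_const, h]
  have hκs : ContDiff ℝ ∞ (curvature γ) :=
    Complex.imCLM.contDiff.comp ((Complex.conjCLE.contDiff.comp hd).mul hdd)
  have hκp : Function.Periodic (curvature γ) ℓ := fun s => by
    simp only [curvature, hper hΩ.periodic s, hper (hper hΩ.periodic) s]
  have hκ := hΩ.curvature_pos
  obtain ⟨f, hf⟩ : ∃ f : ℝ → ℝ, f = fun t => ((curvature γ t)⁻¹) ^ (-(2 / 3) : ℝ) := ⟨_, rfl⟩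
  have hfpos : ∀ s, 0 < f s := fun s => by
    rw [hf]; exact Real.rpow_pos_of_pos (inv_pos.2 (hκ s)) _
  have hfs : ContDiff ℝ ∞ f := by
    rw [hf]
    exact (hκs.inv fun s => (hκ s).ne').rpow_const_of_ne fun s => (inv_pos.2 (hκ s)).ne'
  have hfp : Function.Periodic f ℓ := fun s => by simp only [hf, hκp s]
  have hfc : Continuous f := hfs.continuous
  have hfi : ∀ a b, IntervalIntegrable f MeasureTheory.volume a b :=
    fun a b => hfc.intervalIntegrable a b
  obtain ⟨c, hc⟩ : ∃ c, c = ∫ t in (0 : ℝ)..ℓ, f t := ⟨_, rfl⟩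
  have hcpos : 0 < c := by
    rw [hc]; exact intervalIntegral.intervalIntegral_pos_of_pos (hfi _ _) hfpos hℓ
  obtain ⟨L, hL⟩ : ∃ L, L = lazutkinParam ℓ γ := ⟨_, rfl⟩
  have hLe : ∀ s, L s = c⁻¹ * ∫ t in (0 : ℝ)..s, f t := fun s => by
    rw [hL, hc, hf]; rfl
  have hLd : ∀ s, HasDerivAt L (c⁻¹ * f s) s := fun s => by
    rw [funext hLe]
    exact ((hfc.integral_hasStrictDerivAt 0 s).hasDerivAt).const_mul _
  have hLs : ContDiff ℝ ∞ L := by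
    refine contDiff_infty_iff_deriv.2 ⟨fun s => (hLd s).differentiableAt, ?_⟩
    rw [funext fun s => (hLd s).deriv]
    exact contDiff_const.mul hfs
  have hLm : StrictMono L := strictMono_of_deriv_pos fun s => by
    rw [(hLd s).deriv]; have := hfpos s; positivity
  have hLadd : ∀ s, L (s + ℓ) = L s + 1 := fun s => by
    rw [hLe, hLe, ← intervalIntegral.integral_add_adjacent_intervals (hfi 0 s) (hfi s (s + ℓ)),
      hfp.intervalIntegral_add_eq s 0, zero_add, ← hc]
    field_simp
  have hL0 : L 0 = 0 := by rw [hLe]; simp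
  have hLn : ∀ (n : ℕ) s, L (s + n * ℓ) = L s + n := fun n s => by
    induction n with
    | zero => simp
    | succ n ih =>
      have : s + ((n + 1 : ℕ) : ℝ) * ℓ = (s + n * ℓ) + ℓ := by push_cast; ring
      rw [this, hLadd, ih]; push_cast; ring
  -- `L` takes the value `±n` at `±n ℓ`, so the intermediate value theorem applies.
  have hLsurj : Function.Surjective L := fun y => by
    obtain ⟨n, hn⟩ := exists_nat_ge |y|
    have h1 : L (0 + n * ℓ) = 0 + n := by rw [hLn, hL0]
    have h2 : L (-(n * ℓ)) = -n := by
      have := hLn n (-(n * ℓ))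
      rw [neg_add_cancel, hL0] at this
      linarith
    exact mem_range_of_exists_le_of_exists_ge hLs.continuous
      ⟨-(n * ℓ), by rw [h2]; linarith [neg_abs_le y]⟩
      ⟨0 + n * ℓ, by rw [h1]; linarith [le_abs_self y]⟩
  obtain ⟨e, he⟩ : ∃ e : ℝ ≃o ℝ, ∀ s, e s = L s :=
    ⟨hLm.orderIsoOfSurjective L hLsurj, fun _ => rfl⟩
  have heq : (⇑e.toHomeomorph : ℝ → ℝ) = L := funext he
  obtain ⟨S, hS⟩ : ∃ S : ℝ → ℝ, S = e.symm := ⟨_, rfl⟩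
  have hLS : ∀ x, L (S x) = x := fun x => by rw [← he, hS]; exact e.apply_symm_apply x
  have hSL : ∀ s, S (L s) = s := fun s => by rw [← he, hS]; exact e.symm_apply_apply s
  have hSs : ContDiff ℝ ∞ S := by
    have := e.toHomeomorph.contDiff_symm_deriv (n := ∞) (f' := fun s => c⁻¹ * f s)
      (fun s => (mul_pos (inv_pos.2 hcpos) (hfpos s)).ne') (by rw [heq]; exact hLd)
      (by rw [heq]; exact hLs)
    rw [hS]; exact this
  have hSm : StrictMono S := by rw [hS]; exact e.symm.strictMono
  have hSadd : ∀ x, S (x + 1) = S x + ℓ := fun x => by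
    apply hLm.injective; rw [hLS, hLadd, hLS]
  have hS0 : S 0 = 0 := by rw [← hL0, hSL, hL0]
  obtain ⟨r, hr⟩ : ∃ r : ℝ → ℝ, r = fun x => curvature γ (S x) ^ (-(1 / 3) : ℝ) := ⟨_, rfl⟩
  have hrpos : ∀ x, 0 < r x := fun x => by rw [hr]; exact Real.rpow_pos_of_pos (hκ _) _
  have hrκ : ∀ x, curvature γ (S x) = ((r x)⁻¹) ^ 3 := fun x => by
    simp only [hr]
    rw [← Real.rpow_neg (hκ _).le, ← Real.rpow_natCast, ← Real.rpow_mul (hκ _).le]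
    norm_num
  have hfr : ∀ x, f (S x) * r x ^ 2 = 1 := fun x => by
    simp only [hf, hr]
    rw [Real.inv_rpow (hκ _).le, ← Real.rpow_neg (hκ _).le, ← Real.rpow_natCast,
      ← Real.rpow_mul (hκ _).le, ← Real.rpow_add (hκ _)]
    norm_num
  have hSd : ∀ x, HasDerivAt S (c * r x ^ 2) x := fun x => by
    have h1 := ((hSs.differentiable (by simp)) x).hasDerivAt
    have h2 := (hLd (S x)).comp x h1
    have h3 : L ∘ S = id := funext hLS
    rw [h3] at h2
    have h4 := h2.unique (hasDerivAt_id x)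
    have : deriv S x = c * r x ^ 2 := by
      have h5 := hfr x
      have h6 := (hfpos (S x)).ne'
      field_simp at h4
      apply mul_left_cancel₀ h6
      rw [h4]; linear_combination -c * h5
    rw [← this]; exact h1
  have hrp : SmoothPeriodic r := by
    refine ⟨?_, fun x => ?_⟩
    · rw [hr]
      exact (hκs.comp hSs).rpow_const_of_ne fun x => (hκ _).ne'
    · simp only [hr, hSadd, hκp (S x)]
  refine ⟨c, r, S, ?_⟩
  refine ⟨⟨hcpos, hrp, hrpos, ⟨hΩ.smooth.comp hSs, fun x => ?_⟩, ⟨hd.comp hSs, fun x => ?_⟩,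
    fun x => ?_, fun x => ?_, fun x => hΩ.unit_speed _⟩, hL ▸ hLs, hL ▸ hLadd, hSs, hL ▸ hLS,
    hL ▸ hSL, hSm, hL ▸ hLm, hSadd, hS0, hSd, hrκ⟩
  · simp only [hSadd, hΩ.periodic (S x)]
  · simp only [hSadd, hper hΩ.periodic (S x)]
  · have := ((hdiff (S x)).hasDerivAt).scomp x (hSd x)
    exact HasDerivAt.congr_deriv (f := γ ∘ S) this (Complex.real_smul ..)
  · have h1 : HasDerivAt (deriv γ) (deriv (deriv γ) (S x)) (S x) :=
      (hd.differentiable (by simp) _).hasDerivAt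
    have h2 := h1.scomp x (hSd x)
    refine h2.congr_deriv ?_
    -- Curvature times speed is `r⁻³ · c r² = c / r`.
    rw [hΩ.deriv_deriv_eq, hrκ, Complex.real_smul]
    have : (r x : ℂ) ≠ 0 := by exact_mod_cast (hrpos x).ne'
    push_cast
    field_simp

/-! ### Convexity -/

/-- For a unit vector `e` the unsigned angle is `|arg (z / e)|`, and `z / e` is `z` written in the
frame of `e`; in the right half plane the argument is an arctangent. -/
theorem angle_eq_abs_arctan {z e : ℂ} (he : ‖e‖ = 1) (h : 0 < ((starRingEnd ℂ) e * z).re) :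
    InnerProductGeometry.angle z e =
      |Real.arctan (((starRingEnd ℂ) e * z).im / ((starRingEnd ℂ) e * z).re)| := by
  have he0 : e ≠ 0 := by rintro rfl; simp at he
  have hz0 : z ≠ 0 := by rintro rfl; simp at h
  have hdiv : z / e = (starRingEnd ℂ) e * z := by
    have : (starRingEnd ℂ) e * e = 1 := by
      rw [mul_comm, Complex.mul_conj, Complex.normSq_eq_norm_sq, he]; simp
    rw [div_eq_iff he0, mul_right_comm, this, one_mul]
  rw [Complex.angle_eq_abs_arg hz0 he0, hdiv, ← Complex.tan_arg]
  have h2 := Complex.abs_arg_lt_pi_div_two_iff.2 (Or.inl h)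
  rw [Real.arctan_tan (abs_lt.1 h2).1 (abs_lt.1 h2).2]

section

variable {Ω : Set ℂ} {ℓ : ℝ} {γ : ℝ → ℂ} {c : ℝ} {r S : ℝ → ℝ}

theorem IsBilliardDomain.ne_of_lt (hΩ : IsBilliardDomain Ω ℓ γ) {s t : ℝ} (h1 : s < t)
    (h2 : t < s + ℓ) : γ s ≠ γ t := by
  intro h
  have hℓ := hΩ.length_pos
  have hmod : ∀ s, γ (toIcoMod hℓ 0 s) = γ s := fun s => by
    rw [toIcoMod]; exact hΩ.periodic.sub_zsmul_eq _
  have hmem : ∀ s, toIcoMod hℓ 0 s ∈ Ico 0 ℓ := fun s => by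
    simpa using toIcoMod_mem_Ico hℓ 0 s
  have := hΩ.simple (hmem s) (hmem t) (by rw [hmod, hmod, h])
  obtain ⟨n, hn⟩ := toIcoMod_eq_toIcoMod hℓ |>.1 this
  rw [zsmul_eq_mul] at hn
  have h3 : 0 < (n : ℝ) * ℓ := by linarith
  have h4 : (n : ℝ) * ℓ < 1 * ℓ := by linarith
  have h5 : 0 < (n : ℝ) := pos_of_mul_pos_left h3 hℓ.le
  have h6 : (n : ℝ) < 1 := lt_of_mul_lt_mul_right h4 hℓ.le
  norm_cast at h5 h6
  omega

theorem LazutkinChart.exists_apply_eq (H : LazutkinChart ℓ γ c r S) (s : ℝ) : ∃ x, S x = s :=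
  ⟨_, H.apply_param s⟩

theorem LazutkinChart.ne_of_lt (H : LazutkinChart ℓ γ c r S) (hΩ : IsBilliardDomain Ω ℓ γ)
    {x y : ℝ} (h1 : x < y) (h2 : y < x + 1) : γ (S x) ≠ γ (S y) :=
  hΩ.ne_of_lt (H.strictMono h1) (by rw [← H.add_one]; exact H.strictMono h2)

theorem conj_mul_self_of_norm {e : ℂ} (he : ‖e‖ = 1) : (starRingEnd ℂ) e * e = 1 := by
  rw [mul_comm, Complex.mul_conj, Complex.normSq_eq_norm_sq, he]; simp

/-- The domain lies to the left of each of its oriented tangents. -/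
theorem LazutkinChart.im_pos_of_mem (H : LazutkinChart ℓ γ c r S) (hΩ : IsBilliardDomain Ω ℓ γ)
    (x : ℝ) {w : ℂ} (hw : w ∈ Ω) :
    0 < ((starRingEnd ℂ) (deriv γ (S x)) * (w - γ (S x))).im := by
  set e := deriv γ (S x) with he
  have hmem : ∀ s, γ s ∈ frontier Ω := fun s => by rw [hΩ.boundary]; exact mem_range_self s
  have hcl : ∀ s, γ s ∈ closure Ω := fun s => frontier_subset_closure (hmem s)
  have hnot : γ (S x) ∉ Ω := fun h => (hmem (S x)).2 (by rwa [hΩ.isOpen.interior_eq])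
  obtain ⟨f, hf⟩ := geometric_hahn_banach_open_point hΩ.convex hΩ.isOpen hnot
  have hfc : ∀ z ∈ closure Ω, f z ≤ f (γ (S x)) := fun z hz =>
    closure_minimal (fun a ha => (hf a ha).le) (isClosed_le f.continuous continuous_const) hz
  have hone : (starRingEnd ℂ) e * e = 1 := conj_mul_self_of_norm (hΩ.unit_speed _)
  have hdec : ∀ z : ℂ, f z = ((starRingEnd ℂ) e * z).re * f e
      + ((starRingEnd ℂ) e * z).im * f (Complex.I * e) := by
    intro z
    have h1 : z = ((starRingEnd ℂ) e * z).re • e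
        + ((starRingEnd ℂ) e * z).im • (Complex.I * e) := by
      rw [Complex.real_smul, Complex.real_smul, ← mul_assoc, ← add_mul, Complex.re_add_im,
        mul_right_comm, hone, one_mul]
    conv_lhs => rw [h1]
    rw [map_add, map_smul, map_smul, smul_eq_mul, smul_eq_mul]
  -- The boundary curve attains the maximum of the supporting functional at `x`, so its velocity is
  -- in the kernel. The supporting line is thus the tangent.
  have hfe : f e = 0 := by
    have h1 : HasDerivAt (fun y => f (γ (S y))) (f ((c * r x ^ 2 : ℝ) * e)) x :=
      f.hasFDerivAt.comp_hasDerivAt x (H.curve.hasDerivAt_Γ x)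
    have h2 : IsLocalMax (fun y => f (γ (S y))) x :=
      Eventually.of_forall fun y => hfc _ (hcl _)
    have h3 := h2.hasDerivAt_eq_zero h1
    rw [← Complex.real_smul, map_smul, smul_eq_mul] at h3
    have h4 := H.curve.r_pos x
    have h5 := H.curve.c_pos
    exact (mul_eq_zero.1 h3).resolve_left (by positivity)
  -- The side is decided by a nearby boundary point, which lies strictly to the left of the tangent
  -- by the chord expansion.
  have hlam : f (Complex.I * e) ≤ 0 := by
    obtain ⟨δ, hδ, h⟩ := eventually_stripFilter.1 H.curve.exists_chordAngle_expansion.1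
    have h1 := (h x (δ / 2) (by positivity) (by rw [abs_of_pos (by positivity)]; linarith)).2
    have h2 := hfc _ (hcl (S (x + δ / 2)))
    have h3 := hdec (γ (S (x + δ / 2)) - γ (S x))
    rw [map_sub, hfe, mul_zero, zero_add] at h3
    simp only [frameChord] at h1
    by_contra hneg
    push Not at hneg
    have := mul_pos h1 hneg
    linarith
  have h1 := hf w hw
  have h2 := hdec (w - γ (S x))
  rw [map_sub, hfe, mul_zero, zero_add] at h2
  have h3 : ((starRingEnd ℂ) e * (w - γ (S x))).im * f (Complex.I * e) < 0 := by linarith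
  by_contra hneg
  push Not at hneg
  have := mul_nonneg_of_nonpos_of_nonpos hneg hlam
  linarith

theorem LazutkinChart.im_nonneg_of_mem_closure (H : LazutkinChart ℓ γ c r S)
    (hΩ : IsBilliardDomain Ω ℓ γ) (x : ℝ) {w : ℂ} (hw : w ∈ closure Ω) :
    0 ≤ ((starRingEnd ℂ) (deriv γ (S x)) * (w - γ (S x))).im :=
  closure_minimal (t := {w | 0 ≤ ((starRingEnd ℂ) (deriv γ (S x)) * (w - γ (S x))).im})
    (fun a ha => (H.im_pos_of_mem hΩ x ha).le)
    (isClosed_le continuous_const (by fun_prop)) hw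

/-- Strict convexity: the boundary touches a tangent only once. -/
theorem LazutkinChart.im_pos (H : LazutkinChart ℓ γ c r S) (hΩ : IsBilliardDomain Ω ℓ γ)
    {x y : ℝ} (hxy : x < y) (hyx : y < x + 1) :
    0 < ((starRingEnd ℂ) (deriv γ (S x)) * (γ (S y) - γ (S x))).im := by
  have hmem : ∀ s, γ s ∈ frontier Ω := fun s => by rw [hΩ.boundary]; exact mem_range_self s
  have hcl : ∀ s, γ s ∈ closure Ω := fun s => frontier_subset_closure (hmem s)
  have hnn := fun y => H.im_nonneg_of_mem_closure hΩ x (hcl (S y))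
  refine lt_of_le_of_ne (hnn y) fun hzero => ?_
  have hper : Function.Periodic (fun x => γ (S x)) 1 := H.curve.smooth_Γ.2
  -- If `γ (S y)` were on the tangent at `x`, the whole segment between the two points would be in
  -- the closure and on a supporting line, hence in the boundary. This gives infinitely many
  -- parameters `u n` in one period.
  have hex : ∀ n : ℕ, ∃ u ∈ Ico x (x + 1),
      γ (S u) = γ (S x) + (1 / ((n : ℝ) + 1)) • (γ (S y) - γ (S x)) := by
    intro n
    set p := γ (S x) + (1 / ((n : ℝ) + 1)) • (γ (S y) - γ (S x)) with hp
    have hpc : p ∈ closure Ω := hΩ.convex.closure.add_smul_sub_mem (hcl _) (hcl _)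
      ⟨by positivity, by rw [div_le_one (by positivity)]; linarith [n.cast_nonneg (α := ℝ)]⟩
    have hpn : p ∉ Ω := fun h => by
      have h1 := H.im_pos_of_mem hΩ x h
      rw [hp, add_sub_cancel_left, Complex.real_smul, mul_left_comm, Complex.im_ofReal_mul,
        ← hzero, mul_zero] at h1
      exact lt_irrefl _ h1
    have hpf : p ∈ frontier Ω := ⟨hpc, by rwa [hΩ.isOpen.interior_eq]⟩
    rw [hΩ.boundary] at hpf
    obtain ⟨s, hs⟩ := hpf
    obtain ⟨v, rfl⟩ := H.exists_apply_eq s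
    obtain ⟨u, hu, huv⟩ := hper.exists_mem_Ico one_pos v x
    exact ⟨u, hu, huv.symm.trans hs⟩
  choose u hu hup using hex
  obtain ⟨δ, hδ, hloc⟩ := eventually_stripFilter.1 H.curve.exists_chordAngle_expansion.1
  have hne : γ (S y) - γ (S x) ≠ 0 := sub_ne_zero.2 (H.ne_of_lt hΩ hxy hyx).symm
  have hinj : ∀ m n, u m = u n → m = n := by
    intro m n hmn
    have h1 := (hup m).symm.trans ((congrArg (fun v => γ (S v)) hmn).trans (hup n))
    have h2 := smul_left_injective ℝ hne (add_left_cancel h1)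
    have h3 : (m : ℝ) + 1 = n + 1 := by
      simpa using h2
    exact_mod_cast add_right_cancel h3
  have hz : ∀ n, ((starRingEnd ℂ) (deriv γ (S x)) * (γ (S (u n)) - γ (S x))).im = 0 := fun n => by
    rw [hup, add_sub_cancel_left, Complex.real_smul, mul_left_comm, Complex.im_ofReal_mul,
      ← hzero, mul_zero]
  -- By compactness two distinct parameters `v`, `w` among them are as close as desired. The height
  -- over the tangent at `x` has a minimum at `v`, so the tangents at `v` and `x` are parallel and
  -- the short chord from `v` to `w` lies along the tangent at `v`, which the local expansion
  -- forbids.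
  obtain ⟨a, -, ψ, hψ, hlim⟩ := (isCompact_Icc (a := x) (b := x + 1)).tendsto_subseq
    (fun n => Ico_subset_Icc_self (hu n))
  obtain ⟨N, hN⟩ := Metric.cauchySeq_iff.1 hlim.cauchySeq δ hδ
  have hclose : |u (ψ (N + 1)) - u (ψ N)| < δ := hN (N + 1) (by omega) N le_rfl
  set v := u (ψ N) with hv
  set w := u (ψ (N + 1)) with hw
  have hvw : w - v ≠ 0 := sub_ne_zero.2 fun h => by
    have := hψ.injective (hinj _ _ h)
    omega
  have him := (hloc v (w - v) hvw hclose).2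
  simp only [frameChord, add_sub_cancel] at him
  have hder : ((starRingEnd ℂ) (deriv γ (S x)) * deriv γ (S v)).im = 0 := by
    have h1 : HasDerivAt (fun y => ((starRingEnd ℂ) (deriv γ (S x)) * (γ (S y) - γ (S x))).im)
        (((starRingEnd ℂ) (deriv γ (S x)) * ((c * r v ^ 2 : ℝ) * deriv γ (S v))).im) v :=
      Complex.imCLM.hasFDerivAt.comp_hasDerivAt v
        (((H.curve.hasDerivAt_Γ v).sub_const _).const_mul _)
    have h2 : IsLocalMin (fun y => ((starRingEnd ℂ) (deriv γ (S x)) * (γ (S y) - γ (S x))).im) v :=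
      Eventually.of_forall fun y => by simp only [hv, hz]; exact hnn y
    have h3 := h2.hasDerivAt_eq_zero h1
    rw [mul_left_comm, Complex.im_ofReal_mul] at h3
    have h4 := H.curve.r_pos v
    have h5 := H.curve.c_pos
    exact (mul_eq_zero.1 h3).resolve_left (by positivity)
  set z := (starRingEnd ℂ) (deriv γ (S x)) * deriv γ (S v) with hzdef
  have hz0 : z.re ≠ 0 := fun h0 => by
    have h1 : z = 0 := Complex.ext h0 hder
    have h2 : ‖z‖ = 1 := by
      rw [hzdef, norm_mul, RCLike.norm_conj, hΩ.unit_speed, hΩ.unit_speed, one_mul]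
    rw [h1] at h2; simp at h2
  have e1 : (starRingEnd ℂ) (deriv γ (S x)) * (γ (S w) - γ (S x))
      - (starRingEnd ℂ) (deriv γ (S x)) * (γ (S v) - γ (S x))
      = z * ((starRingEnd ℂ) (deriv γ (S v)) * (γ (S w) - γ (S v))) := by
    have := conj_mul_self_of_norm (hΩ.unit_speed (S v))
    rw [hzdef]
    linear_combination -(starRingEnd ℂ) (deriv γ (S x)) * (γ (S w) - γ (S v)) * this
  have e2 := congrArg Complex.im e1
  rw [Complex.sub_im, hz, hz, sub_zero, Complex.mul_im, hder, zero_mul, add_zero] at e2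
  exact mul_ne_zero hz0 him.ne' e2.symm

/-- For short chords, the unsigned angles of the billiard map are given by the chord angle. -/
theorem LazutkinChart.exists_angle_eq (H : LazutkinChart ℓ γ c r S) : ∃ δ > 0, ∀ x h : ℝ,
    0 < h → h < δ →
    InnerProductGeometry.angle (γ (S (x + h)) - γ (S x)) (deriv γ (S x))
      = chordAngle (fun x => γ (S x)) (fun x => deriv γ (S x)) x h ∧
    InnerProductGeometry.angle (γ (S x) - γ (S (x - h))) (deriv γ (S x))
      = -chordAngle (fun x => γ (S x)) (fun x => deriv γ (S x)) x (-h) := by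
  obtain ⟨δ, hδ, hloc⟩ := eventually_stripFilter.1 H.curve.exists_chordAngle_expansion.1
  refine ⟨δ, hδ, fun x h h0 hh => ⟨?_, ?_⟩⟩
  · obtain ⟨h1, h2⟩ := hloc x h h0.ne' (by rwa [abs_of_pos h0])
    have h3 := (div_pos_iff_of_pos_right h0).1 h1
    rw [angle_eq_abs_arctan (H.curve.norm_E x) (by exact h3)]
    simp only [frameChord] at h2 h3
    rw [chordAngle, abs_of_nonneg]
    · rfl
    · exact Real.arctan_nonneg.2 (div_nonneg h2.le h3.le)
  · obtain ⟨h1, h2⟩ := hloc x (-h) (neg_ne_zero.2 h0.ne') (by rwa [abs_neg, abs_of_pos h0])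
    -- Backwards, the frame chord has negative real and positive imaginary part. Reversing it leaves
    -- the quotient unchanged, so its arctangent is negative and its absolute value is minus the
    -- chord angle.
    have h3 : (frameChord (fun x => γ (S x)) (fun x => deriv γ (S x)) x (-h)).re < 0 := by
      rcases div_pos_iff.1 h1 with ⟨-, h⟩ | ⟨h, -⟩
      · simp only at h; linarith
      · exact h
    have e : (starRingEnd ℂ) (deriv γ (S x)) * (γ (S x) - γ (S (x - h)))
        = -frameChord (fun x => γ (S x)) (fun x => deriv γ (S x)) x (-h) := by
      simp only [frameChord, ← sub_eq_add_neg]; ring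
    rw [angle_eq_abs_arctan (H.curve.norm_E x) (by rw [e, Complex.neg_re]; linarith), e,
      Complex.neg_re, Complex.neg_im, neg_div_neg_eq, chordAngle, abs_of_nonpos]
    rw [← Real.arctan_zero]
    exact Real.arctan_mono (div_nonpos_of_nonneg_of_nonpos h2.le h3.le)

/-- A chord that makes a small angle with the tangent at its starting point is short. -/
theorem LazutkinChart.exists_lt_of_angle_lt (H : LazutkinChart ℓ γ c r S)
    (hΩ : IsBilliardDomain Ω ℓ γ) {η : ℝ} (hη : 0 < η) : ∃ δ > 0, ∀ x y : ℝ, x < y → y < x + 1 →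
    InnerProductGeometry.angle (γ (S y) - γ (S x)) (deriv γ (S x)) < δ → y < x + η := by
  obtain ⟨d, hd, hloc⟩ := eventually_stripFilter.1 H.curve.exists_chordAngle_expansion.1
  have hΓ : Continuous fun x => γ (S x) := H.curve.smooth_Γ.continuous
  have hE : Continuous fun x => deriv γ (S x) := H.curve.smooth_E.continuous
  have hE0 : ∀ x, deriv γ (S x) ≠ 0 := fun x h => by
    have := H.curve.norm_E x; rw [h] at this; simp at this
  -- A compact set of pairs that omits chords shorter than `η` and chords that almost complete a
  -- turn. Strict convexity makes the angle positive on it.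
  set K : Set (ℝ × ℝ) := (Icc 0 1 ×ˢ Icc 0 2) ∩ {p | p.1 + η ≤ p.2 ∧ p.2 ≤ p.1 + 1 - d} with hK
  have hKc : IsCompact K := (isCompact_Icc.prod isCompact_Icc).inter_right
    (by
      rw [ofPred_and]
      exact (isClosed_le (by fun_prop) (by fun_prop)).inter
        (isClosed_le (by fun_prop) (by fun_prop)))
  obtain ⟨δ, hδ, hmin⟩ := hKc.exists_forall_le' (a := 0)
    (f := fun p : ℝ × ℝ => InnerProductGeometry.angle (γ (S p.2) - γ (S p.1)) (deriv γ (S p.1)))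
    (fun p hp => by
      have h1 : p.1 < p.2 := by linarith [hp.2.1]
      have h2 : p.2 < p.1 + 1 := by linarith [hp.2.2]
      have hc := InnerProductGeometry.continuousAt_angle
        (x := (γ (S p.2) - γ (S p.1), deriv γ (S p.1)))
        (sub_ne_zero.2 (H.ne_of_lt hΩ h1 h2).symm) (hE0 _)
      exact (ContinuousAt.comp (f := fun p : ℝ × ℝ => (γ (S p.2) - γ (S p.1), deriv γ (S p.1)))
        hc (((hΓ.comp continuous_snd).sub (hΓ.comp continuous_fst)).prodMk
          (hE.comp continuous_fst)).continuousAt).continuousWithinAt)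
    (fun p hp => by
      have h1 : p.1 < p.2 := by linarith [hp.2.1]
      have h2 : p.2 < p.1 + 1 := by linarith [hp.2.2]
      refine lt_of_le_of_ne (InnerProductGeometry.angle_nonneg _ _) fun h => ?_
      obtain ⟨-, k, hk, he⟩ := InnerProductGeometry.angle_eq_zero_iff.1 h.symm
      have h3 := H.im_pos hΩ h1 h2
      have h4 := conj_mul_self_of_norm (hΩ.unit_speed (S p.1))
      nth_rewrite 2 [he] at h4
      rw [Complex.real_smul, mul_left_comm] at h4
      have h5 := congrArg Complex.im h4
      rw [Complex.im_ofReal_mul, Complex.one_im] at h5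
      exact (mul_pos hk h3).ne' h5)
  refine ⟨min δ (Real.pi / 2), by positivity, fun x y hxy hyx hang => ?_⟩
  by_contra hcon
  push Not at hcon
  rcases le_or_gt y (x + 1 - d) with hle | hgt
  · have hfl : ∀ z : ℝ, γ (S (z - ⌊x⌋)) = γ (S z) := fun z => by
      simpa using H.curve.smooth_Γ.2.sub_zsmul_eq (x := z) ⌊x⌋
    have hfl' : ∀ z : ℝ, deriv γ (S (z - ⌊x⌋)) = deriv γ (S z) := fun z => by
      simpa using H.curve.smooth_E.2.sub_zsmul_eq (x := z) ⌊x⌋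
    have h1 := hmin (x - ⌊x⌋, y - ⌊x⌋) ⟨⟨⟨by linarith [Int.floor_le x],
      by linarith [Int.lt_floor_add_one x]⟩, ⟨by simp only; linarith [Int.floor_le x],
      by simp only; linarith [Int.lt_floor_add_one x]⟩⟩, by simp only; linarith,
      by simp only; linarith⟩
    simp only [hfl, hfl'] at h1
    linarith [min_le_left δ (Real.pi / 2)]
  -- A chord that almost completes a turn is a short backward chord, so its angle exceeds `π / 2`;
  -- this is why the threshold is at most `π / 2`.
  · have h1 := (hloc x (y - 1 - x) (by linarith) (by rw [abs_of_neg] <;> linarith)).1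
    have h2 : (frameChord (fun x => γ (S x)) (fun x => deriv γ (S x)) x (y - 1 - x)).re < 0 := by
      rcases div_pos_iff.1 h1 with ⟨-, h⟩ | ⟨h, -⟩
      · simp only at h; linarith
      · exact h
    have h3 : γ (S (x + (y - 1 - x))) = γ (S y) := by
      have := H.curve.smooth_Γ.2 (y - 1)
      simp only [sub_add_cancel] at this
      rw [this]; congr 2; ring
    simp only [frameChord, h3] at h2
    have h4 : inner ℝ (deriv γ (S x)) (γ (S y) - γ (S x)) < 0 := by
      rwa [Complex.inner, mul_comm]
    have h5 : Real.cos (InnerProductGeometry.angle (γ (S y) - γ (S x)) (deriv γ (S x))) < 0 := by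
      rw [InnerProductGeometry.cos_angle, real_inner_comm]
      have h6 := norm_pos_iff.2 (sub_ne_zero.2 (H.ne_of_lt hΩ hxy hyx).symm)
      rw [H.curve.norm_E, mul_one]
      exact div_neg_of_neg_of_pos h4 h6
    have h7 : 0 ≤ Real.cos (InnerProductGeometry.angle (γ (S y) - γ (S x)) (deriv γ (S x))) :=
      Real.cos_nonneg_of_neg_pi_div_two_le_of_le
        (by linarith [InnerProductGeometry.angle_nonneg (γ (S y) - γ (S x)) (deriv γ (S x)),
          Real.pi_pos])
        (hang.le.trans (min_le_right _ _))
    linarith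

/-! ### Rigidity: a constant potential forces a constant curvature -/

/-- The tangent vector of the boundary turns exactly once. -/
theorem LazutkinChart.exists_tangent_angle (H : LazutkinChart ℓ γ c r S)
    (hΩ : IsBilliardDomain Ω ℓ γ) : ∃ τ : ℝ → ℝ, (∀ x, HasDerivAt τ (c / r x) x) ∧
      τ 1 = τ 0 + 2 * Real.pi := by
  have hc := H.curve.c_pos
  have hr := H.curve.r_pos
  have hcont : Continuous fun x => c / r x :=
    continuous_const.div H.curve.smooth_r.continuous fun x => (hr x).ne'
  set τ : ℝ → ℝ := fun x => ∫ t in (0 : ℝ)..x, c / r t with hτ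
  have hd : ∀ x, HasDerivAt τ (c / r x) x := fun x =>
    (hcont.integral_hasStrictDerivAt 0 x).hasDerivAt
  have hτ0 : τ 0 = 0 := by simp [hτ]
  have hmono : StrictMono τ := strictMono_of_deriv_pos fun x => by
    rw [(hd x).deriv]; have := hr x; positivity
  have hexp : ∀ x, deriv γ (S x) = deriv γ (S 0) * Complex.exp (τ x * Complex.I) := by
    have h1 : ∀ x, HasDerivAt (fun x => deriv γ (S x) * Complex.exp (-(τ x * Complex.I))) 0 x := by
      intro x
      have h2 : HasDerivAt (fun x => Complex.exp (-(τ x * Complex.I)))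
          (Complex.exp (-(τ x * Complex.I)) * -((c / r x : ℝ) * Complex.I)) x :=
        (((hd x).ofReal_comp.mul_const Complex.I).neg).cexp
      refine ((H.curve.hasDerivAt_E x).mul h2).congr_deriv ?_
      ring
    have h3 := is_const_of_deriv_eq_zero (fun x => (h1 x).differentiableAt) fun x => (h1 x).deriv
    intro x
    have h4 := h3 x 0
    simp only [hτ0, Complex.ofReal_zero, zero_mul, neg_zero, Complex.exp_zero, mul_one] at h4
    rw [← h4, mul_assoc, ← Complex.exp_add, neg_add_cancel, Complex.exp_zero, mul_one]
  have hE0 : deriv γ (S 0) ≠ 0 := fun h => by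
    have := H.curve.norm_E 0; rw [h] at this; simp at this
  -- Since the curve closes up, the total turning is `2π n` with `n ≥ 1`.
  have h1 : Complex.exp (τ 1 * Complex.I) = 1 := by
    have h2 := hexp 1
    have h3 : deriv γ (S 1) = deriv γ (S 0) := by
      simpa using H.curve.smooth_E.2 0
    rw [h3] at h2
    exact (mul_right_eq_self₀.1 h2.symm).resolve_right hE0
  obtain ⟨n, hn⟩ := Complex.exp_eq_one_iff.1 h1
  have hn' : τ 1 = n * (2 * Real.pi) := by
    have h2 : (τ 1 : ℂ) * Complex.I = ((n * (2 * Real.pi) : ℝ) : ℂ) * Complex.I := by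
      rw [hn]; push_cast; ring
    exact_mod_cast mul_right_cancel₀ Complex.I_ne_zero h2
  refine ⟨τ, hd, ?_⟩
  have hpos : 0 < τ 1 := by rw [← hτ0]; exact hmono one_pos
  have hn1 : (0 : ℝ) < n := by
    rw [hn'] at hpos; exact pos_of_mul_pos_left hpos (by positivity)
  rcases lt_trichotomy n 1 with h | h | h
  · norm_cast at hn1; omega
  · rw [hn', h, hτ0]; simp
  · exfalso
    have h2 : (2 : ℝ) ≤ n := by exact_mod_cast h
    have h3 : 2 * Real.pi < τ 1 := by rw [hn']; nlinarith [Real.pi_pos]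
    -- If `n ≥ 2`, some interior parameter `y` has the same oriented tangent direction as `0`. Each
    -- of the two points would then be strictly to the left of the tangent at the other, which is
    -- absurd for parallel tangents.
    obtain ⟨y, hy, hyτ⟩ := intermediate_value_Ioo zero_le_one
      (fun x _ => (hd x).continuousAt.continuousWithinAt)
      (show 2 * Real.pi ∈ Ioo (τ 0) (τ 1) from ⟨by rw [hτ0]; positivity, h3⟩)
    have h4 : deriv γ (S y) = deriv γ (S 0) := by
      rw [hexp y, hyτ]
      push_cast
      rw [Complex.exp_two_pi_mul_I, mul_one]
    have h5 := H.im_pos hΩ hy.1 (by linarith [hy.2])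
    have h6 := H.im_pos hΩ hy.2 (by linarith [hy.1])
    have h7 : γ (S 1) = γ (S 0) := by simpa using H.curve.smooth_Γ.2 0
    rw [h4, h7] at h6
    have h8 : (starRingEnd ℂ) (deriv γ (S 0)) * (γ (S 0) - γ (S y))
        = -((starRingEnd ℂ) (deriv γ (S 0)) * (γ (S y) - γ (S 0))) := by ring
    rw [h8, Complex.neg_im] at h6
    linarith

/-- If the potential is constant, then so is the curvature. -/
theorem LazutkinChart.r_eq_of_potential_const (H : LazutkinChart ℓ γ c r S)
    (hΩ : IsBilliardDomain Ω ℓ γ) (hB : ∀ x, deriv (potential c r) x = 0) (x : ℝ) :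
    r x = r 0 := by
  obtain ⟨τ, hτ, hτ1⟩ := H.exists_tangent_angle hΩ
  have hc := H.curve.c_pos
  have hr := H.curve.r_pos
  have hB' : ∀ x, potential c r x = potential c r 0 := fun x =>
    is_const_of_deriv_eq_zero (smoothPeriodic_potential H.curve.smooth_r hr).differentiable hB x 0
  set b := potential c r 0 with hb
  have hτs : ∀ x y, τ (x + 1) - τ x = τ (y + 1) - τ y := fun x y => by
    have h1 : ∀ x, HasDerivAt (fun x => τ (x + 1) - τ x) 0 x := fun x => by
      have := ((hτ (x + 1)).comp_add_const x 1).sub (hτ x)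
      rwa [H.curve.smooth_r.2 x, sub_self] at this
    exact is_const_of_deriv_eq_zero (fun x => (h1 x).differentiableAt) (fun x => (h1 x).deriv) x y
  -- With `u = 1 / r²` and `d/dτ = (r / c) d/dx`, constancy of the potential reads `4 u'' + u + 240
  -- b / c² = 0`. `Q` is the first integral `(u + 240 b / c² + 2 i u') e^{iτ/2}` of this oscillator.
  set Q : ℝ → ℂ := fun x => (((1 / r x ^ 2 + 240 * b / c ^ 2 : ℝ) : ℂ)
    - ((4 * deriv r x / (c * r x ^ 2) : ℝ) : ℂ) * Complex.I)
      * Complex.exp ((τ x / 2 : ℝ) * Complex.I) with hQ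
  have hQd : ∀ x, HasDerivAt Q 0 x := by
    intro x
    have h0 : r x ≠ 0 := (hr x).ne'
    have hc0 := hc.ne'
    have d0 := H.curve.smooth_r.hasDerivAt x
    have d1 := H.curve.smooth_r.deriv.hasDerivAt x
    have hre := ((hasDerivAt_const x (1 : ℝ)).div (d0.pow 2) (pow_ne_zero _ h0)).add_const
      (240 * b / c ^ 2)
    have him := (d1.const_mul 4).div ((d0.pow 2).const_mul c) (mul_ne_zero hc0 (pow_ne_zero _ h0))
    have hex := (((hτ x).div_const 2).ofReal_comp.mul_const Complex.I).cexp
    refine ((hre.ofReal_comp.sub (him.ofReal_comp.mul_const Complex.I)).mul hex).congr_deriv ?_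
    have hbx : b = _ := (hB' x).symm.trans rfl
    rw [potential] at hbx
    have h0' : (r x : ℂ) ≠ 0 := by exact_mod_cast h0
    have hc0' : (c : ℂ) ≠ 0 := by exact_mod_cast hc0
    have hb2 : (b : ℂ) = (1 / 60) * (2 * ((deriv (deriv r) x : ℝ) : ℂ) / r x
        - 4 * ((deriv r x : ℝ) : ℂ) ^ 2 / r x ^ 2 - c ^ 2 / (4 * r x ^ 2)) := by
      rw [hbx]; push_cast; ring
    simp only [Pi.pow_apply, Pi.div_apply, Pi.sub_apply]
    push_cast
    rw [hb2]
    have hI : Complex.I ^ 2 = -1 := Complex.I_sq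
    field_simp
    ring_nf
    rw [hI]
    ring
  have hQc : ∀ x y, Q x = Q y := is_const_of_deriv_eq_zero (fun x => (hQd x).differentiableAt)
    fun x => (hQd x).deriv
  have hQ0 : ∀ x, Q x = 0 := by
    intro x
    -- Over one period of the curve `τ` grows by `2π`, so the exponential changes sign while the
    -- first factor is periodic. Being constant, `Q` vanishes.
    have h1 : Q (x + 1) = -Q x := by
      have h2 : τ (x + 1) = τ x + 2 * Real.pi := by
        have := hτs x 0
        rw [zero_add] at this
        linarith
      have h3 : ((τ (x + 1) / 2 : ℝ) : ℂ) * Complex.I = (τ x / 2 : ℝ) * Complex.I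
          + Real.pi * Complex.I := by rw [h2]; push_cast; ring
      simp only [hQ]
      rw [h3, Complex.exp_add, Complex.exp_pi_mul_I, H.curve.smooth_r.2 x,
        H.curve.smooth_r.deriv.2 x]
      ring
    have h2 := hQc (x + 1) x
    rw [h1] at h2
    exact self_eq_neg.1 h2.symm
  have hsq : ∀ x, 1 / r x ^ 2 + 240 * b / c ^ 2 = 0 := by
    intro x
    have h1 := (mul_eq_zero.1 (hQ0 x)).resolve_right (Complex.exp_ne_zero _)
    have h2 := congrArg Complex.re h1
    simpa only [Complex.sub_re, Complex.ofReal_re, Complex.re_ofReal_mul, Complex.I_re, mul_zero,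
      sub_zero, Complex.zero_re] using h2
  have h1 : 1 / r x ^ 2 = 1 / r 0 ^ 2 := by linarith [hsq x, hsq 0]
  have h2 : r x ^ 2 = r 0 ^ 2 := by simpa using h1
  exact (pow_left_inj₀ (hr x).le (hr 0).le two_ne_zero).1 h2

end

/-! ### Discs -/

section

variable {Ω : Set ℂ} {ℓ : ℝ} {γ : ℝ → ℂ} {c : ℝ} {r S : ℝ → ℝ}

/-- A connected set that avoids the sphere cannot cross the boundary of `Ω`, so it lies in `Ω` as
soon as it meets it. Applied to an outward ray this contradicts boundedness; applied to the open
ball it gives equality. -/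
theorem eq_ball_of_frontier_subset_sphere {Ω : Set ℂ} (ho : IsOpen Ω) (hn : Ω.Nonempty)
    (hb : Bornology.IsBounded Ω) {z : ℂ} {R : ℝ} (hR : 0 < R)
    (hf : frontier Ω ⊆ Metric.sphere z R) : Ω = Metric.ball z R := by
  have key : ∀ A : Set ℂ, IsPreconnected A → Disjoint A (Metric.sphere z R) → (A ∩ Ω).Nonempty →
      A ⊆ Ω := by
    intro A hA hd hne
    by_contra hcon
    obtain ⟨a, ha, hna⟩ := not_subset.1 hcon
    have hcov : ∀ w ∈ A, w ∉ Ω → w ∉ closure Ω := fun w hw hwn hwc =>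
      disjoint_left.1 hd hw (hf ⟨hwc, by rwa [ho.interior_eq]⟩)
    obtain ⟨w, -, hw1, hw2⟩ := hA Ω (closure Ω)ᶜ ho isClosed_closure.isOpen_compl
      (fun w hw => or_iff_not_imp_left.2 (hcov w hw)) hne ⟨a, ha, hcov a ha hna⟩
    exact hw2 (subset_closure hw1)
  have hsub : Ω ⊆ Metric.closedBall z R := by
    intro p hp
    by_contra hcon
    rw [Metric.mem_closedBall, not_le, dist_eq_norm] at hcon
    have hray : (fun t : ℝ => z + t • (p - z)) '' Ici 1 ⊆ Ω := by
      refine key _ (isPreconnected_Ici.image _ (by fun_prop)) ?_ ⟨p, ⟨1, self_mem_Ici, by simp⟩, hp⟩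
      rw [disjoint_left]
      rintro _ ⟨t, ht, rfl⟩ hs
      rw [mem_sphere_iff_norm, add_sub_cancel_left, norm_smul, Real.norm_of_nonneg
        (zero_le_one.trans ht)] at hs
      have : (1 : ℝ) ≤ t := ht
      nlinarith
    obtain ⟨C, hC⟩ := hb.exists_norm_le
    have hp0 : 0 < ‖p - z‖ := hR.trans hcon
    set t : ℝ := max 1 ((C + ‖z‖ + 1) / ‖p - z‖) with ht
    have h1 := hC _ (hray ⟨t, mem_Ici.2 (le_max_left _ _), rfl⟩)
    have h2 : ‖t • (p - z)‖ ≤ ‖z + t • (p - z)‖ + ‖z‖ := by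
      calc ‖t • (p - z)‖ = ‖(z + t • (p - z)) - z‖ := by rw [add_sub_cancel_left]
        _ ≤ _ := norm_sub_le _ _
    rw [norm_smul, Real.norm_of_nonneg (zero_le_one.trans (le_max_left _ _))] at h2
    have h3 : (C + ‖z‖ + 1) / ‖p - z‖ ≤ t := le_max_right _ _
    rw [div_le_iff₀ hp0] at h3
    linarith
  have hsub' : Ω ⊆ Metric.ball z R := by
    rw [← interior_closedBall z hR.ne']
    exact interior_maximal hsub ho
  refine hsub'.antisymm (key _ (convex_ball z R).isPreconnected ?_ ?_)
  · exact Metric.sphere_disjoint_ball.symm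
  · obtain ⟨p, hp⟩ := hn
    exact ⟨p, hsub' hp, hp⟩

/-- Differentiating `|γ - z|² = R²` twice shows that the radius is orthogonal to the tangent and
that curvature times their determinant is `1`. The determinant is `±R`, and positive curvature
selects `R`. -/
theorem IsBilliardDomain.curvature_eq_of_isDisc (hΩ : IsBilliardDomain Ω ℓ γ) (hD : IsDisc Ω) :
    ∃ k, ∀ s, curvature γ s = k := by
  obtain ⟨z, R, hR, rfl⟩ := hD
  refine ⟨1 / R, fun s => ?_⟩
  have hdiff : Differentiable ℝ γ := hΩ.smooth.differentiable (by simp)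
  have hd : ContDiff ℝ ∞ (deriv γ) := (contDiff_infty_iff_deriv.1 hΩ.smooth).2
  have hsph : ∀ s, ‖γ s - z‖ = R := fun s => by
    have : γ s ∈ frontier (Metric.ball z R) := by rw [hΩ.boundary]; exact mem_range_self s
    rwa [frontier_ball z hR.ne', mem_sphere_iff_norm] at this
  have h1 : ∀ s, HasDerivAt (fun s => γ s - z) (deriv γ s) s := fun s =>
    (hdiff s).hasDerivAt.sub_const z
  have h2 : ∀ s, HasDerivAt (deriv γ) (deriv (deriv γ) s) s := fun s =>
    (hd.differentiable (by simp) s).hasDerivAt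
  have h3 : ∀ s, inner ℝ (γ s - z) (deriv γ s) = 0 := fun s => by
    have h4 := (h1 s).inner ℝ (h1 s)
    have h5 : (fun s => inner ℝ (γ s - z) (γ s - z)) = fun _ => R ^ 2 := funext fun s => by
      rw [real_inner_self_eq_norm_sq, hsph]
    rw [h5] at h4
    have h6 := h4.unique (hasDerivAt_const s _)
    rw [real_inner_comm] at h6
    rw [real_inner_comm] 
    linarith
  have h7 := (h1 s).inner ℝ (h2 s)
  rw [funext h3] at h7
  have h8 := h7.unique (hasDerivAt_const s _)
  rw [real_inner_self_eq_norm_sq, hΩ.unit_speed, hΩ.deriv_deriv_eq] at h8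
  have h9 := h3 s
  set e := deriv γ s with he
  set p := γ s - z with hp
  set k := curvature γ s with hk
  have hkpos : 0 < k := hΩ.curvature_pos s
  have hen : e.re * e.re + e.im * e.im = 1 := by
    have := hΩ.unit_speed s
    rw [← Complex.normSq_apply, Complex.normSq_eq_norm_sq, this]; norm_num
  have hpn : p.re * p.re + p.im * p.im = R ^ 2 := by
    rw [← Complex.normSq_apply, Complex.normSq_eq_norm_sq, hsph]
  rw [Complex.inner] at h8 h9
  simp only [Complex.mul_re, Complex.mul_im, Complex.conj_re, Complex.conj_im, Complex.I_re,
    Complex.I_im, Complex.ofReal_re, Complex.ofReal_im] at h8 h9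
  have h10 : k * (p.re * e.im - p.im * e.re) = 1 := by linarith
  have h11 : (p.re * e.im - p.im * e.re) ^ 2 = R ^ 2 := by
    have : (p.re * e.im - p.im * e.re) ^ 2 + (p.re * e.re + p.im * e.im) ^ 2
      = (p.re * p.re + p.im * p.im) * (e.re * e.re + e.im * e.im) := by ring
    have h12 : p.re * e.re + p.im * e.im = 0 := by linarith
    rw [h12, hpn, hen] at this
    linarith
  have h13 : 0 < p.re * e.im - p.im * e.re := by
    by_contra hcon
    push Not at hcon
    have := mul_nonpos_of_nonneg_of_nonpos hkpos.le hcon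
    linarith
  have h14 := (pow_left_inj₀ h13.le hR.le two_ne_zero).1 h11
  rw [h14] at h10
  field_simp
  linarith

/-- The centre of curvature `γ + (i / k) γ'` does not move, so the boundary lies on a circle of
radius `1 / k`. -/
theorem IsBilliardDomain.isDisc_of_curvature_eq (hΩ : IsBilliardDomain Ω ℓ γ) {k : ℝ}
    (hk : ∀ s, curvature γ s = k) : IsDisc Ω := by
  have hk0 : 0 < k := hk 0 ▸ hΩ.curvature_pos 0
  have hdiff : Differentiable ℝ γ := hΩ.smooth.differentiable (by simp)
  have hd : ContDiff ℝ ∞ (deriv γ) := (contDiff_infty_iff_deriv.1 hΩ.smooth).2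
  have hkc : (k : ℂ) ≠ 0 := by exact_mod_cast hk0.ne'
  have h1 : ∀ s, HasDerivAt (fun s => γ s + Complex.I / k * deriv γ s) 0 s := by
    intro s
    have h2 : HasDerivAt (deriv γ) (deriv (deriv γ) s) s :=
      (hd.differentiable (by simp) s).hasDerivAt
    refine ((hdiff s).hasDerivAt.add (h2.const_mul (Complex.I / k))).congr_deriv ?_
    rw [hΩ.deriv_deriv_eq, hk]
    field_simp
    rw [Complex.I_sq]
    ring
  have h2 := is_const_of_deriv_eq_zero (fun x => (h1 x).differentiableAt) fun x => (h1 x).deriv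
  refine ⟨γ 0 + Complex.I / k * deriv γ 0, 1 / k, by positivity,
    eq_ball_of_frontier_subset_sphere hΩ.isOpen hΩ.nonempty hΩ.bounded (by positivity) ?_⟩
  rw [hΩ.boundary]
  rintro _ ⟨s, rfl⟩
  have h3 := h2 0 s
  rw [mem_sphere_iff_norm, h3, sub_add_cancel_left, norm_neg, norm_mul, norm_div, Complex.norm_I,
    Complex.norm_real, Real.norm_of_nonneg hk0.le, hΩ.unit_speed, mul_one]

theorem LazutkinChart.isDisc_iff (H : LazutkinChart ℓ γ c r S) (hΩ : IsBilliardDomain Ω ℓ γ) :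
    IsDisc Ω ↔ ∀ x, deriv (potential c r) x = 0 := by
  constructor
  · intro hD x
    obtain ⟨k, hk⟩ := hΩ.curvature_eq_of_isDisc hD
    have h1 : ∀ x, r x = r 0 := fun x => by
      have h2 : ((r x)⁻¹) ^ 3 = ((r 0)⁻¹) ^ 3 := by
        rw [← H.curvature_eq, ← H.curvature_eq, hk, hk]
      have h3 := (pow_left_inj₀ (inv_pos.2 (H.curve.r_pos x)).le
        (inv_pos.2 (H.curve.r_pos 0)).le three_ne_zero).1 h2
      exact inv_injective h3
    have h2 : r = fun _ => r 0 := funext h1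
    have h3 : potential c r = fun _ => potential c r 0 := funext fun x => by
      rw [h2]; simp [potential]
    rw [h3]; simp
  · intro hB
    refine hΩ.isDisc_of_curvature_eq (k := ((r 0)⁻¹) ^ 3) fun s => ?_
    obtain ⟨x, rfl⟩ := H.exists_apply_eq s
    rw [H.curvature_eq, H.r_eq_of_potential_const hΩ hB]

end

/-! ### The periodic correction -/

/-- The `1`-periodic solution of `a'' = -2 B'` with `a 0 = 0`. -/
noncomputable def correction (B : ℝ → ℝ) (x : ℝ) : ℝ :=
  -2 * ((∫ t in (0 : ℝ)..x, B t) - x * ∫ t in (0 : ℝ)..1, B t)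

section Correction

variable {B : ℝ → ℝ}

theorem hasDerivAt_correction (hB : SmoothPeriodic B) (x : ℝ) :
    HasDerivAt (correction B) (-2 * (B x - ∫ t in (0 : ℝ)..1, B t)) x := by
  have h1 := (hB.continuous.integral_hasStrictDerivAt 0 x).hasDerivAt
  have h2 := (hasDerivAt_id x).mul_const (∫ t in (0 : ℝ)..1, B t)
  rw [one_mul] at h2
  exact (h1.sub h2).const_mul (-2)

theorem correction_zero : correction B 0 = 0 := by simp [correction]

theorem deriv_correction (hB : SmoothPeriodic B) :
    deriv (correction B) = fun x => -2 * (B x - ∫ t in (0 : ℝ)..1, B t) :=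
  funext fun x => (hasDerivAt_correction hB x).deriv

theorem smoothPeriodic_correction (hB : SmoothPeriodic B) : SmoothPeriodic (correction B) := by
  refine ⟨contDiff_infty_iff_deriv.2 ⟨fun x => (hasDerivAt_correction hB x).differentiableAt, ?_⟩,
    fun x => ?_⟩
  · rw [deriv_correction hB]
    exact contDiff_const.mul (hB.1.sub contDiff_const)
  · have hi : ∀ a b, IntervalIntegrable B MeasureTheory.volume a b :=
      fun a b => hB.continuous.intervalIntegrable a b
    simp only [correction]
    rw [← intervalIntegral.integral_add_adjacent_intervals (hi 0 x) (hi x (x + 1)),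
      hB.2.intervalIntegral_add_eq x 0, zero_add]
    ring

theorem deriv_deriv_correction (hB : SmoothPeriodic B) (x : ℝ) :
    deriv (deriv (correction B)) x = -2 * deriv B x := by
  rw [deriv_correction hB]
  exact (((hB.hasDerivAt x).sub_const _).const_mul (-2)).deriv

/-- An affine function with two zeros. It also serves to show that the zeroth order coefficient of
any admissible coordinate is the Lazutkin parameter. -/
theorem eq_zero_of_deriv_deriv_eq_zero {f : ℝ → ℝ} (hf : ContDiff ℝ ∞ f)
    (h2 : ∀ x, deriv (deriv f) x = 0) (h0 : f 0 = 0) (h1 : f 1 = 0) (x : ℝ) : f x = 0 := by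
  have hd := (contDiff_infty_iff_deriv.1 hf)
  have hc : ∀ x, deriv f x = deriv f 0 := fun x =>
    is_const_of_deriv_eq_zero (hd.2.differentiable (by simp)) h2 x 0
  have hg : ∀ x, HasDerivAt (fun x => f x - deriv f 0 * x) 0 x := fun x => by
    have := (hd.1 x).hasDerivAt.sub ((hasDerivAt_id x).const_mul (deriv f 0))
    rw [hc x, mul_one, sub_self] at this
    exact this
  have hl : ∀ x, f x - deriv f 0 * x = 0 := fun x => by
    have := is_const_of_deriv_eq_zero (fun x => (hg x).differentiableAt) (fun x => (hg x).deriv) x 0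
    simpa [h0] using this
  have h3 := hl 1
  rw [h1] at h3
  have h4 : deriv f 0 = 0 := by linarith
  have h5 := hl x
  rw [h4] at h5
  linarith

/-- A second order equation on the circle leaves only an additive constant free, and the
normalization at `0` fixes it. The uniqueness claims for `X₁` and `Z₁` are reduced to this. -/
theorem eq_correction (hB : SmoothPeriodic B) {f : ℝ → ℝ} (hf : SmoothPeriodic f)
    (h2 : ∀ x, deriv (deriv f) x = -2 * deriv B x) (h0 : f 0 = 0) (x : ℝ) :
    f x = correction B x := by
  have hc := smoothPeriodic_correction hB
  have hs := hf.sub hc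
  have hd1 : deriv (fun x => f x - correction B x) = fun x => deriv f x - deriv (correction B) x :=
    funext fun x => ((hf.hasDerivAt x).sub (hc.hasDerivAt x)).deriv
  have := eq_zero_of_deriv_deriv_eq_zero hs.1 (fun x => by
      rw [hd1, ((hf.deriv.hasDerivAt x).fun_sub (hc.deriv.hasDerivAt x)).deriv, h2,
        deriv_deriv_correction hB, sub_self])
    (by simp [h0, correction_zero])
    (by
      have e1 := hs.2 0
      simp only [zero_add] at e1
      rw [e1, h0, correction_zero, sub_zero]) x
  linarith

theorem correction_eq_zero_iff (hB : SmoothPeriodic B) :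
    (∀ x, correction B x = 0) ↔ ∀ x, deriv B x = 0 := by
  constructor
  · intro h x
    have h1 := deriv_deriv_correction hB x
    have h2 : correction B = fun _ => 0 := funext h
    rw [h2] at h1
    simp at h1
    exact h1
  · intro h x
    exact (eq_correction hB (smoothPeriodic_const 0) (fun x => by simp [h x]) rfl x).symm

end Correction

/-! ### The reflection law near the boundary -/

/-- `T x h` has the expansion of a chord angle in the Lazutkin parametrization. -/
structure AngleExpansion (T : ℝ → ℝ → ℝ) (A₁ A₃ A₅ B : ℝ → ℝ) : Prop where
  smooth₁ : SmoothPeriodic A₁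
  smooth₃ : SmoothPeriodic A₃
  smooth₅ : SmoothPeriodic A₅
  smooth_B : SmoothPeriodic B
  pos : ∀ x, 0 < A₁ x
  bdd : Bdd stripFilter fun a => (T a.1 a.2 - (A₁ a.1 * a.2 + A₃ a.1 * a.2 ^ 3
    + A₁ a.1 * deriv B a.1 * a.2 ^ 4 + A₅ a.1 * a.2 ^ 5)) / a.2 ^ 6

theorem LazutkinChart.exists_angleExpansion {ℓ : ℝ} {γ : ℝ → ℂ} {c : ℝ} {r S : ℝ → ℝ}
    (H : LazutkinChart ℓ γ c r S) : ∃ A₁ A₃ A₅ : ℝ → ℝ,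
      AngleExpansion (chordAngle (fun x => γ (S x)) fun x => deriv γ (S x)) A₁ A₃ A₅
        (potential c r) := by
  obtain ⟨-, A₃, A₅, h3, h5, hb⟩ := H.curve.exists_chordAngle_expansion
  have hr := H.curve.r_pos
  have hc := H.curve.c_pos
  exact ⟨fun x => c / (2 * r x), A₃, A₅, (smoothPeriodic_const c).div
    ((smoothPeriodic_const 2).mul H.curve.smooth_r) fun x => mul_ne_zero two_ne_zero (hr x).ne',
    h3, h5, smoothPeriodic_potential H.curve.smooth_r hr, fun x => by
      have := hr x; positivity, hb⟩

namespace AngleExpansion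

variable {T : ℝ → ℝ → ℝ} {A₁ A₃ A₅ B : ℝ → ℝ}

theorem exists_eq (h : AngleExpansion T A₁ A₃ A₅ B) : ∃ R : ℝ × ℝ → ℝ, Bdd stripFilter R ∧
    ∀ x t, t ≠ 0 → T x t = A₁ x * t + A₃ x * t ^ 3 + A₁ x * deriv B x * t ^ 4 + A₅ x * t ^ 5
      + t ^ 6 * R (x, t) := by
  refine ⟨_, h.bdd, fun x t h0 => ?_⟩
  field_simp
  ring

/-- The quotient tends to `A₁` uniformly, and `A₁` is pinched between positive constants by
periodicity. -/
theorem exists_ratio_bounds (h : AngleExpansion T A₁ A₃ A₅ B) : ∃ k > 0, ∃ K > 0,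
    ∀ᶠ a in stripFilter, k ≤ T a.1 a.2 / a.2 ∧ T a.1 a.2 / a.2 ≤ K := by
  obtain ⟨R, hR, hT⟩ := h.exists_eq
  obtain ⟨k, hk, hk'⟩ := h.smooth₁.exists_pos_le h.pos
  obtain ⟨K, hK, hK'⟩ := h.smooth₁.bounded
  have b3 := h.smooth₃.bdd_fst
  have b4 := (h.smooth₁.mul h.smooth_B.deriv).bdd_fst
  have b5 := h.smooth₅.bdd_fst
  have bh := bdd_snd
  have b : Bdd stripFilter fun a => A₃ a.1 * a.2 + A₁ a.1 * deriv B a.1 * a.2 ^ 2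
      + A₅ a.1 * a.2 ^ 3 + a.2 ^ 4 * R a := by
    repeat' first | with_reducible assumption | with_reducible exact bdd_const _ | apply Bdd.pow |
      with_reducible apply Bdd.add | with_reducible apply Bdd.sub | with_reducible apply Bdd.mul
  refine ⟨k / 2, by positivity, K + k / 2, by positivity, ?_⟩
  filter_upwards [b.eventually_abs_snd_mul_lt (half_pos hk), eventually_snd_ne_zero] with a ha h0
  have e : T a.1 a.2 / a.2 = A₁ a.1 + a.2 * (A₃ a.1 * a.2 + A₁ a.1 * deriv B a.1 * a.2 ^ 2
      + A₅ a.1 * a.2 ^ 3 + a.2 ^ 4 * R a) := by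
    rw [hT a.1 a.2 h0]; field_simp; ring
  rw [e]
  have h1 := hk' a.1
  have h2 := (le_abs_self _).trans (hK' a.1)
  rw [abs_lt] at ha
  constructor <;> linarith [ha.1, ha.2]

theorem abs_pow_sub_pow_le {p m M : ℝ} (hp : 0 ≤ p) (hm : 0 ≤ m) (hpM : p ≤ M) (hmM : m ≤ M)
    (n : ℕ) : |p ^ n - m ^ n| ≤ n * M ^ (n - 1) * |p - m| := by
  refine (_root_.abs_pow_sub_pow_le p m n).trans ?_
  have : max |p| |m| ≤ M := by rw [abs_of_nonneg hp, abs_of_nonneg hm]; exact max_le hpM hmM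
  rw [mul_comm |p - m|, mul_right_comm]
  gcongr

/-- The reflection law, as a second order difference equation. -/
theorem exists_reflection_bound (h : AngleExpansion T A₁ A₃ A₅ B) : ∃ C > 0, ∃ δ > 0,
    ∀ x p m M : ℝ, 0 < p → 0 < m → p ≤ M → m ≤ M → M < δ →
      |T x p + T x (-m) - A₁ x * ((p - m) + deriv B x * (p ^ 4 + m ^ 4))|
        ≤ C * (M ^ 2 * |p - m| + M ^ 6) := by
  obtain ⟨R, hR, hT⟩ := h.exists_eq
  obtain ⟨C₀, hC₀, δ, hδ, hb⟩ := hR.exists_bound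
  obtain ⟨C₃, hC₃, h3⟩ := h.smooth₃.bounded
  obtain ⟨C₅, hC₅, h5⟩ := h.smooth₅.bounded
  refine ⟨3 * C₃ + 5 * C₅ + 2 * C₀, by positivity, min δ 1, by positivity,
    fun x p m M hp hm hpM hmM hM => ?_⟩
  have hMδ := hM.trans_le (min_le_left _ _)
  have hM1 := hM.trans_le (min_le_right _ _)
  have hM0 : 0 < M := hp.trans_le hpM
  -- The even term survives doubled, while the odd terms become differences `p³ - m³` and `p⁵ - m⁵`,
  -- both `O(M² |p - m|)`.
  have e : T x p + T x (-m) - A₁ x * ((p - m) + deriv B x * (p ^ 4 + m ^ 4))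
      = A₃ x * (p ^ 3 - m ^ 3) + A₅ x * (p ^ 5 - m ^ 5) + p ^ 6 * R (x, p) + m ^ 6 * R (x, -m) := by
    rw [hT x p hp.ne', hT x (-m) (neg_ne_zero.2 hm.ne')]; ring
  have r1 := hb x p hp.ne' (by rw [abs_of_pos hp]; linarith)
  have r2 := hb x (-m) (neg_ne_zero.2 hm.ne') (by rw [abs_neg, abs_of_pos hm]; linarith)
  have d3 := abs_pow_sub_pow_le hp.le hm.le hpM hmM 3
  have d5 := abs_pow_sub_pow_le hp.le hm.le hpM hmM 5
  have hM4 : M ^ 4 ≤ M ^ 2 := pow_le_pow_of_le_one hM0.le hM1.le (by norm_num)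
  norm_num at d3 d5
  rw [e]
  have t1 : |A₃ x * (p ^ 3 - m ^ 3)| ≤ C₃ * (3 * M ^ 2 * |p - m|) := by
    rw [abs_mul]; exact mul_le_mul (h3 x) d3 (abs_nonneg _) hC₃.le
  have t2 : |A₅ x * (p ^ 5 - m ^ 5)| ≤ C₅ * (5 * M ^ 2 * |p - m|) := by
    rw [abs_mul]
    refine mul_le_mul (h5 x) (d5.trans ?_) (abs_nonneg _) hC₅.le
    gcongr
  have t3 : |p ^ 6 * R (x, p)| ≤ M ^ 6 * C₀ := by
    rw [abs_mul, abs_of_pos (pow_pos hp 6)]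
    gcongr
  have t4 : |m ^ 6 * R (x, -m)| ≤ M ^ 6 * C₀ := by
    rw [abs_mul, abs_of_pos (pow_pos hm 6)]
    gcongr
  have q1 : 0 ≤ M ^ 2 * |p - m| := by positivity
  have q2 : 0 ≤ M ^ 6 := by positivity
  calc _ ≤ |A₃ x * (p ^ 3 - m ^ 3)| + |A₅ x * (p ^ 5 - m ^ 5)| + |p ^ 6 * R (x, p)|
        + |m ^ 6 * R (x, -m)| := by
        refine (abs_add_le _ _).trans (add_le_add ((abs_add_le _ _).trans
          (add_le_add (abs_add_le _ _) le_rfl)) le_rfl)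
    _ ≤ C₃ * (3 * M ^ 2 * |p - m|) + C₅ * (5 * M ^ 2 * |p - m|) + M ^ 6 * C₀ + M ^ 6 * C₀ := by
        gcongr
    _ ≤ _ := by nlinarith [mul_nonneg hC₀.le q1, mul_nonneg hC₃.le q2, mul_nonneg hC₅.le q2]

/-- Consecutive steps that satisfy the reflection law have almost the same length. -/
theorem exists_step_bound (h : AngleExpansion T A₁ A₃ A₅ B) : ∃ C > 0, ∃ δ > 0,
    ∀ x p m : ℝ, 0 < p → 0 < m → p < δ → m < δ → T x p + T x (-m) = 0 → |p - m| ≤ C * m ^ 4 := by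
  obtain ⟨C, hC, δ, hδ, hN⟩ := h.exists_reflection_bound
  obtain ⟨k, hk, hk'⟩ := h.smooth₁.exists_pos_le h.pos
  obtain ⟨b, hb, hb'⟩ := h.smooth_B.deriv.bounded
  set D := 2 * (2 * b + C / k) with hD
  have hD0 : 0 < D := by positivity
  -- `M ≤ k / (2 C)` lets half of `k |p - m|` absorb `C M² |p - m|`, which leaves `|p - m| ≤ D M⁴`.
  -- Then `M ≤ 1 / (2 D)` gives `|p - m| ≤ M / 2` and so `M ≤ 2 m`, whence the factor `16 = 2⁴`.
  refine ⟨16 * D, by positivity, min δ (min 1 (min (k / (2 * C)) (1 / (2 * D)))), by positivity,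
    fun x p m hp hm hpδ hmδ hT => ?_⟩
  obtain ⟨M, hM, hpM, hmM, hMδ⟩ : ∃ M, (M = p ∨ M = m) ∧ p ≤ M ∧ m ≤ M ∧
      M < min δ (min 1 (min (k / (2 * C)) (1 / (2 * D)))) :=
    ⟨max p m, max_choice p m, le_max_left _ _, le_max_right _ _, max_lt hpδ hmδ⟩
  have m1 := hMδ.trans_le (min_le_left _ _)
  have m2 := hMδ.trans_le ((min_le_right _ _).trans (min_le_left _ _))
  have m3 := hMδ.trans_le ((min_le_right _ _).trans ((min_le_right _ _).trans (min_le_left _ _)))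
  have m4 := hMδ.trans_le ((min_le_right _ _).trans ((min_le_right _ _).trans (min_le_right _ _)))
  rw [lt_div_iff₀ (by positivity)] at m3 m4
  have hM0 : 0 < M := hp.trans_le hpM
  have h1 := hN x p m M hp hm hpM hmM m1
  rw [hT, zero_sub, abs_neg, abs_mul, abs_of_pos (h.pos x)] at h1
  have h2 : k * |(p - m) + deriv B x * (p ^ 4 + m ^ 4)| ≤ C * (M ^ 2 * |p - m| + M ^ 6) :=
    le_trans (by gcongr; exact hk' x) h1
  have h3 : |p - m| ≤ |(p - m) + deriv B x * (p ^ 4 + m ^ 4)| + |deriv B x * (p ^ 4 + m ^ 4)| := by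
    have := abs_sub ((p - m) + deriv B x * (p ^ 4 + m ^ 4)) (deriv B x * (p ^ 4 + m ^ 4))
    rwa [add_sub_cancel_right] at this
  have h4 : |deriv B x * (p ^ 4 + m ^ 4)| ≤ b * (2 * M ^ 4) := by
    rw [abs_mul, abs_of_pos (show 0 < p ^ 4 + m ^ 4 by positivity)]
    have e1 : p ^ 4 ≤ M ^ 4 := by gcongr
    have e2 : m ^ 4 ≤ M ^ 4 := by gcongr
    exact mul_le_mul (hb' x) (by linarith) (by positivity) hb.le
  have hM2 : M ^ 2 ≤ M := by nlinarith
  have h5 : C * (M ^ 2 * |p - m|) ≤ k / 2 * |p - m| := by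
    have : C * M ^ 2 ≤ k / 2 := by nlinarith
    nlinarith [abs_nonneg (p - m)]
  have h6 : M ^ 6 ≤ M ^ 4 := pow_le_pow_of_le_one hM0.le m2.le (by norm_num)
  have h7 : |p - m| ≤ D * M ^ 4 := by
    have e1 : k * |p - m| ≤ k / 2 * |p - m| + C * M ^ 4 + k * (b * (2 * M ^ 4)) := by
      have := mul_le_mul_of_nonneg_left h3 hk.le
      have := mul_le_mul_of_nonneg_left h4 hk.le
      have := mul_le_mul_of_nonneg_left h6 hC.le
      nlinarith
    have e2 : k / 2 * |p - m| ≤ k / 2 * (D * M ^ 4) := by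
      have : k / 2 * (D * M ^ 4) = C * M ^ 4 + k * (b * (2 * M ^ 4)) := by
        rw [hD]; field_simp; ring
      linarith
    exact le_of_mul_le_mul_left e2 (by positivity)
  have h8 : M ≤ 2 * m := by
    rcases hM with hMp | hMm
    · have e1 : D * M ^ 4 ≤ M / 2 := by
        have e3 : M ^ 4 ≤ M * M := by
          have := pow_le_pow_of_le_one hM0.le m2.le (show 2 ≤ 4 by norm_num)
          nlinarith
        have e4 : D * M ≤ 1 / 2 := by linarith
        nlinarith [mul_le_mul_of_nonneg_left e3 hD0.le]
      have e2 := le_abs_self (p - m)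
      linarith
    · linarith
  calc |p - m| ≤ D * M ^ 4 := h7
    _ ≤ D * (2 * m) ^ 4 := by gcongr
    _ = 16 * D * m ^ 4 := by ring

end AngleExpansion

/-! ### Periodic orbits -/

/-- A function on `{0, …, q}` that vanishes at the endpoints is controlled by its second
differences. -/
theorem abs_le_of_second_difference {q : ℕ} {e : ℕ → ℝ} {D : ℝ} (hq1 : 2 ≤ q)
    (h0 : e 0 = 0) (hq : e q = 0)
    (h : ∀ k, k + 1 < q → |e (k + 2) - 2 * e (k + 1) + e k| ≤ D) (k : ℕ) (hk : k ≤ q) :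
    |e k| ≤ 2 * q ^ 2 * D := by
  have hD : 0 ≤ D := (abs_nonneg _).trans (h 0 (by omega))
  -- Summing once compares each slope with the first one, and summing again compares `e k` with `k *
  -- e 1`. The zero at `q` then bounds the first slope itself.
  have h1 : ∀ k, k < q → |e (k + 1) - e k - e 1| ≤ k * D := by
    intro k
    induction k with
    | zero => intro _; simp [h0]
    | succ k ih =>
      intro hk
      have a1 := ih (by omega)
      have a2 := h k hk
      have e1 : e (k + 2) - e (k + 1) - e 1 = (e (k + 1) - e k - e 1)
        + (e (k + 2) - 2 * e (k + 1) + e k) := by ring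
      rw [e1]
      push_cast
      linarith [abs_add_le (e (k + 1) - e k - e 1) (e (k + 2) - 2 * e (k + 1) + e k)]
  have h2 : ∀ k, k ≤ q → |e k - k * e 1| ≤ k * q * D := by
    intro k
    induction k with
    | zero => intro _; simp [h0]
    | succ k ih =>
      intro hk
      have a1 := ih (by omega)
      have a2 := h1 k (by omega)
      have e1 : e (k + 1) - ((k + 1 : ℕ) : ℝ) * e 1
          = (e k - k * e 1) + (e (k + 1) - e k - e 1) := by
        push_cast; ring
      rw [e1]
      have a3 : (k : ℝ) * D ≤ q * D := by gcongr; omega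
      push_cast
      linarith [abs_add_le (e k - k * e 1) (e (k + 1) - e k - e 1)]
  have hq0 : (0 : ℝ) < q := by exact_mod_cast (by omega : 0 < q)
  have h3 : |e 1| ≤ q * D := by
    have := h2 q le_rfl
    rw [hq, zero_sub, abs_neg, abs_mul, abs_of_pos hq0, mul_assoc] at this
    exact le_of_mul_le_mul_left this hq0
  have h4 := h2 k hk
  have hkq : (k : ℝ) ≤ q := by exact_mod_cast hk
  have h5 : |(k : ℝ) * e 1| ≤ q * (q * D) := by
    rw [abs_mul, abs_of_nonneg (Nat.cast_nonneg k)]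
    gcongr
  have h6 : (k : ℝ) * q * D ≤ q * q * D := by gcongr
  calc |e k| = |(e k - k * e 1) + k * e 1| := by ring_nf
    _ ≤ |e k - k * e 1| + |k * e 1| := abs_add_le _ _
    _ ≤ 2 * q ^ 2 * D := by linarith

section

variable {Ω : Set ℂ} {ℓ : ℝ} {γ : ℝ → ℂ} {c : ℝ} {r S : ℝ → ℝ}

/-- A short step of a billiard orbit is followed by a short step, and the reflection law at the
common collision point is an equation between chord angles. -/
theorem LazutkinChart.exists_reflection (H : LazutkinChart ℓ γ c r S)
    (hΩ : IsBilliardDomain Ω ℓ γ) {δ : ℝ} (hδ : 0 < δ) : ∃ δ₁ > 0, ∀ q σ, IsPeriodicOrbit ℓ γ q σ →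
    ∀ k : ℤ, lazutkinParam ℓ γ (σ (k + 1)) - lazutkinParam ℓ γ (σ k) < δ₁ →
      lazutkinParam ℓ γ (σ (k + 2)) - lazutkinParam ℓ γ (σ (k + 1)) < δ ∧
      chordAngle (fun x => γ (S x)) (fun x => deriv γ (S x)) (lazutkinParam ℓ γ (σ (k + 1)))
          (lazutkinParam ℓ γ (σ (k + 2)) - lazutkinParam ℓ γ (σ (k + 1)))
        + chordAngle (fun x => γ (S x)) (fun x => deriv γ (S x)) (lazutkinParam ℓ γ (σ (k + 1)))
          (-(lazutkinParam ℓ γ (σ (k + 1)) - lazutkinParam ℓ γ (σ k))) = 0 := by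
  obtain ⟨A₁, A₃, A₅, hA⟩ := H.exists_angleExpansion
  obtain ⟨_, -, K, hK, hT⟩ := hA.exists_ratio_bounds
  obtain ⟨d₁, hd₁, hT⟩ := eventually_stripFilter.1 hT
  obtain ⟨d₂, hd₂, hang⟩ := H.exists_angle_eq
  obtain ⟨d₃, hd₃, hsmall⟩ := H.exists_lt_of_angle_lt hΩ (lt_min hδ hd₂)
  -- A step shorter than `d₃ / K` arrives with an angle below `d₃`. The outgoing angle is the same,
  -- so the next chord is short as well.
  refine ⟨min d₁ (min d₂ (d₃ / K)), by positivity, fun q σ hσ k hk => ?_⟩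
  obtain ⟨-, -, φ, hφ⟩ := hσ
  obtain ⟨a1, a2, -, a4⟩ := hφ k
  obtain ⟨b1, b2, b3, -⟩ := hφ (k + 1)
  rw [show k + 1 + 1 = k + 2 by ring] at b1 b2 b3
  set x₀ := lazutkinParam ℓ γ (σ k) with hx₀
  set x₁ := lazutkinParam ℓ γ (σ (k + 1)) with hx₁
  set x₂ := lazutkinParam ℓ γ (σ (k + 2)) with hx₂
  have s0 : S x₀ = σ k := H.apply_param _
  have s1 : S x₁ = σ (k + 1) := H.apply_param _
  have s2 : S x₂ = σ (k + 2) := H.apply_param _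
  have l1 : x₀ < x₁ := H.strictMono_param a1
  have l2 : x₁ < x₂ := H.strictMono_param b1
  have l3 : x₂ < x₁ + 1 := by
    rw [hx₁, ← H.param_add]; exact H.strictMono_param b2
  have k1 := hk.trans_le (min_le_left _ _)
  have k2 := hk.trans_le ((min_le_right _ _).trans (min_le_left _ _))
  have k3 := hk.trans_le ((min_le_right _ _).trans (min_le_right _ _))
  rw [lt_div_iff₀ hK] at k3
  have e1 := (hang x₁ (x₁ - x₀) (by linarith) k2).2
  rw [sub_sub_cancel, s0, s1, ← a4] at e1
  have r1 := (hT x₁ (-(x₁ - x₀)) (by linarith) (by rw [abs_neg, abs_of_pos] <;> linarith)).2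
  simp only at r1
  rw [div_le_iff_of_neg (by linarith)] at r1
  have hφs : φ (k + 1) < d₃ := by
    rw [e1]; linarith
  have hlt := hsmall x₁ x₂ l2 l3 (by rw [s1, s2, ← b3]; exact hφs)
  have l4 : x₂ - x₁ < min δ d₂ := by linarith
  have e2 := (hang x₁ (x₂ - x₁) (by linarith) (l4.trans_le (min_le_right _ _))).1
  rw [add_sub_cancel, s1, s2, ← b3] at e2
  exact ⟨l4.trans_le (min_le_left _ _), by linarith⟩

/-- The steps of a periodic orbit of rotation number `1/q` are `1/q + O(q⁻³)`. -/
theorem LazutkinChart.exists_orbit_step_bound (H : LazutkinChart ℓ γ c r S)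
    (hΩ : IsBilliardDomain Ω ℓ γ) {η : ℝ} (hη : 0 < η) : ∃ C > 0, ∃ q₀ : ℕ, ∀ q ≥ q₀, ∀ σ,
    IsPeriodicOrbit ℓ γ q σ → ∀ k : ℤ,
      |lazutkinParam ℓ γ (σ (k + 1)) - lazutkinParam ℓ γ (σ k) - 1 / q| ≤ C / q ^ 3 ∧
      lazutkinParam ℓ γ (σ (k + 1)) - lazutkinParam ℓ γ (σ k) < η := by
  obtain ⟨A₁, A₃, A₅, hA⟩ := H.exists_angleExpansion
  obtain ⟨C, hC, δ, hδ, hstep⟩ := hA.exists_step_bound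
  obtain ⟨δ₁, hδ₁, hrefl⟩ := H.exists_reflection hΩ hδ
  obtain ⟨q₁, hq₁⟩ := exists_nat_gt (2 / min η (min δ δ₁) + 16 * C + 1)
  refine ⟨32 * C, by positivity, q₁, fun q hq σ hσ => ?_⟩
  have hqr : 2 / min η (min δ δ₁) + 16 * C + 1 < q := hq₁.trans_le (by exact_mod_cast hq)
  have hmin : 0 < min η (min δ δ₁) := by positivity
  have hq0 : (0 : ℝ) < q := by
    have : 0 < 2 / min η (min δ δ₁) := by positivity
    linarith
  have h2q : 2 / (q : ℝ) < min η (min δ δ₁) := by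
    rw [div_lt_iff₀ hq0]
    have : 2 / min η (min δ δ₁) < q := by linarith
    rw [div_lt_iff₀ hmin] at this
    linarith
  have h16 : 16 * C ≤ (q : ℝ) ^ 2 := by
    have h1 : 16 * C ≤ q := by
      have : 0 < 2 / min η (min δ δ₁) := by positivity
      linarith
    have h2 : (1 : ℝ) ≤ q := by
      have : 0 < 2 / min η (min δ δ₁) := by positivity
      linarith
    nlinarith
  obtain ⟨x, hx⟩ : ∃ x : ℤ → ℝ, x = fun k => lazutkinParam ℓ γ (σ k) := ⟨_, rfl⟩
  have hxq : ∀ k, x (k + q) = x k + 1 := fun k => by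
    simp only [hx, hσ.2.1, H.param_add]
  have hxlt : ∀ k, x k < x (k + 1) := fun k => by
    obtain ⟨φ, hφ⟩ := hσ.2.2
    simp only [hx]; exact H.strictMono_param (hφ k).1
  have hsucc : ∀ k, x (k + 1) - x k ≤ 2 / q →
      |(x (k + 2) - x (k + 1)) - (x (k + 1) - x k)| ≤ 16 * C / q ^ 4 := by
    intro k hk
    have hkm := hk.trans_lt h2q
    have hr := hrefl q σ hσ k (by
      have := hkm.trans_le ((min_le_right _ _).trans (min_le_right _ _))
      simpa only [hx] using this)
    have hl1 := hxlt k
    have hl2 := hxlt (k + 1)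
    rw [show k + 1 + 1 = k + 2 by ring] at hl2
    have hb := hstep (x (k + 1)) (x (k + 2) - x (k + 1)) (x (k + 1) - x k) (by linarith)
      (by linarith) (by simpa only [hx] using hr.1)
      (hkm.trans_le ((min_le_right _ _).trans (min_le_left _ _))) (by simpa only [hx] using hr.2)
    refine hb.trans ?_
    have : (x (k + 1) - x k) ^ 4 ≤ (2 / q) ^ 4 := by
      have : 0 ≤ x (k + 1) - x k := by linarith
      gcongr
    calc C * (x (k + 1) - x k) ^ 4 ≤ C * (2 / q) ^ 4 := by gcongr
      _ = 16 * C / q ^ 4 := by ring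
  have hsum : ∀ k : ℤ, ∑ i ∈ Finset.range q, (x (k + i + 1) - x (k + i)) = 1 := fun k => by
    have := Finset.sum_range_sub (fun i : ℕ => x (k + i)) q
    simp only [hxq, Nat.cast_add, Nat.cast_one, Nat.cast_zero, add_zero, add_sub_cancel_left,
      ← add_assoc] at this
    exact this
  -- Nothing excludes long steps a priori. But `q` steps add up to one turn, so at least one of them
  -- is at most `1 / q`, and control starts from it.
  obtain ⟨j, hj⟩ : ∃ j : ℤ, x (j + 1) - x j ≤ 1 / q := by
    by_contra hcon
    push Not at hcon
    have h1 : ∑ i ∈ Finset.range q, (1 / q : ℝ)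
        < ∑ i ∈ Finset.range q, (x (0 + i + 1) - x (0 + i)) :=
      Finset.sum_lt_sum_of_nonempty (by simpa using by rintro rfl; simp at hq0) fun i _ => hcon _
    rw [hsum] at h1
    simp at h1
    rw [mul_inv_cancel₀ hq0.ne'] at h1
    exact lt_irrefl _ h1
  -- A bootstrap: the successor of a step of size at most `2 / q` differs from it by at most `16 C /
  -- q⁴`. Over `q` steps this drift stays below `1 / q` because `16 C ≤ q²`, so the bound `2 / q` is
  -- never lost.
  have hind : ∀ i : ℕ, i ≤ q → |(x (j + i + 1) - x (j + i)) - (x (j + 1) - x j)|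
      ≤ i * (16 * C / q ^ 4) := by
    intro i
    induction i with
    | zero => intro _; simp
    | succ i ih =>
      intro hi
      have a1 := ih (by omega)
      have a2 : (i : ℝ) * (16 * C / q ^ 4) ≤ 1 / q := by
        have : (i : ℝ) ≤ q := by exact_mod_cast (by omega : i ≤ q)
        calc (i : ℝ) * (16 * C / q ^ 4) ≤ (q : ℝ) * (q ^ 2 / q ^ 4) := by gcongr
          _ = 1 / (q : ℝ) := by field_simp
      have a3 := hsucc (j + i) (by
        have := (abs_le.1 (a1.trans a2)).2
        have e : 2 / (q : ℝ) = 1 / q + 1 / q := by ring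
        linarith)
      have e2 : j + ((i + 1 : ℕ) : ℤ) + 1 = j + i + 2 := by push_cast; ring
      have e3 : j + ((i + 1 : ℕ) : ℤ) = j + i + 1 := by push_cast; ring
      rw [e2, e3]
      push_cast
      have e4 : (x (j + i + 2) - x (j + i + 1)) - (x (j + 1) - x j)
        = ((x (j + i + 2) - x (j + i + 1)) - (x (j + i + 1) - x (j + i)))
          + ((x (j + i + 1) - x (j + i)) - (x (j + 1) - x j)) := by ring
      rw [e4]
      refine (abs_add_le _ _).trans ?_
      linarith
  have hall : ∀ k : ℤ, |(x (k + 1) - x k) - (x (j + 1) - x j)| ≤ 16 * C / q ^ 3 := by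
    intro k
    have hqz : (0 : ℤ) < q := by exact_mod_cast hq0
    have hxm : ∀ (n k : ℤ), x (k + n * q) = x k + n := by
      intro n k
      induction n using Int.induction_on with
      | zero => simp
      | succ n ih =>
        rw [add_mul, one_mul, ← add_assoc, hxq, ih]; push_cast; ring
      | pred n ih =>
        have := hxq (k + (-n - 1) * q)
        rw [show k + (-(n : ℤ) - 1) * q + q = k + -n * q by ring, ih] at this
        push_cast at this ⊢
        linarith
    obtain ⟨m, hm⟩ : ∃ m, m = (k - j) / q := ⟨_, rfl⟩
    obtain ⟨i, hi⟩ : ∃ i, i = (k - j) % q := ⟨_, rfl⟩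
    have hi0 : 0 ≤ i := hi ▸ Int.emod_nonneg _ hqz.ne'
    have hiq : i < q := hi ▸ Int.emod_lt_of_pos _ hqz
    have hk : k = (j + i) + m * q := by
      have := Int.emod_add_mul_ediv (k - j) q
      rw [← hi, ← hm] at this
      linarith
    lift i to ℕ using hi0
    have h1 := hind i (by exact_mod_cast hiq.le)
    have e1 : x (k + 1) - x k = x (j + i + 1) - x (j + i) := by
      rw [hk, hxm, show j + (i : ℤ) + m * q + 1 = (j + i + 1) + m * q by ring, hxm]; ring
    rw [e1]
    refine h1.trans ?_
    have : (i : ℝ) ≤ q := by exact_mod_cast hiq.le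
    calc (i : ℝ) * (16 * C / q ^ 4) ≤ q * (16 * C / q ^ 4) := by gcongr
      _ = 16 * C / q ^ 3 := by field_simp
  -- The average step is exactly `1 / q`, and all steps are within `16 C / q³` of step `j`.
  have hjq : |x (j + 1) - x j - 1 / q| ≤ 16 * C / q ^ 3 := by
    have h1 : |∑ i ∈ Finset.range q, ((x (0 + i + 1) - x (0 + i)) - (x (j + 1) - x j))|
        ≤ ∑ i ∈ Finset.range q, 16 * C / q ^ 3 :=
      (Finset.abs_sum_le_sum_abs _ _).trans (Finset.sum_le_sum fun i _ => hall _)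
    rw [Finset.sum_sub_distrib, hsum] at h1
    simp only [Finset.sum_const, Finset.card_range, nsmul_eq_mul] at h1
    have h2 : 1 - q * (x (j + 1) - x j) = -(q * (x (j + 1) - x j - 1 / q)) := by
      field_simp; ring
    rw [h2, abs_neg, abs_mul, abs_of_pos hq0] at h1
    exact le_of_mul_le_mul_left h1 hq0
  intro k
  have h1 : |x (k + 1) - x k - 1 / q| ≤ 32 * C / q ^ 3 := by
    have e1 : x (k + 1) - x k - 1 / q = ((x (k + 1) - x k) - (x (j + 1) - x j))
      + (x (j + 1) - x j - 1 / q) := by ring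
    rw [e1]
    refine (abs_add_le _ _).trans ((add_le_add (hall k) hjq).trans (le_of_eq (by ring)))
  refine ⟨by simpa only [hx] using h1, ?_⟩
  have h2 : |(x (k + 1) - x k) - (x (j + 1) - x j)| ≤ 1 / q := (hall k).trans (by
    rw [div_le_div_iff₀ (by positivity) hq0]
    nlinarith)
  have h3 := (abs_le.1 h2).2
  have h4 : x (k + 1) - x k < η := by
    have e : 2 / (q : ℝ) = 1 / q + 1 / q := by ring
    linarith [min_le_left η (min δ δ₁)]
  simpa only [hx] using h4

theorem SmoothPeriodic.exists_lipschitz {f : ℝ → ℝ} (hf : SmoothPeriodic f) : ∃ C, 0 < C ∧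
    ∀ x y, |f x - f y| ≤ C * |x - y| := by
  obtain ⟨C, hC, h⟩ := hf.taylor 1
  refine ⟨C, hC, fun x y => ?_⟩
  have := h y (x - y)
  simpa using this

theorem SmoothPeriodic.exists_second_difference {f : ℝ → ℝ} (hf : SmoothPeriodic f) : ∃ C, 0 < C ∧
    ∀ x t, |f (x + t) + f (x - t) - 2 * f x - _root_.deriv (_root_.deriv f) x * t ^ 2|
      ≤ C * t ^ 4 := by
  obtain ⟨C, hC, h⟩ := hf.taylor 4
  refine ⟨2 * C, by positivity, fun x t => ?_⟩
  have h1 := h x t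
  have h2 := h x (-t)
  simp only [Finset.sum_range_succ, Finset.sum_range_zero, iteratedDeriv_succ, iteratedDeriv_zero,
    Nat.factorial, smul_eq_mul, Real.norm_eq_abs, abs_neg, ← sub_eq_add_neg] at h1 h2
  have ht : |t| ^ 4 = t ^ 4 := by rw [← abs_pow, abs_of_nonneg (by positivity)]
  rw [ht] at h1 h2
  refine le_trans (le_of_eq_of_le ?_ ((abs_add_le _ _).trans (add_le_add h1 h2)))
    (le_of_eq (by ring))
  congr 1
  push_cast
  ring

/-- The second differences of `x k` are `-2 B' / q⁴ + O(q⁻⁶)` by the reflection law, and so are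
those of `k/q + a(k/q) / q²` because `a'' = -2 B'`. The error vanishes at `k = 0` and `k = q`, so
`abs_le_of_second_difference` bounds it by `O(q² · q⁻⁶)`. -/
theorem LazutkinChart.isOrbitCorrection_correction (H : LazutkinChart ℓ γ c r S)
    (hΩ : IsBilliardDomain Ω ℓ γ) : IsOrbitCorrection ℓ γ (correction (potential c r)) := by
  obtain ⟨A₁, A₃, A₅, hA⟩ := H.exists_angleExpansion
  have hB := hA.smooth_B
  have ha := smoothPeriodic_correction hB
  refine ⟨ha.1, ha.2, ?_⟩
  obtain ⟨B, hBdef⟩ : ∃ B, B = potential c r := ⟨_, rfl⟩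
  rw [← hBdef] at hA hB ha ⊢
  obtain ⟨CN, hCN, δN, hδN, hN⟩ := hA.exists_reflection_bound
  obtain ⟨C₂, hC₂, δ₂, hδ₂, hstep⟩ := hA.exists_step_bound
  obtain ⟨δ₁, hδ₁, hrefl⟩ := H.exists_reflection hΩ one_pos
  obtain ⟨Cs, hCs, q₀, hsteps⟩ := H.exists_orbit_step_bound hΩ (lt_min hδ₁ hδ₂)
  obtain ⟨k₀, hk₀, hk₀'⟩ := hA.smooth₁.exists_pos_le hA.pos
  obtain ⟨b, hb, hb'⟩ := hB.deriv.bounded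
  obtain ⟨Lb, hLb, hLb'⟩ := hB.deriv.exists_lipschitz
  obtain ⟨Ca, hCa, hCa'⟩ := ha.exists_second_difference
  obtain ⟨q₁, hq₁⟩ := exists_nat_gt (2 / δN + Cs + 1)
  set D₁ := CN * (64 * C₂ + 64) / k₀ with hD₁
  refine ⟨2 * (D₁ + 64 * b * Cs + 2 * Lb * Cs + Ca), max q₀ q₁, fun q hq σ hσ hσ0 k hk => ?_⟩
  have hqq₀ : q₀ ≤ q := (le_max_left _ _).trans hq
  have hqr : 2 / δN + Cs + 1 < q := hq₁.trans_le (by exact_mod_cast (le_max_right _ _).trans hq)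
  have hpos : 0 < 2 / δN := by positivity
  have hq0 : (0 : ℝ) < q := by linarith
  have hq1 : (1 : ℝ) ≤ q := by linarith
  have h2q : 2 / (q : ℝ) < δN := by
    rw [div_lt_iff₀ hq0]
    have : 2 / δN < q := by linarith
    rw [div_lt_iff₀ hδN] at this
    linarith
  obtain ⟨x, hx⟩ : ∃ x : ℤ → ℝ, x = fun k => lazutkinParam ℓ γ (σ k) := ⟨_, rfl⟩
  have hxk : ∀ k, lazutkinParam ℓ γ (σ k) = x k := fun k => by rw [hx]
  have hx0 : x 0 = 0 := by rw [hx]; simp only [hσ0, H.param_zero]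
  have hxq : x q = 1 := by
    have := hσ.2.1 0
    rw [zero_add] at this
    rw [← hxk, this, H.param_add, hxk, hx0, zero_add]
  have hxlt : ∀ k, x k < x (k + 1) := fun k => by
    obtain ⟨φ, hφ⟩ := hσ.2.2
    simp only [hx]; exact H.strictMono_param (hφ k).1
  have hst := hsteps q hqq₀ σ hσ
  have hre := hrefl q σ hσ
  simp only [hxk] at hst hre ⊢
  have hle2 : ∀ k, x (k + 1) - x k ≤ 2 / q := fun k => by
    have h1 := (abs_le.1 (hst k).1).2
    have h2 : Cs / (q : ℝ) ^ 3 ≤ 1 / q := by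
      rw [div_le_div_iff₀ (by positivity) hq0]
      have : Cs ≤ q := by linarith
      have h3 : (q : ℝ) ≤ q ^ 2 := by nlinarith
      nlinarith
    have e : 2 / (q : ℝ) = 1 / q + 1 / q := by ring
    linarith
  -- Summing the deviations `Cs / q³` of at most `q` steps. This rough localization is enough to
  -- evaluate `B'` at `k / q`.
  have hxc : ∀ k : ℕ, k ≤ q → |x k - k / q| ≤ Cs / q ^ 2 := by
    have h1 : ∀ k : ℕ, |x k - k / q| ≤ k * (Cs / q ^ 3) := by
      intro k
      induction k with
      | zero => simp [hx0]
      | succ k ih =>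
        have h2 := (hst k).1
        have e : x ((k + 1 : ℕ) : ℤ) - ((k + 1 : ℕ) : ℝ) / q
            = (x k - k / q) + (x (k + 1) - x k - 1 / q) := by push_cast; ring
        rw [e]
        refine (abs_add_le _ _).trans ?_
        push_cast
        linarith
    intro k hk
    refine (h1 k).trans ?_
    have : (k : ℝ) ≤ q := by exact_mod_cast hk
    calc (k : ℝ) * (Cs / q ^ 3) ≤ (q : ℝ) * (Cs / q ^ 3) := by gcongr
      _ = Cs / (q : ℝ) ^ 2 := by field_simp
  set e : ℕ → ℝ := fun k => x k - (k / q + correction B (k / q) / q ^ 2) with he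
  have key := abs_le_of_second_difference (q := q) (e := e)
    (D := (D₁ + 64 * b * Cs + 2 * Lb * Cs + Ca) / q ^ 6) hσ.1
    (by simp [he, hx0, correction_zero])
    (by
      have h1 : correction B 1 = 0 := by
        have := ha.2 0
        rwa [zero_add, correction_zero] at this
      simp [he, hxq, div_self hq0.ne', h1])
    (fun k hk => ?_) k hk.le
  · calc |x k - (k / q + correction B (k / q) / q ^ 2)| = |e k| := rfl
      _ ≤ _ := key
      _ = _ := by field_simp
  obtain ⟨p, hp⟩ : ∃ p, p = x (k + 2) - x (k + 1) := ⟨_, rfl⟩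
  obtain ⟨m, hm⟩ : ∃ m, m = x (k + 1) - x k := ⟨_, rfl⟩
  obtain ⟨y, hy⟩ : ∃ y, y = x (k + 1) := ⟨_, rfl⟩
  obtain ⟨ξ, hξ⟩ : ∃ ξ : ℝ, ξ = (k + 1) / q := ⟨_, rfl⟩
  obtain ⟨t, ht⟩ : ∃ t : ℝ, t = 1 / q := ⟨_, rfl⟩
  have ht0 : 0 < t := by rw [ht]; positivity
  have hk2 : (k : ℤ) + 1 + 1 = k + 2 := by ring
  have hp0 : 0 < p := by have := hxlt (k + 1); rw [hk2] at this; rw [hp]; linarith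
  have hm0 : 0 < m := by have := hxlt k; rw [hm]; linarith
  have hst1 := hst (k + 1)
  rw [hk2, ← hp] at hst1
  have hst0 := hst k
  rw [← hm] at hst0
  have hp2 : p ≤ 2 * t := by
    have := hle2 (k + 1)
    rw [hk2, ← hp] at this
    rw [ht]
    linarith [show 2 / (q : ℝ) = 2 * (1 / q) by ring]
  have hm2 : m ≤ 2 * t := by
    have := hle2 k
    rw [← hm] at this
    rw [ht]
    linarith [show 2 / (q : ℝ) = 2 * (1 / q) by ring]
  have hT := (hre k (hm ▸ hst0.2.trans_le (min_le_left _ _))).2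
  rw [← hp, ← hm, ← hy] at hT
  have hpm := hstep y p m hp0 hm0 (hst1.2.trans_le (min_le_right _ _))
    (hst0.2.trans_le (min_le_right _ _)) hT
  have hpm4 : |p - m| ≤ 16 * C₂ * t ^ 4 := hpm.trans (by
    calc C₂ * m ^ 4 ≤ C₂ * (2 * t) ^ 4 := by gcongr
      _ = 16 * C₂ * t ^ 4 := by ring)
  have hNk := hN y p m (2 * t) hp0 hm0 hp2 hm2
    (by rw [ht]; linarith [h2q, show 2 / (q : ℝ) = 2 * (1 / q) by ring])
  rw [hT, zero_sub, abs_neg, abs_mul, abs_of_pos (hA.pos y)] at hNk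
  have hcube : Cs / (q : ℝ) ^ 3 = Cs * t ^ 3 := by rw [ht]; ring
  rw [hcube, ← ht] at hst1 hst0
  have b1 : |(p - m) + deriv B y * (p ^ 4 + m ^ 4)| ≤ D₁ * t ^ 6 := by
    have h1 : k₀ * |(p - m) + deriv B y * (p ^ 4 + m ^ 4)| ≤ CN * (64 * C₂ + 64) * t ^ 6 := by
      calc k₀ * |(p - m) + deriv B y * (p ^ 4 + m ^ 4)|
          ≤ A₁ y * |(p - m) + deriv B y * (p ^ 4 + m ^ 4)| := by gcongr; exact hk₀' y
        _ ≤ CN * ((2 * t) ^ 2 * |p - m| + (2 * t) ^ 6) := hNk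
        _ ≤ CN * ((2 * t) ^ 2 * (16 * C₂ * t ^ 4) + (2 * t) ^ 6) := by gcongr
        _ = CN * (64 * C₂ + 64) * t ^ 6 := by ring
    rw [hD₁, div_mul_eq_mul_div, le_div_iff₀ hk₀]
    linarith
  have hpow : ∀ z, 0 < z → z ≤ 2 * t → |z - t| ≤ Cs * t ^ 3 →
      |z ^ 4 - t ^ 4| ≤ 32 * Cs * t ^ 6 := by
    intro z hz0 hz hzt
    have h1 := AngleExpansion.abs_pow_sub_pow_le hz0.le ht0.le hz (by linarith) 4
    norm_num at h1
    refine h1.trans ?_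
    calc 4 * (2 * t) ^ 3 * |z - t| ≤ 4 * (2 * t) ^ 3 * (Cs * t ^ 3) := by gcongr
      _ = 32 * Cs * t ^ 6 := by ring
  have b2 : |deriv B y * ((p ^ 4 - t ^ 4) + (m ^ 4 - t ^ 4))| ≤ 64 * b * Cs * t ^ 6 := by
    rw [abs_mul]
    calc |deriv B y| * |(p ^ 4 - t ^ 4) + (m ^ 4 - t ^ 4)|
        ≤ b * (32 * Cs * t ^ 6 + 32 * Cs * t ^ 6) := by
          gcongr
          · exact hb' y
          · exact (abs_add_le _ _).trans (add_le_add (hpow p hp0 hp2 hst1.1)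
              (hpow m hm0 hm2 hst0.1))
      _ = 64 * b * Cs * t ^ 6 := by ring
  have b3 : |2 * (deriv B y - deriv B ξ) * t ^ 4| ≤ 2 * Lb * Cs * t ^ 6 := by
    have h1 := hxc (k + 1) (by omega)
    push_cast at h1
    rw [← hy, ← hξ] at h1
    rw [abs_mul, abs_mul, abs_two, abs_of_pos (pow_pos ht0 4)]
    have h2 : |deriv B y - deriv B ξ| ≤ Lb * (Cs * t ^ 2) := by
      refine (hLb' y ξ).trans ?_
      have : Cs / (q : ℝ) ^ 2 = Cs * t ^ 2 := by rw [ht]; ring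
      rw [this] at h1
      gcongr
    calc 2 * |deriv B y - deriv B ξ| * t ^ 4 ≤ 2 * (Lb * (Cs * t ^ 2)) * t ^ 4 := by gcongr
      _ = 2 * Lb * Cs * t ^ 6 := by ring
  have b4 := hCa' ξ t
  rw [deriv_deriv_correction hB] at b4
  have b5 : |(correction B (ξ + t) + correction B (ξ - t) - 2 * correction B ξ
      - -2 * deriv B ξ * t ^ 2) * t ^ 2| ≤ Ca * t ^ 6 := by
    rw [abs_mul, abs_of_pos (pow_pos ht0 2)]
    calc _ ≤ Ca * t ^ 4 * t ^ 2 := by gcongr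
      _ = Ca * t ^ 6 := by ring
  -- Four errors of order `t⁶`: the defect of the difference equation, the replacement of `p⁴` and
  -- `m⁴` by `t⁴`, the evaluation of `B'` at `ξ` instead of `y`, and the Taylor remainder of `a`.
  have e1 : e (k + 2) - 2 * e (k + 1) + e k = ((p - m) + deriv B y * (p ^ 4 + m ^ 4))
      - deriv B y * ((p ^ 4 - t ^ 4) + (m ^ 4 - t ^ 4)) - 2 * (deriv B y - deriv B ξ) * t ^ 4
      - (correction B (ξ + t) + correction B (ξ - t) - 2 * correction B ξ
        - -2 * deriv B ξ * t ^ 2) * t ^ 2 := by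
    have x1 : ((k + 2 : ℕ) : ℝ) / q = ξ + t := by rw [hξ, ht]; push_cast; ring
    have x2 : ((k + 1 : ℕ) : ℝ) / q = ξ := by rw [hξ]; push_cast; ring
    have x3 : (k : ℝ) / q = ξ - t := by rw [hξ, ht]; ring
    simp only [he, x1, x2, x3]
    have x4 : ∀ z : ℝ, z / q ^ 2 = z * t ^ 2 := fun z => by rw [ht]; ring
    simp only [x4]
    push_cast
    rw [hp, hm]
    ring
  rw [e1]
  have x6 : (D₁ + 64 * b * Cs + 2 * Lb * Cs + Ca) / (q : ℝ) ^ 6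
      = D₁ * t ^ 6 + 64 * b * Cs * t ^ 6 + 2 * Lb * Cs * t ^ 6 + Ca * t ^ 6 := by
    rw [ht]; ring
  rw [x6]
  exact (abs_sub _ _).trans (add_le_add ((abs_sub _ _).trans (add_le_add ((abs_sub _ _).trans
    (add_le_add b1 b2)) b3)) b5)

/-! ### Symmetric periodic orbits and uniqueness of the orbit correction -/

theorem IsBilliardDomain.im_pos (hΩ : IsBilliardDomain Ω ℓ γ) {s t : ℝ} (h1 : s < t)
    (h2 : t < s + ℓ) : 0 < ((starRingEnd ℂ) (deriv γ s) * (γ t - γ s)).im := by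
  obtain ⟨c, r, S, H⟩ := hΩ.exists_lazutkinChart
  have := H.im_pos hΩ (H.strictMono_param h1) (by rw [← H.param_add]; exact H.strictMono_param h2)
  rwa [H.apply_param, H.apply_param] at this

/-- Equality would put `γ t` on the segment between the other two points, but both of these are
strictly to the left of the tangent at `t`. -/
theorem IsBilliardDomain.norm_sub_lt (hΩ : IsBilliardDomain Ω ℓ γ) {s₁ t s₂ : ℝ} (h1 : s₁ < t)
    (h2 : t < s₂) (h3 : s₂ < s₁ + ℓ) : ‖γ s₂ - γ s₁‖ < ‖γ t - γ s₁‖ + ‖γ s₂ - γ t‖ := by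
  have hle : ‖γ s₂ - γ s₁‖ ≤ ‖γ t - γ s₁‖ + ‖γ s₂ - γ t‖ := by
    have := norm_add_le (γ t - γ s₁) (γ s₂ - γ t)
    rwa [show γ t - γ s₁ + (γ s₂ - γ t) = γ s₂ - γ s₁ by ring] at this
  refine lt_of_le_of_ne hle fun heq => ?_
  have hw : Wbtw ℝ (γ s₁) (γ t) (γ s₂) := by
    rw [← dist_add_dist_eq_iff, dist_eq_norm, dist_eq_norm, dist_eq_norm, norm_sub_rev (γ s₁) (γ t),
      norm_sub_rev (γ t) (γ s₂), norm_sub_rev (γ s₁) (γ s₂)]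
    exact heq.symm
  obtain ⟨θ, ⟨hθ0, hθ1⟩, hθ⟩ := hw
  have g1 := hΩ.im_pos (s := t) (t := s₁ + ℓ) (by linarith) (by linarith)
  rw [hΩ.periodic s₁] at g1
  have g2 := hΩ.im_pos (s := t) (t := s₂) h2 (by linarith)
  rw [AffineMap.lineMap_apply_module] at hθ
  have e : ((1 - θ : ℝ) : ℂ) * ((starRingEnd ℂ) (deriv γ t) * (γ s₁ - γ t))
      + (θ : ℂ) * ((starRingEnd ℂ) (deriv γ t) * (γ s₂ - γ t)) = 0 := by
    simp only [Complex.real_smul] at hθ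
    push_cast at hθ ⊢
    linear_combination (starRingEnd ℂ) (deriv γ t) * hθ
  have e2 := congrArg Complex.im e
  rw [Complex.add_im, Complex.im_ofReal_mul, Complex.im_ofReal_mul, Complex.zero_im] at e2
  rcases hθ0.eq_or_lt with h | h
  · rw [← h] at e2; linarith
  · have := mul_pos h g2
    have := mul_nonneg (sub_nonneg.2 hθ1) g1.le
    linarith

/-- With this formula the critical points of the length of a polygon are exactly those where the
reflection law holds. -/
theorem IsBilliardDomain.hasDerivAt_norm_sub (hΩ : IsBilliardDomain Ω ℓ γ) {t : ℝ} {p : ℂ}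
    (h : γ t ≠ p) : HasDerivAt (fun t => ‖γ t - p‖)
      (Real.cos (InnerProductGeometry.angle (γ t - p) (deriv γ t))) t := by
  have hdiff : Differentiable ℝ γ := hΩ.smooth.differentiable (by simp)
  have h1 := ((hdiff t).hasDerivAt.sub_const p).norm_sq
  have h0 : 0 < ‖γ t - p‖ := norm_pos_iff.2 (sub_ne_zero.2 h)
  have h2 := h1.sqrt (by positivity)
  simp only [Real.sqrt_sq (norm_nonneg _)] at h2
  refine h2.congr_deriv ?_
  rw [InnerProductGeometry.cos_angle, hΩ.unit_speed, mul_one]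
  field_simp

/-- Half of a symmetric periodic orbit, obtained by maximizing its length. -/
theorem IsBilliardDomain.exists_half_orbit (hΩ : IsBilliardDomain Ω ℓ γ) {m : ℕ} (hm : 0 < m) :
    ∃ y : ℕ → ℝ, y 0 = 0 ∧ y m = ℓ / 2 ∧ (∀ j < m, y j < y (j + 1)) ∧
      (∀ j, 0 ≤ y j ∧ y j ≤ ℓ / 2) ∧ ∀ j, j + 1 < m →
        InnerProductGeometry.angle (γ (y (j + 1)) - γ (y j)) (deriv γ (y (j + 1))) =
        InnerProductGeometry.angle (γ (y (j + 2)) - γ (y (j + 1))) (deriv γ (y (j + 1))) := by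
  have hℓ := hΩ.length_pos
  have hγ : Continuous γ := hΩ.smooth.continuous
  -- Monotone sequences that start at `0` and are frozen at `ℓ / 2` from index `m` on: a closed
  -- subset of a product of compact intervals.
  set K : Set (ℕ → ℝ) := {y | y 0 = 0 ∧ (∀ j, y j ≤ y (j + 1)) ∧ ∀ j, m ≤ j → y j = ℓ / 2} with hK
  have hKb : ∀ y ∈ K, ∀ j, 0 ≤ y j ∧ y j ≤ ℓ / 2 := by
    intro y hy j
    have hmono : Monotone y := monotone_nat_of_le_succ hy.2.1
    refine ⟨hy.1 ▸ hmono (Nat.zero_le j), ?_⟩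
    rw [← hy.2.2 (max j m) (le_max_right _ _)]
    exact hmono (le_max_left _ _)
  have hKc : IsCompact K := by
    refine (isCompact_univ_pi (s := fun _ : ℕ => Icc (0 : ℝ) (ℓ / 2))
      fun _ => isCompact_Icc).of_isClosed_subset ?_
      (fun y hy j _ => hKb y hy j)
    have : K = {y | y 0 = 0} ∩ ((⋂ j, {y | y j ≤ y (j + 1)})
        ∩ ⋂ j, ⋂ _ : m ≤ j, {y | y j = ℓ / 2}) := by
      ext y; simp [hK]
    rw [this]
    refine (isClosed_eq (by fun_prop) (by fun_prop)).inter (IsClosed.inter ?_ ?_)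
    · exact isClosed_iInter fun j => isClosed_le (by fun_prop) (by fun_prop)
    · exact isClosed_iInter fun j => isClosed_iInter fun _ =>
        isClosed_eq (by fun_prop) (by fun_prop)
  have hKn : K.Nonempty := by
    refine ⟨fun j => if j < m then 0 else ℓ / 2, by simp [hm], fun j => ?_, fun j hj => by
      simp [not_lt.2 hj]⟩
    simp only
    split_ifs <;> linarith
  set F : (ℕ → ℝ) → ℝ := fun y => ∑ j ∈ Finset.range m, ‖γ (y (j + 1)) - γ (y j)‖ with hF
  obtain ⟨y, hyK, hymax⟩ := hKc.exists_isMaxOn hKn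
    (f := F) (by
      refine Continuous.continuousOn ?_
      simp only [hF]
      fun_prop)
  have hmono : Monotone y := monotone_nat_of_le_succ hyK.2.1
  have hyb := hKb y hyK
  have hloc : ∀ j, j + 1 < m → ∀ t, y j ≤ t → t ≤ y (j + 2) →
      ‖γ t - γ (y j)‖ + ‖γ (y (j + 2)) - γ t‖
        ≤ ‖γ (y (j + 1)) - γ (y j)‖ + ‖γ (y (j + 2)) - γ (y (j + 1))‖ := by
    intro j hj t ht1 ht2
    have hmem : Function.update y (j + 1) t ∈ K := by
      refine ⟨by rw [Function.update_of_ne (by omega)]; exact hyK.1, fun i => ?_, fun i hi => ?_⟩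
      · rcases eq_or_ne i j with rfl | h1
        · rw [Function.update_self, Function.update_of_ne (by omega)]; exact ht1
        rcases eq_or_ne i (j + 1) with rfl | h2
        · rw [Function.update_self, Function.update_of_ne (by omega)]; exact ht2
        · rw [Function.update_of_ne h2, Function.update_of_ne (by omega)]; exact hyK.2.1 i
      · rw [Function.update_of_ne (by omega)]; exact hyK.2.2 i hi
    have h1 : F (Function.update y (j + 1) t) ≤ F y := hymax hmem
    have h2 : F (Function.update y (j + 1) t) - F y
        = (‖γ t - γ (y j)‖ - ‖γ (y (j + 1)) - γ (y j)‖)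
          + (‖γ (y (j + 2)) - γ t‖ - ‖γ (y (j + 2)) - γ (y (j + 1))‖) := by
      simp only [hF]
      rw [← Finset.sum_sub_distrib, Finset.sum_eq_add_of_mem j (j + 1) (by simp; omega)
        (by simp; omega) (by omega)]
      · rw [Function.update_self, Function.update_of_ne (by omega),
          Function.update_of_ne (by omega)]
      · intro i _ hi
        rw [Function.update_of_ne (by omega), Function.update_of_ne (by omega), sub_self]
    linarith
  -- If a vertex coincided with one of two distinct neighbours, moving it to the middle parameter
  -- would lengthen the polygon by the strict triangle inequality. Hence the gaps are all positive
  -- or all zero, and they cannot all be zero because they add up to `ℓ / 2`.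
  have hinside : ∀ j, j + 1 < m → y j < y (j + 2) → y j < y (j + 1) ∧ y (j + 1) < y (j + 2) := by
    intro j hj hlt
    have hs := hΩ.norm_sub_lt (s₁ := y j) (t := (y j + y (j + 2)) / 2) (s₂ := y (j + 2))
      (by linarith) (by linarith) (by linarith [(hyb j).1, (hyb (j + 2)).2])
    have h1 := hloc j hj ((y j + y (j + 2)) / 2) (by linarith) (by linarith)
    constructor
    · refine lt_of_le_of_ne (hyK.2.1 j) fun h => ?_
      rw [← h, sub_self, norm_zero, zero_add] at h1
      linarith
    · refine lt_of_le_of_ne (hyK.2.1 (j + 1)) fun h => ?_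
      rw [h, sub_self, norm_zero, add_zero] at h1
      linarith
  have hiff : ∀ j, j < m → (y j < y (j + 1) ↔ y 0 < y 1) := by
    intro j
    induction j with
    | zero => intro _; rfl
    | succ j ih =>
      intro hj
      rw [← ih (by omega)]
      constructor
      · intro h
        exact (hinside j hj ((hyK.2.1 j).trans_lt h)).1
      · intro h
        exact (hinside j hj (h.trans_le (hyK.2.1 (j + 1)))).2
  have hstrict : ∀ j < m, y j < y (j + 1) := by
    by_contra hcon
    push Not at hcon
    obtain ⟨j, hj, hle⟩ := hcon
    have h0 : ¬ y 0 < y 1 := fun h => absurd ((hiff j hj).2 h) (not_lt.2 hle)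
    have hz : ∀ j, j ≤ m → y j = 0 := by
      intro j
      induction j with
      | zero => intro _; exact hyK.1
      | succ j ih =>
        intro hj
        have h1 := ih (by omega)
        have h2 : ¬ y j < y (j + 1) := fun h => h0 ((hiff j (by omega)).1 h)
        linarith [hyK.2.1 j, not_lt.1 h2]
    have h1 := hz m le_rfl
    rw [hyK.2.2 m le_rfl] at h1
    linarith
  refine ⟨y, hyK.1, hyK.2.2 m le_rfl, hstrict, hyb, fun j hj => ?_⟩
  have hl1 := hstrict j (by omega)
  have hl2 := hstrict (j + 1) hj
  have hne1 : γ (y (j + 1)) ≠ γ (y j) := (hΩ.ne_of_lt hl1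
    (by linarith [(hyb j).1, (hyb (j + 1)).2])).symm
  have hne2 : γ (y (j + 1)) ≠ γ (y (j + 2)) := hΩ.ne_of_lt hl2
    (by have := (hyb (j + 1)).1; have := (hyb (j + 1 + 1)).2; linarith)
  have hd1 := hΩ.hasDerivAt_norm_sub hne1
  have hd2 := hΩ.hasDerivAt_norm_sub hne2
  have hd := hd1.add hd2
  have hmax : IsLocalMax ((fun t => ‖γ t - γ (y j)‖)
      + fun t => ‖γ t - γ (y (j + 2))‖) (y (j + 1)) := by
    filter_upwards [Ioo_mem_nhds hl1 hl2] with t ht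
    have := hloc j hj t ht.1.le ht.2.le
    simp only [Pi.add_apply]
    rwa [norm_sub_rev (γ t) (γ (y (j + 2))), norm_sub_rev (γ (y (j + 1))) (γ (y (j + 2)))]
  -- At an interior maximum the two cosines agree up to the sign that comes from reversing a chord,
  -- and the cosine is injective on `[0, π]`.
  have hz := hmax.hasDerivAt_eq_zero hd
  rw [← neg_sub (γ (y (j + 2))), InnerProductGeometry.angle_neg_left, Real.cos_pi_sub] at hz
  exact Real.injOn_cos ⟨InnerProductGeometry.angle_nonneg _ _, InnerProductGeometry.angle_le_pi _ _⟩
    ⟨InnerProductGeometry.angle_nonneg _ _, InnerProductGeometry.angle_le_pi _ _⟩ (by linarith)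

/-- The symmetry is an isometry that reverses the orientation of the boundary: chord and tangent
both change sign, which leaves the angle unchanged. -/
theorem IsAxiallySymmetric.angle_eq (hγ : Differentiable ℝ γ) (h : IsAxiallySymmetric γ) (s t : ℝ) :
    InnerProductGeometry.angle (γ (-t) - γ (-s)) (deriv γ (-s))
      = InnerProductGeometry.angle (γ s - γ t) (deriv γ s) := by
  obtain ⟨u, hu, hs⟩ := h
  have hd : deriv γ (-s) = -(u ^ 2 * (starRingEnd ℂ) (deriv γ s)) := by
    have h1 : HasDerivAt (fun s => γ (-s)) (-deriv γ (-s)) s := by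
      have := (hγ (-s)).hasDerivAt.scomp s (hasDerivAt_neg s)
      exact HasDerivAt.congr_deriv (f := γ ∘ Neg.neg) this (by simp)
    have h2 : HasDerivAt (fun s => γ 0 + u ^ 2 * (starRingEnd ℂ) (γ s - γ 0))
        (u ^ 2 * (starRingEnd ℂ) (deriv γ s)) s := by
      have h3 : HasDerivAt (fun s => (starRingEnd ℂ) (γ s - γ 0)) ((starRingEnd ℂ) (deriv γ s)) s :=
        ((hγ s).hasDerivAt.sub_const (γ 0)).star
      exact (h3.const_mul (u ^ 2)).const_add (γ 0)
    rw [funext hs] at h1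
    rw [← h1.unique h2, neg_neg]
  have hc : γ (-t) - γ (-s) = -(u ^ 2 * (starRingEnd ℂ) (γ s - γ t)) := by
    rw [hs t, hs s]; simp only [map_sub]; ring
  have hu2 : (starRingEnd ℂ) (u ^ 2) * u ^ 2 = 1 :=
    conj_mul_self_of_norm (by rw [norm_pow, hu, one_pow])
  rw [hd, hc, InnerProductGeometry.angle_neg_neg]
  have hnorm : ∀ w : ℂ, ‖u ^ 2 * (starRingEnd ℂ) w‖ = ‖w‖ := fun w => by
    rw [norm_mul, norm_pow, hu, one_pow, one_mul, RCLike.norm_conj]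
  have hinner : ∀ v w : ℂ, inner ℝ (u ^ 2 * (starRingEnd ℂ) v) (u ^ 2 * (starRingEnd ℂ) w)
      = inner ℝ v w := fun v w => by
    rw [Complex.inner, Complex.inner]
    have e : u ^ 2 * (starRingEnd ℂ) w * (starRingEnd ℂ) (u ^ 2 * (starRingEnd ℂ) v)
        = (starRingEnd ℂ) (w * (starRingEnd ℂ) v) := by
      simp only [map_mul, Complex.conj_conj]
      linear_combination (starRingEnd ℂ) w * v * hu2
    rw [e, Complex.conj_re]
  rw [InnerProductGeometry.angle, InnerProductGeometry.angle, hnorm, hnorm, hinner]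

theorem forall_int_of_periodic {P : ℤ → Prop} {q : ℤ} (hq : 0 < q) (a : ℤ)
    (hP : ∀ k, P (k + q) ↔ P k) (h : ∀ k, a ≤ k → k < a + q → P k) (k : ℤ) : P k := by
  have hmul : ∀ (n k : ℤ), P (k + n * q) ↔ P k := by
    intro n k
    induction n using Int.induction_on with
    | zero => simp
    | succ n ih => rw [add_mul, one_mul, ← add_assoc, hP, ih]
    | pred n ih =>
      rw [← ih, ← hP (k + (-n - 1) * q), show k + (-(n : ℤ) - 1) * q + q = k + -n * q by ring]
  have e : k = (a + (k - a) % q) + (k - a) / q * q := by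
    linarith [Int.emod_add_mul_ediv (k - a) q]
  rw [e, hmul]
  exact h _ (by linarith [Int.emod_nonneg (k - a) hq.ne'])
    (by linarith [Int.emod_lt_of_pos (k - a) hq])

/-- An axially symmetric domain has periodic orbits of rotation number `1/(2 m)` through `γ 0`. -/
theorem IsBilliardDomain.exists_periodicOrbit (hΩ : IsBilliardDomain Ω ℓ γ)
    (hsym : IsAxiallySymmetric γ) {m : ℕ} (hm : 0 < m) :
    ∃ σ : ℤ → ℝ, IsPeriodicOrbit ℓ γ (2 * m) σ ∧ σ 0 = 0 := by
  have hℓ := hΩ.length_pos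
  have hdiff : Differentiable ℝ γ := hΩ.smooth.differentiable (by simp)
  have hper := hΩ.periodic
  have hdper : Function.Periodic (deriv γ) ℓ := fun x => by
    have h : (fun y => γ (y + ℓ)) = γ := funext hper
    rw [← deriv_comp_add_const, h]
  obtain ⟨y, hy0, hym, hylt, hyb, hyr⟩ := hΩ.exists_half_orbit hm
  have hq : (0 : ℤ) < 2 * m := by omega
  -- Within a period the orbit follows the half orbit `y` up to index `m` and then returns along its
  -- mirror image `ℓ - y`. The resulting sequence is odd.
  obtain ⟨σ, hσ⟩ : ∃ σ : ℤ → ℝ, σ = fun k => ((k / (2 * m) : ℤ) : ℝ) * ℓ +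
      (if k % (2 * m) ≤ m then y (k % (2 * m)).toNat else ℓ - y (2 * m - k % (2 * m)).toNat) :=
    ⟨_, rfl⟩
  have hσq : ∀ k, σ (k + 2 * m) = σ k + ℓ := fun k => by
    simp only [hσ]
    rw [Int.add_emod_right, Int.add_ediv_of_dvd_right (dvd_refl _), Int.ediv_self hq.ne']
    push_cast
    ring
  have hσy : ∀ i : ℕ, i ≤ m → σ i = y i := fun i hi => by
    simp only [hσ]
    have h1 : (i : ℤ) / (2 * m) = 0 := Int.ediv_eq_zero_of_lt (by omega) (by omega)
    have h2 : (i : ℤ) % (2 * m) = i := Int.emod_eq_of_lt (by omega) (by omega)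
    rw [h1, h2, if_pos (by exact_mod_cast hi)]
    simp
  have hσneg0 : ∀ i : ℕ, i ≤ m → σ (-i) = -σ i := fun i hi => by
    rw [hσy i hi]
    rcases Nat.eq_zero_or_pos i with rfl | hi0
    · have := hσy 0 (by omega)
      simp only [Nat.cast_zero] at this
      simp [this, hy0]
    have h3 : σ (-i + 2 * m) = ℓ - y i := by
      simp only [hσ]
      have h1 : (-i + 2 * m : ℤ) / (2 * m) = 0 := Int.ediv_eq_zero_of_lt (by omega) (by omega)
      have h2 : (-i + 2 * m : ℤ) % (2 * m) = -i + 2 * m := Int.emod_eq_of_lt (by omega) (by omega)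
      rw [h1, h2]
      by_cases him : i = m
      · subst him
        rw [if_pos (by omega), show (-i + 2 * i : ℤ).toNat = i by omega, hym]
        simp; ring
      · rw [if_neg (by omega), show (2 * m - (-i + 2 * m) : ℤ).toNat = i by omega]
        simp
    rw [hσq] at h3
    linarith
  have hneg : ∀ k, σ (-k) = -σ k := by
    refine forall_int_of_periodic hq (-m) (fun k => ?_) fun k h1 h2 => ?_
    · have e := hσq (-(k + 2 * m))
      rw [show -(k + 2 * (m : ℤ)) + 2 * m = -k by ring] at e
      rw [hσq, e]
      constructor <;> intro h <;> linarith
    · rcases le_or_gt 0 k with hk | hk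
      · lift k to ℕ using hk
        exact hσneg0 k (by omega)
      · obtain ⟨i, rfl⟩ : ∃ i : ℕ, k = -i := ⟨k.natAbs, by omega⟩
        rw [neg_neg, hσneg0 i (by omega), neg_neg]
  have hnegc : ∀ i j : ℤ, i = -j → σ i = -σ j := fun i j h => by rw [h, hneg]
  have hstep : ∀ k, σ k < σ (k + 1) ∧ σ (k + 1) ≤ σ k + ℓ / 2 := by
    have hpos : ∀ i : ℕ, i < m → σ i < σ (i + 1) ∧ σ (i + 1) ≤ σ i + ℓ / 2 := fun i hi => by
      have e := hσy (i + 1) (by omega)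
      push_cast at e
      rw [hσy i (by omega), e]
      exact ⟨hylt i hi, by linarith [(hyb i).1, (hyb (i + 1)).2]⟩
    refine forall_int_of_periodic hq (-m) (fun k => ?_) fun k h1 h2 => ?_
    · rw [add_right_comm, hσq, hσq]
      constructor <;> intro h <;> constructor <;> linarith [h.1, h.2]
    · rcases le_or_gt 0 k with hk | hk
      · lift k to ℕ using hk
        exact hpos k (by omega)
      · obtain ⟨i, rfl⟩ : ∃ i : ℕ, k = -(i + 1) := ⟨(k + 1).natAbs, by omega⟩
        have h3 := hpos i (by omega)
        rw [hnegc _ _ rfl, hnegc (-((i : ℤ) + 1) + 1) i (by ring)]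
        constructor <;> linarith [h3.1, h3.2]
  have hrefl : ∀ k, InnerProductGeometry.angle (γ (σ (k + 1)) - γ (σ k)) (deriv γ (σ (k + 1)))
      = InnerProductGeometry.angle (γ (σ (k + 2)) - γ (σ (k + 1))) (deriv γ (σ (k + 1))) := by
    have hpos : ∀ i : ℕ, i + 1 < m →
        InnerProductGeometry.angle (γ (σ (i + 1)) - γ (σ i)) (deriv γ (σ (i + 1)))
        = InnerProductGeometry.angle (γ (σ (i + 2)) - γ (σ (i + 1))) (deriv γ (σ (i + 1))) :=
      fun i hi => by
        have e1 := hσy (i + 1) (by omega)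
        have e2 := hσy (i + 2) (by omega)
        push_cast at e1 e2
        rw [hσy i (by omega), e1, e2]
        exact hyr i hi
    refine forall_int_of_periodic hq (-m) (fun k => ?_) fun k h1 h2 => ?_
    · rw [add_right_comm, add_right_comm k (2 * (m : ℤ)) 2, hσq, hσq, hσq, hper, hper, hper, hdper]
    · rcases lt_or_ge (k + 1) 0 with hk | hk
      · obtain ⟨i, rfl⟩ : ∃ i : ℕ, k = -(i + 2) := ⟨(k + 2).natAbs, by omega⟩
        have h3 := hpos i (by omega)
        rw [hnegc _ _ rfl, hnegc (-((i : ℤ) + 2) + 1) (i + 1) (by ring),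
          hnegc (-((i : ℤ) + 2) + 2) i (by ring), hsym.angle_eq hdiff, h3,
          ← neg_sub (γ (-σ (i + 2))), InnerProductGeometry.angle_neg_left, hsym.angle_eq hdiff,
          ← neg_sub (γ (σ (i + 2))), InnerProductGeometry.angle_neg_left]
        ring
      -- The maximization says nothing about the two collisions on the axis. At `γ 0`, here, and at
      -- `γ (ℓ / 2)`, in the case `k + 1 = m`, the law holds because the two chords are mirror
      -- images.
      rcases hk.eq_or_lt with hk | hk
      · have h0 : σ 0 = 0 := by rw [← hy0, ← hσy 0 (by omega)]; simp
        have e1 : σ k = -σ 1 := hnegc _ _ (by omega)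
        rw [← hk, e1, show k + 2 = 1 by omega, h0]
        have := hsym.angle_eq hdiff 0 (-σ 1)
        rw [neg_neg, neg_zero] at this
        exact this.symm
      · lift k to ℕ using (by omega)
        by_cases hkm : k + 1 = m
        · have e1 : σ (k + 1) = ℓ / 2 := by
            have := hσy (k + 1) (by omega)
            push_cast at this
            rw [this, hkm, hym]
          have e2 : σ (k + 2) = -σ k + ℓ := by
            rw [← hneg, ← hσq]; congr 1; omega
          have e3 : γ (ℓ / 2) = γ (-(ℓ / 2)) := by
            rw [← hper (-(ℓ / 2))]; congr 1; ring
          have e4 : deriv γ (ℓ / 2) = deriv γ (-(ℓ / 2)) := by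
            rw [← hdper (-(ℓ / 2))]; congr 1; ring
          rw [e1, e2, hper, ← hsym.angle_eq hdiff (ℓ / 2) (σ k), e3, e4]
        · exact hpos k (by omega)
  refine ⟨σ, ⟨by omega, fun k => by push_cast; exact hσq k,
    fun k => InnerProductGeometry.angle (γ (σ (k + 1)) - γ (σ k)) (deriv γ (σ k)),
    fun k => ⟨(hstep k).1, by linarith [(hstep k).2], rfl, ?_⟩⟩, ?_⟩
  · rw [hrefl]
    simp only [add_assoc]
    norm_num
  · rw [← hy0, ← hσy 0 (by omega)]; simp

/-- Orbits with `q = 2 m` collisions exist for every `m`, so two corrections differ by `O(q⁻²)` at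
`⌊q x⌋ / q`. These points tend to `x`, and continuity gives equality. -/
theorem IsBilliardDomain.isOrbitCorrection_unique (hΩ : IsBilliardDomain Ω ℓ γ)
    (hsym : IsAxiallySymmetric γ) {α β : ℝ → ℝ} (hα : IsOrbitCorrection ℓ γ α)
    (hβ : IsOrbitCorrection ℓ γ β) : α = β := by
  obtain ⟨hαs, hαp, C₁, q₁, h₁⟩ := hα
  obtain ⟨hβs, hβp, C₂, q₂, h₂⟩ := hβ
  have hIco : ∀ x ∈ Ico (0 : ℝ) 1, α x - β x = 0 := by
    intro x hx
    have hseq : Tendsto (fun m : ℕ => (⌊x * ((2 * m : ℕ) : ℝ)⌋₊ : ℝ) / ((2 * m : ℕ) : ℝ))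
        atTop (𝓝 x) := by
      have h := (tendsto_nat_floor_mul_div_atTop hx.1).comp
        (tendsto_natCast_atTop_atTop (R := ℝ))
      exact h.comp (tendsto_id.const_mul_atTop' (by norm_num : (0 : ℕ) < 2))
    have hd : Tendsto (fun m : ℕ => α ((⌊x * ((2 * m : ℕ) : ℝ)⌋₊ : ℝ) / ((2 * m : ℕ) : ℝ))
        - β ((⌊x * ((2 * m : ℕ) : ℝ)⌋₊ : ℝ) / ((2 * m : ℕ) : ℝ))) atTop (𝓝 (α x - β x)) :=
      ((hαs.continuous.sub hβs.continuous).tendsto x).comp hseq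
    have hz : Tendsto (fun m : ℕ => (C₁ + C₂) / ((2 * m : ℕ) : ℝ) ^ 2) atTop (𝓝 0) := by
      refine Tendsto.div_atTop tendsto_const_nhds ((tendsto_pow_atTop two_ne_zero).comp
        ((tendsto_natCast_atTop_atTop (R := ℝ)).comp
          (tendsto_id.const_mul_atTop' (by norm_num : (0 : ℕ) < 2))))
    refine tendsto_nhds_unique hd (squeeze_zero_norm' ?_ hz)
    filter_upwards [eventually_ge_atTop (max 1 (max q₁ q₂))] with m hm
    have hm1 : 1 ≤ m := (le_max_left _ _).trans hm
    have hm2 : q₁ ≤ m := ((le_max_left _ _).trans (le_max_right _ _)).trans hm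
    have hm3 : q₂ ≤ m := ((le_max_right _ _).trans (le_max_right _ _)).trans hm
    obtain ⟨σ, hσ, hσ0⟩ := hΩ.exists_periodicOrbit hsym hm1
    have hq0 : (0 : ℝ) < ((2 * m : ℕ) : ℝ) := by exact_mod_cast (by omega : 0 < 2 * m)
    have hk : ⌊x * ((2 * m : ℕ) : ℝ)⌋₊ < 2 * m := by
      rw [Nat.floor_lt (by have := hx.1; positivity)]
      have := mul_lt_mul_of_pos_right hx.2 hq0
      linarith
    have a1 := h₁ (2 * m) (by omega) σ hσ hσ0 _ hk
    have a2 := h₂ (2 * m) (by omega) σ hσ hσ0 _ hk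
    obtain ⟨Q, hQ⟩ : ∃ Q : ℝ, Q = ((2 * m : ℕ) : ℝ) := ⟨_, rfl⟩
    rw [← hQ] at a1 a2 hq0 ⊢
    obtain ⟨ξ, hξ⟩ : ∃ ξ : ℝ, ξ = (⌊x * Q⌋₊ : ℝ) / Q := ⟨_, rfl⟩
    rw [← hξ] at a1 a2 ⊢
    obtain ⟨X, hX⟩ : ∃ X : ℝ, X = lazutkinParam ℓ γ (σ ⌊x * Q⌋₊) := ⟨_, rfl⟩
    rw [← hX] at a1 a2
    have e : α ξ - β ξ = ((X - (ξ + β ξ / Q ^ 2)) - (X - (ξ + α ξ / Q ^ 2))) * Q ^ 2 := by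
      field_simp; ring
    rw [e, norm_mul, Real.norm_eq_abs, Real.norm_of_nonneg (by positivity)]
    calc _ ≤ (C₂ / Q ^ 4 + C₁ / Q ^ 4) * Q ^ 2 := by
          gcongr
          exact (abs_sub _ _).trans (add_le_add a2 a1)
      _ = (C₁ + C₂) / Q ^ 2 := by field_simp; ring
  funext x
  have hp : Function.Periodic (fun x => α x - β x) 1 := fun x => by simp only [hαp x, hβp x]
  obtain ⟨z, hz, hxz⟩ := hp.exists_mem_Ico₀ one_pos x
  rw [hIco z hz] at hxz
  linarith

end

/-! ### Lazutkin coordinates -/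

theorem SmoothPeriodic.exists_taylor_eq {f : ℝ → ℝ} (hf : SmoothPeriodic f) (n : ℕ) :
    ∃ R : ℝ × ℝ → ℝ, Bdd stripFilter R ∧ ∀ x h, h ≠ 0 →
      f (x + h) = ∑ j ∈ Finset.range n, (h ^ j / j.factorial) * _root_.iteratedDeriv j f x
        + h ^ n * R (x, h) := by
  obtain ⟨C, -, hC⟩ := SmoothPeriodic.taylor n hf
  refine ⟨fun a => (f (a.1 + a.2) - ∑ j ∈ Finset.range n,
    (a.2 ^ j / j.factorial) * _root_.iteratedDeriv j f a.1) / a.2 ^ n,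
    bdd_div_pow_of_le (C := C) (Eventually.of_forall fun a => by simpa using hC a.1 a.2),
    fun x h h0 => ?_⟩
  field_simp
  ring

namespace AngleExpansion

variable {T : ℝ → ℝ → ℝ} {A₁ A₃ A₅ B β : ℝ → ℝ}

/-- The expansion of `β / A₁² · T²`. -/
theorem exists_sq_eq (h : AngleExpansion T A₁ A₃ A₅ B) (hβ : SmoothPeriodic β) :
    ∃ W : ℝ × ℝ → ℝ, Bdd stripFilter W ∧ ∀ x t, t ≠ 0 →
      β x / A₁ x ^ 2 * T x t ^ 2 = β x * t ^ 2 + 2 * β x * A₃ x / A₁ x * t ^ 4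
        + 2 * β x * deriv B x * t ^ 5 + t ^ 6 * W (x, t) := by
  obtain ⟨R, hR, hT⟩ := h.exists_eq
  have hA := fun x => (h.pos x).ne'
  have b1 := (((smoothPeriodic_const 2).mul hβ).div h.smooth₁ hA).bdd_fst
  have b2 := (hβ.div (h.smooth₁.pow 2) fun x => pow_ne_zero 2 (hA x)).bdd_fst
  have b3 := h.smooth₃.bdd_fst
  have b4 := (h.smooth₁.mul h.smooth_B.deriv).bdd_fst
  have b5 := h.smooth₅.bdd_fst
  have bh := bdd_snd
  refine ⟨fun a => 2 * β a.1 / A₁ a.1 * (A₅ a.1 + a.2 * R a) + β a.1 / A₁ a.1 ^ 2 * (A₃ a.1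
    + A₁ a.1 * deriv B a.1 * a.2 + A₅ a.1 * a.2 ^ 2 + a.2 ^ 3 * R a) ^ 2, ?_, fun x t h0 => ?_⟩
  · repeat' first | with_reducible assumption | apply Bdd.pow | with_reducible apply Bdd.add |
      with_reducible apply Bdd.mul
  · rw [hT x t h0]
    have := hA x
    field_simp
    ring

/-- The expansion of `T³`. -/
theorem exists_cube_eq (h : AngleExpansion T A₁ A₃ A₅ B) :
    ∃ W : ℝ × ℝ → ℝ, Bdd stripFilter W ∧ ∀ x t, t ≠ 0 →
      T x t ^ 3 = A₁ x ^ 3 * t ^ 3 + 3 * A₁ x ^ 2 * A₃ x * t ^ 5 + t ^ 6 * W (x, t) := by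
  obtain ⟨R, hR, hT⟩ := h.exists_eq
  have b1 := h.smooth₁.bdd_fst
  have b3 := h.smooth₃.bdd_fst
  have b4 := h.smooth_B.deriv.bdd_fst
  have b5 := h.smooth₅.bdd_fst
  have bh := bdd_snd
  obtain ⟨V, hV⟩ : ∃ V : ℝ × ℝ → ℝ, V = fun a => A₃ a.1 + A₁ a.1 * deriv B a.1 * a.2
    + A₅ a.1 * a.2 ^ 2 + a.2 ^ 3 * R a := ⟨_, rfl⟩
  have bV : Bdd stripFilter V := by
    rw [hV]
    repeat' first | with_reducible assumption | apply Bdd.pow | with_reducible apply Bdd.add |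
      with_reducible apply Bdd.mul
  refine ⟨fun a => 3 * A₁ a.1 ^ 2 * (A₁ a.1 * deriv B a.1 + A₅ a.1 * a.2 + a.2 ^ 2 * R a)
    + 3 * A₁ a.1 * a.2 * V a ^ 2 + a.2 ^ 3 * V a ^ 3, ?_, fun x t h0 => ?_⟩
  · repeat' first | with_reducible assumption | with_reducible exact bdd_const _ | apply Bdd.pow |
      with_reducible apply Bdd.add | with_reducible apply Bdd.mul
  · rw [hT x t h0, hV]
    ring

/-- The expansion of `T⁵`. -/
theorem exists_fifth_eq (h : AngleExpansion T A₁ A₃ A₅ B) :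
    ∃ W : ℝ × ℝ → ℝ, Bdd stripFilter W ∧ ∀ x t, t ≠ 0 →
      T x t ^ 5 = A₁ x ^ 5 * t ^ 5 + t ^ 6 * W (x, t) := by
  obtain ⟨R, hR, hT⟩ := h.exists_eq
  have b1 := h.smooth₁.bdd_fst
  have b3 := h.smooth₃.bdd_fst
  have b4 := h.smooth_B.deriv.bdd_fst
  have b5 := h.smooth₅.bdd_fst
  have bh := bdd_snd
  obtain ⟨V, hV⟩ : ∃ V : ℝ × ℝ → ℝ, V = fun a => A₃ a.1 * a.2 + A₁ a.1 * deriv B a.1 * a.2 ^ 2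
    + A₅ a.1 * a.2 ^ 3 + a.2 ^ 4 * R a := ⟨_, rfl⟩
  have bV : Bdd stripFilter V := by
    rw [hV]
    repeat' first | with_reducible assumption | apply Bdd.pow | with_reducible apply Bdd.add |
      with_reducible apply Bdd.mul
  refine ⟨fun a => V a * (5 * A₁ a.1 ^ 4 + 10 * A₁ a.1 ^ 3 * (a.2 * V a)
    + 10 * A₁ a.1 ^ 2 * (a.2 * V a) ^ 2 + 5 * A₁ a.1 * (a.2 * V a) ^ 3 + (a.2 * V a) ^ 4), ?_,
    fun x t h0 => ?_⟩
  · repeat' first | with_reducible assumption | with_reducible exact bdd_const _ | apply Bdd.pow |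
      with_reducible apply Bdd.add | with_reducible apply Bdd.mul
  · have e : T x t = t * (A₁ x + t * V (x, t)) := by rw [hT x t h0, hV]; ring
    rw [e]
    ring

/-- If `β'' = 2 B'`, the displacement `h + b(x+h) T(x+h,-h)² - b(x) T(x,h)²`, where `b = β / A₁²`,
is an odd polynomial in `T(x,h)` up to `O(h⁶)`. -/
theorem exists_displacement_eq (h : AngleExpansion T A₁ A₃ A₅ B) (hβ : SmoothPeriodic β)
    (hβ2 : ∀ x, deriv (deriv β) x = 2 * deriv B x) :
    ∃ q₃ q₅ : ℝ → ℝ, SmoothPeriodic q₃ ∧ SmoothPeriodic q₅ ∧ ∃ W : ℝ × ℝ → ℝ,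
      Bdd stripFilter W ∧ ∀ x t, t ≠ 0 →
        t + β (x + t) / A₁ (x + t) ^ 2 * T (x + t) (-t) ^ 2 - β x / A₁ x ^ 2 * T x t ^ 2
          = 1 / A₁ x * T x t + q₃ x * T x t ^ 3 + q₅ x * T x t ^ 5 + t ^ 6 * W (x, t) := by
  have hA := fun x => (h.pos x).ne'
  obtain ⟨R, hR, hT⟩ := h.exists_eq
  obtain ⟨W₂, hW₂, h2⟩ := h.exists_sq_eq hβ
  obtain ⟨W₃, hW₃, h3⟩ := h.exists_cube_eq
  obtain ⟨W₅, hW₅, h5⟩ := h.exists_fifth_eq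
  obtain ⟨cc, hcc⟩ : ∃ cc : ℝ → ℝ, cc = fun x => 2 * β x * A₃ x / A₁ x := ⟨_, rfl⟩
  obtain ⟨d, hd⟩ : ∃ d : ℝ → ℝ, d = fun x => 2 * β x * deriv B x := ⟨_, rfl⟩
  have sc : SmoothPeriodic cc := by
    rw [hcc]; exact (((smoothPeriodic_const 2).mul hβ).mul h.smooth₃).div h.smooth₁ hA
  have sd : SmoothPeriodic d := by
    rw [hd]; exact ((smoothPeriodic_const 2).mul hβ).mul h.smooth_B.deriv
  obtain ⟨Rβ, bRβ, eβ⟩ := hβ.exists_taylor_eq 4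
  obtain ⟨Rc, bRc, ec⟩ := sc.exists_taylor_eq 2
  obtain ⟨Rd, bRd, ed⟩ := sd.exists_taylor_eq 1
  -- `q₃` and `q₅` are found by matching `t³` and `t⁵`. At `t⁴` nothing is left to choose: `β'' / 2`
  -- must equal `B'`, which is the hypothesis on `β`.
  obtain ⟨q₃, hq₃⟩ : ∃ q : ℝ → ℝ, q = fun x => (deriv β x - A₃ x / A₁ x) / A₁ x ^ 3 := ⟨_, rfl⟩
  have sq3 : SmoothPeriodic q₃ := by
    rw [hq₃]
    exact (hβ.deriv.sub (h.smooth₃.div h.smooth₁ hA)).div (h.smooth₁.pow 3)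
      fun x => pow_ne_zero 3 (hA x)
  obtain ⟨q₅, hq₅⟩ : ∃ q : ℝ → ℝ, q = fun x => (iteratedDeriv 3 β x / 6 + deriv cc x - 2 * d x
    - A₅ x / A₁ x - q₃ x * (3 * A₁ x ^ 2 * A₃ x)) / A₁ x ^ 5 := ⟨_, rfl⟩
  have sq5 : SmoothPeriodic q₅ := by
    rw [hq₅]
    exact (((((hβ.iteratedDeriv 3).div (smoothPeriodic_const 6) fun _ => by norm_num).add
      sc.deriv).sub ((smoothPeriodic_const 2).mul sd)).sub (h.smooth₅.div h.smooth₁ hA)|>.sub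
      (sq3.mul (((smoothPeriodic_const 3).mul (h.smooth₁.pow 2)).mul h.smooth₃))).div
      (h.smooth₁.pow 5) fun x => pow_ne_zero 5 (hA x)
  have hu := tendsto_stripFilter_reverse
  have hW₂' := hW₂.comp hu
  have bA := ((smoothPeriodic_const 1).div h.smooth₁ hA).bdd_fst
  have b3 := sq3.bdd_fst
  have b5 := sq5.bdd_fst
  refine ⟨q₃, q₅, sq3, sq5, fun a => Rβ a + Rc a - Rd a + W₂ (a.1 + a.2, -a.2) - W₂ a
    - (1 / A₁ a.1 * R a + q₃ a.1 * W₃ a + q₅ a.1 * W₅ a), ?_, fun x t h0 => ?_⟩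
  · repeat' first | with_reducible assumption | with_reducible apply Bdd.add |
      with_reducible apply Bdd.sub | with_reducible apply Bdd.mul
  · have e2 := h2 (x + t) (-t) (neg_ne_zero.2 h0)
    have eβ' := eβ x t h0
    have ec' := ec x t h0
    have ed' := ed x t h0
    simp only [Finset.sum_range_succ, Finset.range_zero, Finset.sum_empty, iteratedDeriv_zero,
      iteratedDeriv_one, pow_zero, Nat.factorial] at eβ' ec' ed'
    rw [show iteratedDeriv 2 β x = 2 * deriv B x by
      rw [iteratedDeriv_succ, iteratedDeriv_one, hβ2]] at eβ'
    have f1 : 2 * β (x + t) * A₃ (x + t) / A₁ (x + t) = cc (x + t) := by rw [hcc]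
    have f2 : 2 * β (x + t) * deriv B (x + t) = d (x + t) := by rw [hd]
    have f3 : 2 * β x * A₃ x / A₁ x = cc x := by rw [hcc]
    have f4 : 2 * β x * deriv B x = d x := by rw [hd]
    have g3 : q₃ x * A₁ x ^ 3 = deriv β x - A₃ x / A₁ x := by
      rw [hq₃]; field_simp [hA x]
    have g5 : q₅ x * A₁ x ^ 5 = iteratedDeriv 3 β x / 6 + deriv cc x - 2 * d x
        - A₅ x / A₁ x - q₃ x * (3 * A₁ x ^ 2 * A₃ x) := by
      rw [hq₅]; field_simp [hA x]
    have g1 : 1 / A₁ x * T x t = t + A₃ x / A₁ x * t ^ 3 + deriv B x * t ^ 4 + A₅ x / A₁ x * t ^ 5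
        + t ^ 6 * (1 / A₁ x * R (x, t)) := by
      rw [hT x t h0]; have := hA x; field_simp
    rw [e2, h2 x t h0, h3 x t h0, h5 x t h0, g1, f1, f2, f3, f4, eβ', ec', ed']
    push_cast
    linear_combination (-t ^ 3) * g3 - t ^ 5 * g5

end AngleExpansion

/-! ### Diffeomorphisms up to the boundary and existence of Lazutkin coordinates -/

section NearIdentity

variable {E : Type*} [NormedAddCommGroup E] [NormedSpace ℝ E] [CompleteSpace E] {N : E → E}
  {U : Set E}

/-- A perturbation of the identity by a `1/2`-Lipschitz map has a smooth inverse. -/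
theorem exists_contDiffOn_leftInvOn (hU : IsOpen U) (hN : ContDiff ℝ ∞ N)
    (hL : LipschitzOnWith (1 / 2) N U) : ∃ G : E → E, LeftInvOn G (fun p => p + N p) U ∧
      ContDiffOn ℝ ∞ G ((fun p => p + N p) '' U) := by
  obtain ⟨f, hf⟩ : ∃ f : E → E, f = fun p => p + N p := ⟨_, rfl⟩
  have hfs : ContDiff ℝ ∞ f := by rw [hf]; exact contDiff_id.add hN
  have hinj : InjOn f U := by
    intro p hp q hq h
    have h1 := hL.norm_sub_le hp hq
    have h2 : p - q = -(N p - N q) := by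
      rw [hf] at h
      simp only at h
      rw [neg_sub, sub_eq_sub_iff_add_eq_add, h, add_comm]
    rw [← norm_neg, ← h2] at h1
    have h3 : ‖p - q‖ = 0 := by
      have := norm_nonneg (p - q)
      have e : ((1 / 2 : NNReal) : ℝ) = 1 / 2 := by norm_num
      rw [e] at h1
      linarith
    exact sub_eq_zero.1 (norm_eq_zero.1 h3)
  rcases U.eq_empty_or_nonempty with rfl | ⟨u, hu⟩
  · exact ⟨id, by simp [LeftInvOn], by simp⟩
  have : Nonempty E := ⟨u⟩
  have hG := hinj.leftInvOn_invFunOn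
  rw [← hf]
  refine ⟨Function.invFunOn f U, hG, ?_⟩
  rintro _ ⟨p, hp, rfl⟩
  refine ContDiffAt.contDiffWithinAt ?_
  have hNd : HasFDerivAt N (fderiv ℝ N p) p := (hN.differentiable (by simp) p).hasFDerivAt
  -- The derivative `1 + N'` is invertible by a Neumann series, so the inverse function theorem
  -- applies. Its local inverse stays in `U` near the image point and therefore agrees with the
  -- global left inverse.
  have hlt : ‖-(fderiv ℝ N p)‖ < 1 := by
    rw [norm_neg]
    refine (hNd.le_of_lipschitzOn (hU.mem_nhds hp) hL).trans_lt ?_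
    norm_num
  have hfd : HasFDerivAt f
      ((ContinuousLinearEquiv.unitsEquiv ℝ E (Units.oneSub _ hlt) : E ≃L[ℝ] E) : E →L[ℝ] E) p := by
    rw [hf]
    refine ((hasFDerivAt_id p).add hNd).congr_fderiv ?_
    ext v
    simp
  have h0 : (∞ : WithTop ℕ∞) ≠ 0 := by simp
  have hst := hfs.contDiffAt.hasStrictFDerivAt' hfd h0
  have h1 := hst.eventually_right_inverse
  have h2 : ∀ᶠ y in 𝓝 (f p), hst.localInverse f _ p y ∈ U := by
    refine hst.localInverse_continuousAt.eventually_mem ?_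
    rw [hst.localInverse_apply_image]
    exact hU.mem_nhds hp
  refine (hfs.contDiffAt.to_localInverse hfd h0).congr_of_eventuallyEq ?_
  filter_upwards [h1, h2] with y hy1 hy2
  have := hG hy2
  rw [hy1] at this
  exact this

/-- Quantitative surjectivity: around a zero of `N`, the image of a ball of radius `ε` contains the
concentric ball of radius `(1 - 1/2) ε`. -/
theorem exists_add_eq_of_lipschitzOn {p y : E} {ε : ℝ} (hL : LipschitzOnWith (1 / 2) N U)
    (hε : 0 ≤ ε) (hU : Metric.closedBall p ε ⊆ U) (hp : N p = 0) (hy : ‖y - p‖ ≤ ε / 2) :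
    ∃ q ∈ Metric.closedBall p ε, q + N q = y := by
  have ha : ApproximatesLinearOn (fun p => p + N p) (ContinuousLinearMap.id ℝ E) U (1 / 2) := by
    intro a ha b hb
    have := hL.norm_sub_le ha hb
    simpa [add_sub_add_comm] using this
  have := ha.surjOn_closedBall_of_nonlinearRightInverse
    { toFun := id, nnnorm := 1, bound' := fun y => by simp, right_inv' := fun y => by simp }
    (b := p) hε hU
  refine this ?_
  simp only [hp, add_zero, mem_closedBall_iff_norm]
  norm_num
  linarith

end NearIdentity

/-- A monomial of order at least `2` has a small Lipschitz constant near `w = 0`. -/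
theorem SmoothPeriodic.exists_abs_mul_pow_sub_le {g : ℝ → ℝ} (hg : SmoothPeriodic g) {n : ℕ}
    (hn : 2 ≤ n) {κ : ℝ} (hκ : 0 < κ) : ∃ δ > 0, ∀ p q : ℝ × ℝ, |p.2| < δ → |q.2| < δ →
      |g p.1 * p.2 ^ n - g q.1 * q.2 ^ n| ≤ κ * ‖p - q‖ := by
  obtain ⟨C, hC, hb⟩ := hg.bounded
  obtain ⟨K, hK, hl⟩ := hg.exists_lipschitz
  have hn0 : (0 : ℝ) < n := by exact_mod_cast (by omega : 0 < n)
  refine ⟨min 1 (κ / (K + C * n)), by positivity, fun p q hp hq => ?_⟩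
  have hM : max |p.2| |q.2| < min 1 (κ / (K + C * n)) := max_lt hp hq
  obtain ⟨M, hMe⟩ : ∃ M, M = max |p.2| |q.2| := ⟨_, rfl⟩
  rw [← hMe] at hM
  have hM0 : 0 ≤ M := by rw [hMe]; positivity
  have m1 := hM.trans_le (min_le_left _ _)
  have m2 := hM.trans_le (min_le_right _ _)
  rw [lt_div_iff₀ (by positivity)] at m2
  have e1 : |p.1 - q.1| ≤ ‖p - q‖ := norm_fst_le (p - q)
  have e2 : |p.2 - q.2| ≤ ‖p - q‖ := norm_snd_le (p - q)
  have e3 : |p.2 ^ n| ≤ M := by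
    rw [abs_pow]
    have : |p.2| ≤ M := by rw [hMe]; exact le_max_left _ _
    calc |p.2| ^ n ≤ M ^ n := by gcongr
      _ ≤ M := pow_le_of_le_one hM0 m1.le (by omega)
  have e4 : |p.2 ^ n - q.2 ^ n| ≤ n * M * ‖p - q‖ := by
    refine (_root_.abs_pow_sub_pow_le p.2 q.2 n).trans ?_
    rw [← hMe, mul_comm |p.2 - q.2|, mul_right_comm]
    have : M ^ (n - 1) ≤ M := pow_le_of_le_one hM0 m1.le (by omega)
    gcongr
  have d : g p.1 * p.2 ^ n - g q.1 * q.2 ^ n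
      = (g p.1 - g q.1) * p.2 ^ n + g q.1 * (p.2 ^ n - q.2 ^ n) := by ring
  have t1 : |(g p.1 - g q.1) * p.2 ^ n| ≤ K * ‖p - q‖ * M := by
    rw [abs_mul]
    have := hl p.1 q.1
    gcongr
    exact this.trans (by gcongr)
  have t2 : |g q.1 * (p.2 ^ n - q.2 ^ n)| ≤ C * (n * M * ‖p - q‖) := by
    rw [abs_mul]
    have := hb q.1
    rw [Real.norm_eq_abs] at this
    gcongr
  rw [d]
  refine (abs_add_le _ _).trans ?_
  nlinarith [norm_nonneg (p - q)]

variable {Ω : Set ℂ} {ℓ : ℝ} {γ : ℝ → ℂ} {c : ℝ} {r S : ℝ → ℝ}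

/-- `Ψ` factors as `(id + N) ∘ D`, where `D` divides the angle by `A` in the Lazutkin chart and has
the global inverse `I`. All terms of `N` have order at least `2` in the second variable, so `N` is
`1/2`-Lipschitz on a thin strip. -/
theorem LazutkinChart.isBoundaryDiffeo (H : LazutkinChart ℓ γ c r S) {A g₂ g₃ g₅ : ℝ → ℝ}
    (hA : SmoothPeriodic A) (hA0 : ∀ x, 0 < A x) (h₂ : SmoothPeriodic g₂) (h₃ : SmoothPeriodic g₃)
    (h₅ : SmoothPeriodic g₅) {Ψ : ℝ × ℝ → ℝ × ℝ}
    (hΨ : ∀ p, Ψ p = (lazutkinParam ℓ γ p.1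
        + g₂ (lazutkinParam ℓ γ p.1) * (p.2 / A (lazutkinParam ℓ γ p.1)) ^ 2,
      p.2 / A (lazutkinParam ℓ γ p.1)
        + (g₃ (lazutkinParam ℓ γ p.1) * (p.2 / A (lazutkinParam ℓ γ p.1)) ^ 3
        + g₅ (lazutkinParam ℓ γ p.1) * (p.2 / A (lazutkinParam ℓ γ p.1)) ^ 5))) :
    IsBoundaryDiffeo Ψ := by
  obtain ⟨N, hN⟩ : ∃ N : ℝ × ℝ → ℝ × ℝ, N = fun p => (g₂ p.1 * p.2 ^ 2,
    g₃ p.1 * p.2 ^ 3 + g₅ p.1 * p.2 ^ 5) := ⟨_, rfl⟩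
  obtain ⟨D, hD⟩ : ∃ D : ℝ × ℝ → ℝ × ℝ, D = fun p =>
    (lazutkinParam ℓ γ p.1, p.2 / A (lazutkinParam ℓ γ p.1)) := ⟨_, rfl⟩
  obtain ⟨I, hI⟩ : ∃ I : ℝ × ℝ → ℝ × ℝ, I = fun p => (S p.1, A p.1 * p.2) := ⟨_, rfl⟩
  have hNs : ContDiff ℝ ∞ N := by
    rw [hN]
    exact ((h₂.1.comp contDiff_fst).mul (contDiff_snd.pow 2)).prodMk
      (((h₃.1.comp contDiff_fst).mul (contDiff_snd.pow 3)).add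
        ((h₅.1.comp contDiff_fst).mul (contDiff_snd.pow 5)))
  have hLs : ContDiff ℝ ∞ fun p : ℝ × ℝ => lazutkinParam ℓ γ p.1 := H.smooth_param.comp contDiff_fst
  have hDs : ContDiff ℝ ∞ D := by
    rw [hD]
    exact hLs.prodMk (contDiff_snd.div (hA.1.comp hLs) fun p => (hA0 _).ne')
  have hIs : ContDiff ℝ ∞ I := by
    rw [hI]
    exact (H.smooth.comp contDiff_fst).prodMk ((hA.1.comp contDiff_fst).mul contDiff_snd)
  have hID : ∀ p, I (D p) = p := fun p => by
    rw [hI, hD]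
    simp only [H.apply_param]
    rw [mul_div_cancel₀ _ (hA0 _).ne']
  have hDI : ∀ p, D (I p) = p := fun p => by
    rw [hI, hD]
    simp only [H.param_apply]
    rw [mul_div_cancel_left₀ _ (hA0 _).ne']
  have hΨ' : Ψ = fun p => D p + N (D p) := by
    funext p
    rw [hΨ, hN, hD]
    simp
  obtain ⟨δ₁, hδ₁, l₂⟩ := h₂.exists_abs_mul_pow_sub_le (n := 2) (κ := 1 / 2)
    (by norm_num) (by norm_num)
  obtain ⟨δ₂, hδ₂, l₃⟩ := h₃.exists_abs_mul_pow_sub_le (n := 3) (κ := 1 / 4)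
    (by norm_num) (by norm_num)
  obtain ⟨δ₃, hδ₃, l₅⟩ := h₅.exists_abs_mul_pow_sub_le (n := 5) (κ := 1 / 4)
    (by norm_num) (by norm_num)
  obtain ⟨δ, hδ, hd1, hd2, hd3⟩ : ∃ δ > 0, δ ≤ δ₁ ∧ δ ≤ δ₂ ∧ δ ≤ δ₃ :=
    ⟨min δ₁ (min δ₂ δ₃), by positivity, min_le_left _ _, (min_le_right _ _).trans (min_le_left _ _),
      (min_le_right _ _).trans (min_le_right _ _)⟩
  obtain ⟨U, hUe⟩ : ∃ U : Set (ℝ × ℝ), U = univ ×ˢ Ioo (-δ) δ := ⟨_, rfl⟩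
  have hmem : ∀ p, p ∈ U ↔ |p.2| < δ := fun p => by simp [hUe, abs_lt]
  have hU : IsOpen U := by rw [hUe]; exact isOpen_univ.prod isOpen_Ioo
  have hL : LipschitzOnWith (1 / 2) N U := by
    refine LipschitzOnWith.of_dist_le_mul fun p hp q hq => ?_
    rw [hmem] at hp hq
    rw [dist_eq_norm, dist_eq_norm, hN, Prod.norm_def]
    have e : ((1 / 2 : NNReal) : ℝ) = 1 / 2 := by norm_num
    rw [e]
    refine max_le (l₂ p q (by linarith) (by linarith)) ?_
    have a1 := l₃ p q (by linarith) (by linarith)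
    have a2 := l₅ p q (by linarith) (by linarith)
    simp only [Prod.mk_sub_mk, Real.norm_eq_abs]
    rw [add_sub_add_comm]
    exact (abs_add_le _ _).trans (by linarith)
  have hN0 : ∀ x, N (x, 0) = 0 := fun x => by rw [hN]; simp
  obtain ⟨G, hG1, hG2⟩ := exists_contDiffOn_leftInvOn hU hNs hL
  -- `N` vanishes on the axis, so it moves the second coordinate by at most half of its size. Its
  -- sign is preserved, and the half plane is respected in both directions.
  have hsgn : ∀ p ∈ U, |(N p).2| ≤ |p.2| / 2 := fun p hp => by
    have h0 : (p.1, (0 : ℝ)) ∈ U := by rw [hmem]; simpa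
    have := hL.norm_sub_le hp h0
    rw [hN0, sub_zero, Prod.norm_def (p - (p.1, 0))] at this
    have e : ((1 / 2 : NNReal) : ℝ) = 1 / 2 := by norm_num
    rw [e] at this
    have := (norm_snd_le (N p)).trans this
    simp only [Prod.fst_sub, Prod.snd_sub, sub_self, norm_zero, sub_zero, Real.norm_eq_abs] at this
    rw [max_eq_right (abs_nonneg _)] at this
    linarith
  obtain ⟨k, hk, hk'⟩ := hA.exists_pos_le hA0
  obtain ⟨K, hK, hK'⟩ := hA.bounded
  have hAK : ∀ x, A x ≤ K := fun x => (le_abs_self _).trans (hK' x)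
  have hkK : k ≤ K := (hk' 0).trans (hAK 0)
  have hDU : ∀ p ∈ univ ×ˢ Ico (0 : ℝ) (δ * k), 0 ≤ (D p).2 ∧ D p ∈ U := by
    rintro p ⟨-, hp1, hp2⟩
    have e1 : (D p).2 = p.2 / A (lazutkinParam ℓ γ p.1) := by rw [hD]
    have e2 : 0 ≤ (D p).2 := by rw [e1]; exact div_nonneg hp1 (hA0 _).le
    refine ⟨e2, ?_⟩
    rw [hmem, abs_of_nonneg e2, e1, div_lt_iff₀ (hA0 _)]
    exact hp2.trans_le (by have := hk' (lazutkinParam ℓ γ p.1); gcongr)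
  -- With `k ≤ A ≤ K`: angles below `δ k` go into the strip of width `δ`. Targets below `δ k / (4
  -- K)` are reached from the ball of radius `δ k / (2 K)`, where `A` times the coordinate is at
  -- most `δ k / 2`.
  refine ⟨δ * k, by positivity, δ * k / (4 * K), by positivity,
    fun p => I (G p), ?_, ?_, ?_, ?_, ?_⟩
  · rw [hΨ']; exact (hDs.add (hNs.comp hDs)).contDiffOn
  · refine hIs.comp_contDiffOn (hG2.mono ?_)
    rintro _ ⟨p, hp, rfl⟩
    rw [hΨ']
    exact ⟨D p, (hDU p hp).2, rfl⟩
  · intro p hp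
    rw [hΨ']
    have := hG1 (hDU p hp).2
    simp only at this ⊢
    rw [this, hID]
  · rintro _ ⟨p, hp, rfl⟩
    refine ⟨trivial, ?_⟩
    obtain ⟨h1, h2⟩ := hDU p hp
    have h3 := hsgn _ h2
    rw [abs_of_nonneg h1, abs_le] at h3
    rw [hΨ', mem_Ici, Prod.snd_add]
    linarith [h3.1]
  · rintro ⟨x, y⟩ ⟨-, hy0, hy1⟩
    have hρ : δ * k / (2 * K) < δ := by
      rw [div_lt_iff₀ (by positivity)]; nlinarith
    have hball : Metric.closedBall (x, (0 : ℝ)) (δ * k / (2 * K)) ⊆ U := by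
      intro q hq
      rw [mem_closedBall_iff_norm] at hq
      have := (norm_snd_le _).trans hq
      rw [hmem]
      simp only [Prod.snd_sub, sub_zero, Real.norm_eq_abs] at this
      linarith
    obtain ⟨q, hq, hqy⟩ := exists_add_eq_of_lipschitzOn (y := (x, y)) hL
      (show 0 ≤ δ * k / (2 * K) by positivity) hball (hN0 x) (by
        simp only [Prod.mk_sub_mk, sub_self, sub_zero, Prod.norm_def, norm_zero, Real.norm_eq_abs,
          abs_of_nonneg hy0]
        rw [max_eq_right hy0]
        simp only at hy1
        have : δ * k / (2 * K) / 2 = δ * k / (4 * K) := by rw [div_div]; ring_nf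
        rw [this]
        exact hy1.le)
    have hqU := hball hq
    have hq2 : |q.2| ≤ δ * k / (2 * K) := by
      rw [mem_closedBall_iff_norm] at hq
      simpa using (norm_snd_le _).trans hq
    have hq0 : 0 ≤ q.2 := by
      by_contra hneg
      push Not at hneg
      have h3 := hsgn q hqU
      rw [abs_of_neg hneg, abs_le] at h3
      have h4 : q.2 + (N q).2 = y := by rw [← Prod.snd_add, hqy]
      simp only at hy0
      linarith [h3.2]
    rw [abs_of_nonneg hq0, le_div_iff₀ (by positivity)] at hq2
    refine ⟨I q, ⟨trivial, ?_, ?_⟩, ?_⟩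
    · rw [hI]; exact mul_nonneg (hA0 _).le hq0
    · rw [hI]
      have : A q.1 * q.2 ≤ K * q.2 := by have := hAK q.1; gcongr
      have : 0 < δ * k := by positivity
      simp only
      linarith
    · rw [hΨ']
      simp only
      rw [hDI, hqy]

namespace AngleExpansion

variable {T : ℝ → ℝ → ℝ} {A₁ A₃ A₅ B q₃ q₅ : ℝ → ℝ}

theorem bdd_div_snd (h : AngleExpansion T A₁ A₃ A₅ B) :
    Bdd stripFilter fun a => T a.1 a.2 / a.2 := by
  obtain ⟨k, hk, K, -, hb⟩ := h.exists_ratio_bounds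
  refine bdd_of_le (C := K) ?_
  filter_upwards [hb] with a ha
  rw [abs_of_pos (hk.trans_le ha.1)]
  exact ha.2

/-- The new action coordinate is bounded below by a multiple of the chord length `t`, so errors
`O(t⁶)` are errors `O(y⁶)`. -/
theorem exists_le_oddPoly_div (h : AngleExpansion T A₁ A₃ A₅ B) (h₃ : SmoothPeriodic q₃)
    (h₅ : SmoothPeriodic q₅) : ∃ κ > 0, ∀ᶠ a in stripFilter,
      κ ≤ (1 / A₁ a.1 * T a.1 a.2 + q₃ a.1 * T a.1 a.2 ^ 3 + q₅ a.1 * T a.1 a.2 ^ 5) / a.2 := by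
  obtain ⟨k, hk, _, -, hb⟩ := h.exists_ratio_bounds
  obtain ⟨K, hK, hK'⟩ := h.smooth₁.bounded
  have bu := h.bdd_div_snd
  have b3 := h₃.bdd_fst
  have b5 := h₅.bdd_fst
  have bh := bdd_snd
  have b : Bdd stripFilter fun a => a.2 * (q₃ a.1 * (T a.1 a.2 / a.2) ^ 3
      + q₅ a.1 * (T a.1 a.2 / a.2) ^ 5 * a.2 ^ 2) := by
    repeat' first | with_reducible assumption | apply Bdd.pow | with_reducible apply Bdd.add |
      with_reducible apply Bdd.mul
  refine ⟨k / K / 2, by positivity, ?_⟩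
  filter_upwards [hb, b.eventually_abs_snd_mul_lt (show 0 < k / K / 2 by positivity),
    eventually_snd_ne_zero] with a ha hs h0
  have e : (1 / A₁ a.1 * T a.1 a.2 + q₃ a.1 * T a.1 a.2 ^ 3 + q₅ a.1 * T a.1 a.2 ^ 5) / a.2
      = (T a.1 a.2 / a.2) / A₁ a.1 + a.2 * (a.2 * (q₃ a.1 * (T a.1 a.2 / a.2) ^ 3
      + q₅ a.1 * (T a.1 a.2 / a.2) ^ 5 * a.2 ^ 2)) := by
    have := (h.pos a.1).ne'
    field_simp
    ring
  have h1 : k / K ≤ (T a.1 a.2 / a.2) / A₁ a.1 :=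
    div_le_div₀ (hk.le.trans ha.1) ha.1 (h.pos _) ((le_abs_self _).trans (hK' _))
  rw [e]
  linarith [(abs_lt.1 hs).1]

end AngleExpansion

/-- The billiard map near the boundary, in the Lazutkin parametrization. -/
theorem LazutkinChart.exists_step (H : LazutkinChart ℓ γ c r S)
    (hΩ : IsBilliardDomain Ω ℓ γ) {η : ℝ} (hη : 0 < η) : ∃ δ > 0, ∀ s φ s' φ', φ < δ →
      IsBilliardStep ℓ γ s φ s' φ' → ∃ t, 0 < t ∧ t < η ∧
        lazutkinParam ℓ γ s' = lazutkinParam ℓ γ s + t ∧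
        φ = chordAngle (fun x => γ (S x)) (fun x => deriv γ (S x)) (lazutkinParam ℓ γ s) t ∧
        φ' = -chordAngle (fun x => γ (S x)) (fun x => deriv γ (S x))
          (lazutkinParam ℓ γ s') (-t) := by
  obtain ⟨d₂, hd₂, hang⟩ := H.exists_angle_eq
  obtain ⟨d₃, hd₃, hsmall⟩ := H.exists_lt_of_angle_lt hΩ (lt_min hη hd₂)
  refine ⟨d₃, hd₃, fun s φ s' φ' hφ ⟨h1, h2, h3, h4⟩ => ?_⟩
  obtain ⟨x, hx⟩ : ∃ x, x = lazutkinParam ℓ γ s := ⟨_, rfl⟩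
  obtain ⟨x', hx'⟩ : ∃ x', x' = lazutkinParam ℓ γ s' := ⟨_, rfl⟩
  have s0 : S x = s := by rw [hx]; exact H.apply_param _
  have s1 : S x' = s' := by rw [hx']; exact H.apply_param _
  have l1 : x < x' := by rw [hx, hx']; exact H.strictMono_param h1
  have l2 : x' < x + 1 := by rw [hx, hx', ← H.param_add]; exact H.strictMono_param h2
  have hlt := hsmall x x' l1 l2 (by rw [s0, s1, ← h3]; exact hφ)
  have l3 : x' - x < min η d₂ := by linarith
  have l4 := l3.trans_le (min_le_right _ _)
  have e1 := (hang x (x' - x) (by linarith) l4).1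
  have e2 := (hang x' (x' - x) (by linarith) l4).2
  rw [add_sub_cancel, s0, s1, ← h3] at e1
  rw [sub_sub_cancel, s0, s1, ← h4] at e2
  rw [← hx, ← hx']
  exact ⟨x' - x, by linarith, l3.trans_le (min_le_left _ _), by ring, e1, e2⟩

theorem LazutkinChart.periodic_comp_param (H : LazutkinChart ℓ γ c r S) {f : ℝ → ℝ}
    (hf : SmoothPeriodic f) : ContDiff ℝ ∞ (fun s => f (lazutkinParam ℓ γ s)) ∧
      Function.Periodic (fun s => f (lazutkinParam ℓ γ s)) ℓ :=
  ⟨hf.1.comp H.smooth_param, fun s => by simp only [H.param_add, hf.2 _]⟩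

/-- Order `k = 2`, with `X = x + (β / A₁²) φ²`, `β = -a`, and for `Y` the odd polynomial of
`exists_displacement_eq`, so that `X` advances by `Y` up to order `6`. -/
theorem LazutkinChart.isLazutkinX1 (H : LazutkinChart ℓ γ c r S) (hΩ : IsBilliardDomain Ω ℓ γ)
    {A₁ A₃ A₅ : ℝ → ℝ} (hA : AngleExpansion (chordAngle (fun x => γ (S x)) fun x => deriv γ (S x))
      A₁ A₃ A₅ (potential c r)) :
    IsLazutkinX1 ℓ γ fun s => -correction (potential c r) (lazutkinParam ℓ γ s)
      / A₁ (lazutkinParam ℓ γ s) ^ 2 := by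
  have hA0 := fun x => (hA.pos x).ne'
  have hcor := smoothPeriodic_correction hA.smooth_B
  obtain ⟨β, hβe⟩ : ∃ β : ℝ → ℝ, β = fun x => -correction (potential c r) x := ⟨_, rfl⟩
  have hβ : SmoothPeriodic β := by rw [hβe]; exact hcor.neg
  have hβ2 : ∀ x, deriv (deriv β) x = 2 * deriv (potential c r) x := fun x => by
    rw [hβe, deriv.fun_neg', deriv.fun_neg, deriv_deriv_correction hA.smooth_B]; ring
  obtain ⟨q₃, q₅, h₃, h₅, W, hW, hdisp⟩ := hA.exists_displacement_eq hβ hβ2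
  obtain ⟨κ, hκ, hY⟩ := hA.exists_le_oddPoly_div h₃ h₅
  obtain ⟨d₁, hd₁, hY⟩ := eventually_stripFilter.1 hY
  obtain ⟨C, hC, d₂, hd₂, hWb⟩ := hW.exists_bound
  obtain ⟨δ, hδ, hstep⟩ := H.exists_step hΩ (lt_min hd₁ hd₂)
  have hb : SmoothPeriodic fun x => β x / A₁ x ^ 2 :=
    hβ.div (hA.smooth₁.pow 2) fun x => pow_ne_zero 2 (hA0 x)
  have h₁ : SmoothPeriodic fun x => 1 / A₁ x := (smoothPeriodic_const 1).div hA.smooth₁ hA0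
  obtain ⟨L, hL⟩ : ∃ L, L = lazutkinParam ℓ γ := ⟨_, rfl⟩
  obtain ⟨X, hX0, hX1⟩ : ∃ X : ℕ → ℝ → ℝ, X 0 = L ∧ X 1 = fun s => β (L s) / A₁ (L s) ^ 2 :=
    ⟨fun j => if j = 0 then L else fun s => β (L s) / A₁ (L s) ^ 2, by simp, by simp⟩
  obtain ⟨Y, hY0, hY1, hY2⟩ : ∃ Y : ℕ → ℝ → ℝ, Y 0 = (fun s => 1 / A₁ (L s)) ∧
      Y 1 = (fun s => q₃ (L s)) ∧ Y 2 = fun s => q₅ (L s) :=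
    ⟨fun j => if j = 0 then fun s => 1 / A₁ (L s) else if j = 1 then fun s => q₃ (L s) else
      fun s => q₅ (L s), by simp, by simp, by simp⟩
  have hXs : ∀ s φ, evenSum 2 X s φ = L s + β (L s) / A₁ (L s) ^ 2 * φ ^ 2 := fun s φ => by
    simp [evenSum, Finset.sum_range_succ, hX0, hX1]
  have hYs : ∀ s φ, oddSum 2 Y s φ = 1 / A₁ (L s) * φ + q₃ (L s) * φ ^ 3 + q₅ (L s) * φ ^ 5 :=
    fun s φ => by simp [oddSum, Finset.sum_range_succ, hY0, hY1, hY2]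
  have p1 := H.periodic_comp_param h₁
  have p3 := H.periodic_comp_param h₃
  have p5 := H.periodic_comp_param h₅
  have pb := H.periodic_comp_param hb
  rw [← hL] at p1 p3 p5 pb
  refine ⟨2, le_rfl, X, Y, ⟨?_, ?_, ?_, ?_, ?_, ?_, ?_⟩, ?_, ?_⟩
  · intro j hj
    interval_cases j
    · rw [hX0, hL]; exact H.smooth_param
    · rw [hX1]; exact pb.1
  · intro j hj
    interval_cases j
    · rw [hY0]; exact p1.1
    · rw [hY1]; exact p3.1
    · rw [hY2]; exact p5.1
  · rw [hX0, hL]; exact H.param_add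
  · intro j hj0 hj
    interval_cases j
    rw [hX1]; exact pb.2
  · intro j hj
    interval_cases j
    · rw [hY0]; exact p1.2
    · rw [hY1]; exact p3.2
    · rw [hY2]; exact p5.2
  · refine H.isBoundaryDiffeo hA.smooth₁ hA.pos hβ (h₃.mul (hA.smooth₁.pow 3))
      (h₅.mul (hA.smooth₁.pow 5)) fun p => ?_
    rw [hXs, hYs, ← hL]
    have := hA0 (L p.1)
    refine Prod.ext ?_ ?_
    · simp only; field_simp
    · simp only; field_simp; ring
  · refine ⟨δ, hδ, 2 * C / κ ^ 6, fun s φ s' φ' _ hφδ hs => ?_⟩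
    obtain ⟨t, ht0, htη, hx', hφ, hφ'⟩ := hstep s φ s' φ' hφδ hs
    rw [hXs, hXs, hYs, hYs]
    rw [← hL] at hx' hφ hφ'
    have ht1 := htη.trans_le (min_le_left _ _)
    have ht2 := htη.trans_le (min_le_right _ _)
    have a1 := hdisp (L s) t ht0.ne'
    -- Near-invariance of `Y` comes from reversing the chord: this changes the sign of the
    -- displacement and exchanges `φ` with `-φ'`, and `Y` is odd in the angle.
    have a2 := hdisp (L s + t) (-t) (neg_ne_zero.2 ht0.ne')
    rw [add_neg_cancel_right, neg_neg] at a2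
    have a3 := hY (L s) t ht0.ne' (by rwa [abs_of_pos ht0])
    have a4 := hWb (L s) t ht0.ne' (by rwa [abs_of_pos ht0])
    have a5 := hWb (L s + t) (-t) (neg_ne_zero.2 ht0.ne') (by rwa [abs_neg, abs_of_pos ht0])
    rw [hx'] at hφ' ⊢
    simp only [← hφ] at a1 a2 a3
    rw [show chordAngle (fun x => γ (S x)) (fun x => deriv γ (S x)) (L s + t) (-t) = -φ' by
      rw [hφ', neg_neg]] at a1 a2
    obtain ⟨Q, hQ⟩ : ∃ Q, Q = 1 / A₁ (L s) * φ + q₃ (L s) * φ ^ 3 + q₅ (L s) * φ ^ 5 := ⟨_, rfl⟩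
    rw [← hQ] at a1 a3 ⊢
    rw [le_div_iff₀ ht0] at a3
    have hQ6 : t ^ 6 ≤ Q ^ 6 / κ ^ 6 := by
      rw [le_div_iff₀ (by positivity), ← mul_pow, mul_comm t]
      gcongr
    have hCQ : 2 * C * t ^ 6 ≤ 2 * C / κ ^ 6 * Q ^ 6 := by
      calc 2 * C * t ^ 6 ≤ 2 * C * (Q ^ 6 / κ ^ 6) := by gcongr
        _ = _ := by ring
    have ht6 : 0 < t ^ 6 := by positivity
    norm_num only
    constructor
    · have e : L s + t + β (L s + t) / A₁ (L s + t) ^ 2 * φ' ^ 2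
          - (L s + β (L s) / A₁ (L s) ^ 2 * φ ^ 2 + Q) = t ^ 6 * W (L s, t) := by
        linear_combination a1
      rw [e, abs_mul, abs_of_pos ht6]
      nlinarith
    · have e : 1 / A₁ (L s + t) * φ' + q₃ (L s + t) * φ' ^ 3 + q₅ (L s + t) * φ' ^ 5 - Q
          = t ^ 6 * (W (L s, t) + W (L s + t, -t)) := by
        linear_combination a1 + a2
      rw [e, abs_mul, abs_of_pos ht6]
      have := abs_add_le (W (L s, t)) (W (L s + t, -t))
      nlinarith
  · intro φ
    rw [hXs, hL, H.param_zero, hβe]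
    simp [correction_zero]
  · rw [hX1, hβe, hL]

/-! ### Uniqueness of the coefficient `X₁` -/

theorem tendsto_mk_stripFilter (x : ℝ) :
    Tendsto (fun t : ℝ => (x, t)) (𝓝[>] 0) stripFilter := by
  refine tendsto_top.prodMk (nhdsWithin_mono 0 fun t ht => ?_)
  exact (ne_of_gt ht : t ≠ 0)

namespace AngleExpansion

variable {T : ℝ → ℝ → ℝ} {A₁ A₃ A₅ B f : ℝ → ℝ}

theorem bdd_odd_power (h : AngleExpansion T A₁ A₃ A₅ B) (hf : SmoothPeriodic f) (n : ℕ) :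
    Bdd stripFilter fun a => f a.1 * T a.1 a.2 ^ (2 * (n + 2) + 1) / a.2 ^ 5 := by
  have bu := h.bdd_div_snd
  have bf := hf.bdd_fst
  have bh := bdd_snd
  have : Bdd stripFilter fun a =>
      f a.1 * (T a.1 a.2 / a.2) ^ (2 * (n + 2) + 1) * a.2 ^ (2 * n) := by
    repeat' first | with_reducible assumption | apply Bdd.pow | with_reducible apply Bdd.mul
  refine this.congr ?_
  filter_upwards [eventually_snd_ne_zero] with a h0
  rw [div_pow, eq_div_iff (by positivity), show 2 * (n + 2) + 1 = 2 * n + 5 by ring, pow_add a.2]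
  field_simp

/-- Each term alone is only `O(t⁴)` when `n = 0`. The difference gains a factor `t`, because `T / t`
at the two ends of a chord agree up to `O(t)`. Hence the coefficients `X j` with `j ≥ 2` do not
affect the orders up to four. -/
theorem bdd_even_power_sub (h : AngleExpansion T A₁ A₃ A₅ B) (hf : SmoothPeriodic f) (n : ℕ) :
    Bdd stripFilter fun a => (f (a.1 + a.2) * T (a.1 + a.2) (-a.2) ^ (2 * (n + 2))
      - f a.1 * T a.1 a.2 ^ (2 * (n + 2))) / a.2 ^ 5 := by
  obtain ⟨R, hR, hT⟩ := h.exists_eq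
  obtain ⟨Q, bQ, hQ⟩ := h.smooth₁.exists_taylor_eq 1
  obtain ⟨P, bP, hP⟩ := hf.exists_taylor_eq 1
  have hu := tendsto_stripFilter_reverse
  have bh := bdd_snd
  have b3 := h.smooth₃.bdd_fst
  have b4 := (h.smooth₁.mul h.smooth_B.deriv).bdd_fst
  have b5 := h.smooth₅.bdd_fst
  obtain ⟨V, hV⟩ : ∃ V : ℝ × ℝ → ℝ, V = fun a => A₃ a.1 * a.2 + A₁ a.1 * deriv B a.1 * a.2 ^ 2
    + A₅ a.1 * a.2 ^ 3 + a.2 ^ 4 * R a := ⟨_, rfl⟩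
  have bV : Bdd stripFilter V := by
    rw [hV]
    repeat' first | with_reducible assumption | apply Bdd.pow | with_reducible apply Bdd.add |
      with_reducible apply Bdd.mul
  have hTV : ∀ x t, t ≠ 0 → T x t / t = A₁ x + t * V (x, t) := fun x t h0 => by
    rw [hT x t h0, hV]; field_simp; ring
  have bV' := bV.comp hu
  have bu := h.bdd_div_snd
  have bu' := bu.comp hu
  have bf := hf.bdd_fst
  obtain ⟨v, hv⟩ : ∃ v : ℝ × ℝ → ℝ, v = fun a => T (a.1 + a.2) (-a.2) / -a.2 := ⟨_, rfl⟩
  obtain ⟨u, hu⟩ : ∃ u : ℝ × ℝ → ℝ, u = fun a => T a.1 a.2 / a.2 := ⟨_, rfl⟩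
  simp only [← hv] at bu'
  rw [← hu] at bu
  have key : Bdd stripFilter fun a => a.2 ^ (2 * n) * (P a * v a ^ (2 * (n + 2)) + f a.1 *
      ((∑ i ∈ Finset.range (2 * (n + 2)), v a ^ i * u a ^ (2 * (n + 2) - 1 - i)) *
        (Q a - V (a.1 + a.2, -a.2) - V a))) := by
    have bs : Bdd stripFilter fun a =>
        ∑ i ∈ Finset.range (2 * (n + 2)), v a ^ i * u a ^ (2 * (n + 2) - 1 - i) :=
      Bdd.sum fun i _ => (bu'.pow i).mul (bu.pow _)
    repeat' first | with_reducible assumption | apply Bdd.pow | with_reducible apply Bdd.add |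
      with_reducible apply Bdd.sub | with_reducible apply Bdd.mul
  refine key.congr ?_
  filter_upwards [eventually_snd_ne_zero] with a h0
  have e1 : T a.1 a.2 ^ (2 * (n + 2)) = a.2 ^ (2 * n) * a.2 ^ 4 * u a ^ (2 * (n + 2)) := by
    rw [← pow_add, show 2 * n + 4 = 2 * (n + 2) by ring, ← mul_pow, hu]
    field_simp
  have e2 : T (a.1 + a.2) (-a.2) ^ (2 * (n + 2))
      = a.2 ^ (2 * n) * a.2 ^ 4 * v a ^ (2 * (n + 2)) := by
    rw [← pow_add, show 2 * n + 4 = 2 * (n + 2) by ring, ← mul_pow, hv]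
    rw [show a.2 * (T (a.1 + a.2) (-a.2) / -a.2) = -T (a.1 + a.2) (-a.2) by field_simp,
      Even.neg_pow (even_two_mul _)]
  have e3 : v a - u a = a.2 * (Q a - V (a.1 + a.2, -a.2) - V a) := by
    rw [hv, hu]
    simp only
    rw [hTV _ _ h0, hTV _ _ (neg_ne_zero.2 h0), hQ _ _ h0]
    simp
    ring
  have e4 : f (a.1 + a.2) = f a.1 + a.2 * P a := by
    rw [hP _ _ h0]; simp
  have e5 := geom_sum₂_mul (v a) (u a) (2 * (n + 2))
  rw [e3] at e5
  rw [e1, e2, e4, eq_div_iff (by positivity)]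
  linear_combination (a.2 ^ (2 * n) * f a.1 * a.2 ^ 4) * e5

end AngleExpansion

theorem LazutkinChart.smoothPeriodic_comp (H : LazutkinChart ℓ γ c r S) {f : ℝ → ℝ}
    (hf : ContDiff ℝ ∞ f) (hp : Function.Periodic f ℓ) : SmoothPeriodic fun x => f (S x) :=
  ⟨hf.comp H.smooth, fun x => by simp only [H.add_one, hp _]⟩

/-- Short chords give billiard steps. -/
theorem LazutkinChart.exists_isBilliardStep (H : LazutkinChart ℓ γ c r S) : ∃ δ > 0,
    ∀ x t, 0 < t → t < δ → IsBilliardStep ℓ γ (S x)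
      (chordAngle (fun x => γ (S x)) (fun x => deriv γ (S x)) x t) (S (x + t))
      (-chordAngle (fun x => γ (S x)) (fun x => deriv γ (S x)) (x + t) (-t)) := by
  obtain ⟨d, hd, hang⟩ := H.exists_angle_eq
  refine ⟨min d 1, by positivity, fun x t h0 ht => ?_⟩
  have h1 := ht.trans_le (min_le_left _ _)
  have h2 := ht.trans_le (min_le_right _ _)
  have e := (hang (x + t) t h0 h1).2
  rw [add_sub_cancel_right] at e
  refine ⟨H.strictMono (by linarith), ?_, (hang x t h0 h1).1.symm, e.symm⟩
  rw [← H.add_one]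
  exact H.strictMono (by linarith)

theorem coeff_eq_zero_of_evenSum_eq_zero {k : ℕ} {X : ℕ → ℝ → ℝ} (hk : 2 ≤ k)
    (hn : ∀ φ, evenSum k X 0 φ = 0) : X 0 0 = 0 ∧ X 1 0 = 0 := by
  obtain ⟨m, rfl⟩ : ∃ m, k = m + 2 := ⟨k - 2, by omega⟩
  have e : ∀ φ, evenSum (m + 2) X 0 φ
      = φ ^ 4 * ∑ j ∈ Finset.range m, X (j + 2) 0 * φ ^ (2 * j) + X 1 0 * φ ^ 2 + X 0 0 := by
    intro φ
    rw [evenSum, Finset.sum_range_succ', Finset.sum_range_succ', Finset.mul_sum]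
    congr 2
    · refine Finset.sum_congr rfl fun j _ => ?_
      ring
    · simp
  have h0 : X 0 0 = 0 := by
    have := hn 0
    rw [e] at this
    simpa using this
  refine ⟨h0, ?_⟩
  have h1 : (fun φ : ℝ => φ ^ 2 * ∑ j ∈ Finset.range m, X (j + 2) 0 * φ ^ (2 * j) + X 1 0)
      = fun _ => 0 := by
    refine Continuous.ext_on (dense_compl_singleton (0 : ℝ)) (by fun_prop) (by fun_prop) ?_
    intro φ hφ
    have h2 : φ ≠ 0 := hφ
    have := hn φ
    rw [e, h0] at this
    have h3 : φ ^ 2 ≠ 0 := by positivity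
    apply mul_left_cancel₀ h3
    linear_combination this
  have := congrFun h1 0
  simpa using this

/-- The conjugacy relation for the first component, along short chords. -/
theorem LazutkinChart.exists_conjugacy_eq (H : LazutkinChart ℓ γ c r S)
    {T : ℝ → ℝ → ℝ} (hTe : T = chordAngle (fun x => γ (S x)) fun x => deriv γ (S x))
    {A₁ A₃ A₅ : ℝ → ℝ} (hA : AngleExpansion T A₁ A₃ A₅ (potential c r)) {k : ℕ} (hk : 2 ≤ k)
    {X Y : ℕ → ℝ → ℝ} (hXY : IsLazutkinChange ℓ γ k X Y) : ∃ R : ℝ × ℝ → ℝ, Bdd stripFilter R ∧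
      ∀ᶠ a in stripFilter, 0 < a.2 →
        evenSum k X (S (a.1 + a.2)) (T (a.1 + a.2) (-a.2)) - evenSum k X (S a.1) (T a.1 a.2)
          - oddSum k Y (S a.1) (T a.1 a.2) = a.2 ^ 5 * R a := by
  obtain ⟨δ, hδ, C, hconj⟩ := hXY.conjugates
  obtain ⟨d, hd, hstep⟩ := H.exists_isBilliardStep
  obtain ⟨κ, hκ, K, hK, hratio⟩ := hA.exists_ratio_bounds
  have hYp : ∀ j ≤ k, SmoothPeriodic fun x => Y j (S x) := fun j hj =>
    H.smoothPeriodic_comp (hXY.smooth_Y j hj) (hXY.periodic_Y j hj)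
  have bu := hA.bdd_div_snd
  have bh := bdd_snd
  have bY : Bdd stripFilter fun a => oddSum k Y (S a.1) (T a.1 a.2) / a.2 := by
    have : Bdd stripFilter fun a => ∑ j ∈ Finset.range (k + 1),
        Y j (S a.1) * (T a.1 a.2 / a.2) ^ (2 * j + 1) * a.2 ^ (2 * j) :=
      Bdd.sum fun j hj => ((hYp j (by simpa [Nat.lt_succ_iff] using hj)).bdd_fst.mul
        (bu.pow _)).mul (bh.pow _)
    refine this.congr ?_
    filter_upwards [eventually_snd_ne_zero] with a h0
    rw [oddSum, Finset.sum_div]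
    refine Finset.sum_congr rfl fun j _ => ?_
    rw [div_pow, pow_succ a.2]
    field_simp
  -- The exponent `2 k - 3` is `2 k + 2 - 5`; the subtraction is not truncated since `k ≥ 2`.
  have bQ : Bdd stripFilter fun a => |C| * (oddSum k Y (S a.1) (T a.1 a.2) / a.2) ^ (2 * k + 2)
      * a.2 ^ (2 * k - 3) := ((bdd_const _).mul (bY.pow _)).mul (bh.pow _)
  obtain ⟨M, hM⟩ := IsBigO.bound bQ
  have hφ : ∀ᶠ a in stripFilter, T a.1 a.2 < δ := by
    have := bu.eventually_abs_snd_mul_lt hδ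
    filter_upwards [this, eventually_snd_ne_zero] with a ha h0
    rw [mul_div_cancel₀ _ h0] at ha
    exact (le_abs_self _).trans_lt ha
  have hlt : ∀ᶠ a in stripFilter, |a.2| < d :=
    eventually_stripFilter.2 ⟨d, hd, fun _ _ _ h => h⟩
  -- Only forward chords are billiard steps, so the remainder is set to zero for the others.
  refine ⟨fun a => if 0 < a.2 then (evenSum k X (S (a.1 + a.2)) (T (a.1 + a.2) (-a.2))
    - evenSum k X (S a.1) (T a.1 a.2) - oddSum k Y (S a.1) (T a.1 a.2)) / a.2 ^ 5 else 0, ?_, ?_⟩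
  · refine bdd_of_le (C := |M|) ?_
    filter_upwards [hM, hφ, hlt, hratio] with a hM hφ hlt hr
    split_ifs with h0
    · have h1 := hstep a.1 a.2 h0 (by rwa [abs_of_pos h0] at hlt)
      rw [← hTe] at h1
      have hpos : 0 < T a.1 a.2 := (div_pos_iff_of_pos_right h0).1 (hκ.trans_le hr.1)
      have h2 := (hconj _ _ _ _ hpos hφ h1).1
      have e : evenSum k X (S (a.1 + a.2)) (-T (a.1 + a.2) (-a.2))
          = evenSum k X (S (a.1 + a.2)) (T (a.1 + a.2) (-a.2)) := by
        simp only [evenSum, Even.neg_pow (even_two_mul _)]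
      rw [e, ← sub_sub] at h2
      rw [abs_div, abs_of_pos (pow_pos h0 5), div_le_iff₀ (pow_pos h0 5)]
      refine h2.trans ?_
      rw [norm_one, mul_one, Real.norm_eq_abs] at hM
      have e2 : C * oddSum k Y (S a.1) (T a.1 a.2) ^ (2 * k + 2)
          ≤ |C| * (oddSum k Y (S a.1) (T a.1 a.2) / a.2) ^ (2 * k + 2)
            * a.2 ^ (2 * k - 3) * a.2 ^ 5 := by
        have e3 : a.2 ^ (2 * k - 3) * a.2 ^ 5 = a.2 ^ (2 * k + 2) := by
          rw [← pow_add]; congr 1; omega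
        rw [mul_assoc, e3, div_pow, mul_assoc, div_mul_cancel₀ _ (pow_pos h0 _).ne']
        have e4 : 0 ≤ oddSum k Y (S a.1) (T a.1 a.2) ^ (2 * k + 2) :=
          Even.pow_nonneg ⟨k + 1, by ring⟩ _
        exact mul_le_mul_of_nonneg_right (le_abs_self C) e4
      refine e2.trans ?_
      have := (le_abs_self _).trans (hM.trans (le_abs_self M))
      exact mul_le_mul_of_nonneg_right this (pow_pos h0 5).le
    · simp
  · refine Eventually.of_forall fun a h0 => ?_
    simp only [h0, if_true]
    rw [mul_div_cancel₀ _ (pow_pos h0 5).ne']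

/-- Write `X 0 = x + p` and `X 1 = β / A₁²` in the Lazutkin parameter and compare powers of `t` in
the conjugacy relation. Order `2` gives `p'' = 0`, so `p = 0`; order `1` then gives `Y 0 = 1 / A₁`;
and order `4` becomes `β'' = 2 B'`. -/
theorem LazutkinChart.eq_of_isLazutkinX1 (H : LazutkinChart ℓ γ c r S)
    {A₁ A₃ A₅ : ℝ → ℝ} (hA : AngleExpansion (chordAngle (fun x => γ (S x)) fun x => deriv γ (S x))
      A₁ A₃ A₅ (potential c r)) {X₁ : ℝ → ℝ} (hX₁ : IsLazutkinX1 ℓ γ X₁) :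
    X₁ = fun s => -correction (potential c r) (lazutkinParam ℓ γ s)
      / A₁ (lazutkinParam ℓ γ s) ^ 2 := by
  obtain ⟨k, hk, X, Y, hXY, hnorm, rfl⟩ := hX₁
  obtain ⟨hn0, hn1⟩ := coeff_eq_zero_of_evenSum_eq_zero hk hnorm
  obtain ⟨T, hTe⟩ : ∃ T, T = chordAngle (fun x => γ (S x)) fun x => deriv γ (S x) := ⟨_, rfl⟩
  rw [← hTe] at hA
  obtain ⟨R, bR, hR⟩ := H.exists_conjugacy_eq hTe hA hk hXY
  obtain ⟨m, rfl⟩ : ∃ m, k = m + 2 := ⟨k - 2, by omega⟩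
  have hA0 := fun x => (hA.pos x).ne'
  obtain ⟨p, hp⟩ : ∃ p : ℝ → ℝ, p = fun x => X 0 (S x) - x := ⟨_, rfl⟩
  obtain ⟨β, hβ⟩ : ∃ β : ℝ → ℝ, β = fun x => X 1 (S x) * A₁ x ^ 2 := ⟨_, rfl⟩
  obtain ⟨y₀, hy₀⟩ : ∃ y : ℝ → ℝ, y = fun x => Y 0 (S x) := ⟨_, rfl⟩
  obtain ⟨y₁, hy₁⟩ : ∃ y : ℝ → ℝ, y = fun x => Y 1 (S x) := ⟨_, rfl⟩
  have sp : SmoothPeriodic p := by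
    rw [hp]
    refine ⟨((hXY.smooth_X 0 (by omega)).comp H.smooth).sub contDiff_id, fun x => ?_⟩
    simp only [H.add_one, hXY.degree_X]
    ring
  have sβ : SmoothPeriodic β := by
    rw [hβ]
    exact (H.smoothPeriodic_comp (hXY.smooth_X 1 (by omega))
      (hXY.periodic_X 1 (by omega) (by omega))).mul (hA.smooth₁.pow 2)
  have sy₀ : SmoothPeriodic y₀ := by
    rw [hy₀]; exact H.smoothPeriodic_comp (hXY.smooth_Y 0 (by omega)) (hXY.periodic_Y 0 (by omega))
  have sy₁ : SmoothPeriodic y₁ := by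
    rw [hy₁]; exact H.smoothPeriodic_comp (hXY.smooth_Y 1 (by omega)) (hXY.periodic_Y 1 (by omega))
  obtain ⟨cc, hcc⟩ : ∃ cc : ℝ → ℝ, cc = fun x => 2 * β x * A₃ x / A₁ x := ⟨_, rfl⟩
  obtain ⟨d, hd⟩ : ∃ d : ℝ → ℝ, d = fun x => 2 * β x * deriv (potential c r) x := ⟨_, rfl⟩
  have sc : SmoothPeriodic cc := by
    rw [hcc]; exact (((smoothPeriodic_const 2).mul sβ).mul hA.smooth₃).div hA.smooth₁ hA0
  have sd : SmoothPeriodic d := by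
    rw [hd]; exact ((smoothPeriodic_const 2).mul sβ).mul hA.smooth_B.deriv
  obtain ⟨P, bP, eP⟩ := hA.exists_eq
  obtain ⟨W₂, bW₂, eW₂⟩ := hA.exists_sq_eq sβ
  obtain ⟨W₃, bW₃, eW₃⟩ := hA.exists_cube_eq
  obtain ⟨Rp, bRp, eRp⟩ := sp.exists_taylor_eq 5
  obtain ⟨Rβ, bRβ, eRβ⟩ := sβ.exists_taylor_eq 3
  obtain ⟨Rc, bRc, eRc⟩ := sc.exists_taylor_eq 1
  obtain ⟨EX, hEX⟩ : ∃ E : ℝ × ℝ → ℝ, E = fun a => ∑ j ∈ Finset.range m,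
    (X (j + 2) (S (a.1 + a.2)) * T (a.1 + a.2) (-a.2) ^ (2 * (j + 2))
      - X (j + 2) (S a.1) * T a.1 a.2 ^ (2 * (j + 2))) / a.2 ^ 5 := ⟨_, rfl⟩
  obtain ⟨EY, hEY⟩ : ∃ E : ℝ × ℝ → ℝ, E = fun a => ∑ j ∈ Finset.range (m + 1),
    Y (j + 2) (S a.1) * T a.1 a.2 ^ (2 * (j + 2) + 1) / a.2 ^ 5 := ⟨_, rfl⟩
  have bEX : Bdd stripFilter EX := by
    rw [hEX]
    refine Bdd.sum fun j hj => ?_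
    have hj' := Finset.mem_range.1 hj
    exact hA.bdd_even_power_sub (H.smoothPeriodic_comp (hXY.smooth_X (j + 2) (by omega))
      (hXY.periodic_X (j + 2) (by omega) (by omega))) j
  have bEY : Bdd stripFilter EY := by
    rw [hEY]
    refine Bdd.sum fun j hj => ?_
    have hj' := Finset.mem_range.1 hj
    exact hA.bdd_odd_power (H.smoothPeriodic_comp (hXY.smooth_Y (j + 2) (by omega))
      (hXY.periodic_Y (j + 2) (by omega))) j
  have hu := tendsto_stripFilter_reverse
  have bW₂' := bW₂.comp hu
  have bh := bdd_snd
  have bd := sd.bdd_fst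
  have bd' : Bdd stripFilter fun a => d (a.1 + a.2) := sd.bdd_comp _
  have by₀ := sy₀.bdd_fst
  have by₁ := sy₁.bdd_fst
  have b5 := hA.smooth₅.bdd_fst
  have b13 := (((smoothPeriodic_const 3).mul (hA.smooth₁.pow 2)).mul hA.smooth₃).bdd_fst
  have bQ : Bdd stripFilter fun a => R a - (Rp a + Rβ a + Rc a - d (a.1 + a.2) - d a.1
      + a.2 * W₂ (a.1 + a.2, -a.2) - a.2 * W₂ a + EX a) + y₀ a.1 * (A₅ a.1 + a.2 * P a)
      + y₁ a.1 * (3 * A₁ a.1 ^ 2 * A₃ a.1 + a.2 * W₃ a) + EY a := by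
    repeat' first | with_reducible assumption | with_reducible apply Bdd.add |
      with_reducible apply Bdd.sub | with_reducible apply Bdd.mul
  have hcoef : ∀ x, 1 + deriv p x - y₀ x * A₁ x = 0 ∧ iteratedDeriv 2 p x / 2 = 0 ∧
      iteratedDeriv 3 p x / 6 + deriv β x - y₀ x * A₃ x - y₁ x * A₁ x ^ 3 = 0 ∧
      iteratedDeriv 4 p x / 24 + iteratedDeriv 2 β x / 2
        - y₀ x * (A₁ x * deriv (potential c r) x) = 0 := by
    intro x
    refine coeff_eq_zero_of_bdd (bQ.comp (tendsto_mk_stripFilter x)) ?_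
    filter_upwards [(tendsto_mk_stripFilter x).eventually hR, self_mem_nhdsWithin] with t ht ht0
    have ht0' : t ≠ 0 := ne_of_gt ht0
    have h1 := ht ht0
    have eX : evenSum (m + 2) X (S (x + t)) (T (x + t) (-t)) - evenSum (m + 2) X (S x) (T x t)
        = t ^ 5 * EX (x, t) + (β (x + t) / A₁ (x + t) ^ 2 * T (x + t) (-t) ^ 2
          - β x / A₁ x ^ 2 * T x t ^ 2) + (p (x + t) + t - p x) := by
      rw [hEX, Finset.mul_sum, evenSum, evenSum, ← Finset.sum_sub_distrib, Finset.sum_range_succ',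
        Finset.sum_range_succ', hβ, hp]
      simp only
      have z1 := hA0 x
      have z2 := hA0 (x + t)
      congr 1
      · congr 1
        · refine Finset.sum_congr rfl fun j _ => ?_
          rw [mul_div_cancel₀ _ (pow_ne_zero 5 ht0')]
        · field_simp
      · simp
        ring
    have eY : oddSum (m + 2) Y (S x) (T x t) = t ^ 5 * EY (x, t) + y₁ x * T x t ^ 3
        + y₀ x * T x t := by
      rw [hEY, Finset.mul_sum, oddSum, Finset.sum_range_succ', Finset.sum_range_succ', hy₁, hy₀]
      simp only
      congr 1
      · congr 1
        · refine Finset.sum_congr rfl fun j _ => ?_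
          rw [mul_div_cancel₀ _ (pow_ne_zero 5 ht0')]
      · simp
    have e2 := eW₂ (x + t) (-t) (neg_ne_zero.2 ht0')
    have e2' := eW₂ x t ht0'
    have e3 := eW₃ x t ht0'
    have e1 := eP x t ht0'
    have f1 := eRp x t ht0'
    have f2 := eRβ x t ht0'
    have f3 := eRc x t ht0'
    simp only [Finset.sum_range_succ, Finset.range_zero, Finset.sum_empty, iteratedDeriv_zero,
      iteratedDeriv_one, pow_zero, Nat.factorial] at f1 f2 f3
    have g1 : 2 * β (x + t) * A₃ (x + t) / A₁ (x + t) = cc (x + t) := by rw [hcc]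
    have g2 : 2 * β (x + t) * deriv (potential c r) (x + t) = d (x + t) := by rw [hd]
    have g3 : 2 * β x * A₃ x / A₁ x = cc x := by rw [hcc]
    have g4 : 2 * β x * deriv (potential c r) x = d x := by rw [hd]
    rw [g1, g2] at e2
    rw [g3, g4] at e2'
    rw [eX, eY, e2, e2', e3, e1, f1, f2, f3] at h1
    push_cast at h1
    linear_combination h1
  have hp2 : ∀ x, deriv (deriv p) x = 0 := fun x => by
    have := (hcoef x).2.1
    rw [iteratedDeriv_succ, iteratedDeriv_one] at this
    linarith
  have hp0 : p 0 = 0 := by rw [hp]; simp [H.zero, hn0]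
  have hpz : p = fun _ => 0 := funext fun x =>
    eq_zero_of_deriv_deriv_eq_zero sp.1 hp2 hp0 (by rw [← hp0]; simpa using sp.2 0) x
  have hβ2 : ∀ x, deriv (deriv β) x = 2 * deriv (potential c r) x := fun x => by
    obtain ⟨a1, -, -, a4⟩ := hcoef x
    rw [hpz] at a1 a4
    have z : iteratedDeriv 4 (fun _ : ℝ => (0 : ℝ)) x = 0 := by simp
    rw [deriv_const] at a1
    rw [z] at a4
    rw [show iteratedDeriv 2 β x = deriv (deriv β) x by
      rw [iteratedDeriv_succ, iteratedDeriv_one]] at a4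
    linear_combination 2 * a4 - 2 * deriv (potential c r) x * a1
  have hcor := eq_correction hA.smooth_B sβ.neg (fun x => by
    rw [deriv.fun_neg', deriv.fun_neg, hβ2]; ring) (by rw [hβ]; simp [H.zero, hn1])
  funext s
  have h1 := hcor (lazutkinParam ℓ γ s)
  rw [← h1, hβ]
  simp only [H.apply_param, neg_neg]
  rw [mul_div_cancel_right₀ _ (pow_ne_zero 2 (hA0 _))]

/-! ### Angular functions -/

/-- Exchanging the endpoints of a triple amounts to changing the sign of `η`, so positive `η`
suffices. -/
theorem collisionDefect_comm (γ : ℝ → ℂ) (sm s sp : ℝ) :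
    collisionDefect γ sm s sp = collisionDefect γ sp s sm := by
  rw [collisionDefect, collisionDefect, InnerProductGeometry.angle_neg_right,
    InnerProductGeometry.angle_neg_right]
  congr 1
  ring

/-- The collision defect of a short triple, in terms of chord angles. -/
theorem LazutkinChart.exists_collisionDefect_eq (H : LazutkinChart ℓ γ c r S) : ∃ δ > 0,
    ∀ x p m, 0 < p → p < δ → 0 < m → m < δ →
      collisionDefect γ (S (x - m)) (S x) (S (x + p))
        = |chordAngle (fun x => γ (S x)) (fun x => deriv γ (S x)) x p
          + chordAngle (fun x => γ (S x)) (fun x => deriv γ (S x)) x (-m)| := by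
  obtain ⟨δ, hδ, hang⟩ := H.exists_angle_eq
  refine ⟨δ, hδ, fun x p m hp hpδ hm hmδ => ?_⟩
  rw [collisionDefect, (hang x p hp hpδ).1, ← neg_sub (γ (S x)), InnerProductGeometry.angle_neg_neg,
    (hang x m hm hmδ).2, sub_neg_eq_add]

/-- The two gaps of the triple satisfy `p - m = a'' η⁴ + O(η⁶) = -2 B' η⁴ + O(η⁶)`, which cancels
`B' (p⁴ + m⁴)` in the reflection law. -/
theorem LazutkinChart.exists_collisionDefect_le (H : LazutkinChart ℓ γ c r S) : ∃ δ > 0, ∃ C > 0,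
    ∀ ξ η, 0 < η → η < δ →
      collisionDefect γ (S (ξ - η + correction (potential c r) (ξ - η) * η ^ 2))
        (S (ξ + correction (potential c r) ξ * η ^ 2))
        (S (ξ + η + correction (potential c r) (ξ + η) * η ^ 2)) ≤ C * η ^ 6 := by
  obtain ⟨A₁, A₃, A₅, hA⟩ := H.exists_angleExpansion
  obtain ⟨B, hB⟩ : ∃ B, B = potential c r := ⟨_, rfl⟩
  rw [← hB] at hA ⊢
  have sa := smoothPeriodic_correction hA.smooth_B
  have a2 := deriv_deriv_correction hA.smooth_B
  obtain ⟨a, hae⟩ : ∃ a, a = correction B := ⟨_, rfl⟩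
  rw [← hae] at sa a2 ⊢
  obtain ⟨d₁, hd₁, hdef⟩ := H.exists_collisionDefect_eq
  obtain ⟨C, hC, d₂, hd₂, hrefl⟩ := hA.exists_reflection_bound
  obtain ⟨Ka, hKa, la⟩ := sa.exists_lipschitz
  obtain ⟨C₂, hC₂, da⟩ := sa.exists_second_difference
  obtain ⟨Ma, hMa, ma⟩ := sa.bounded
  obtain ⟨b, hb, mb⟩ := hA.smooth_B.deriv.bounded
  obtain ⟨Lb, hLb, lb⟩ := hA.smooth_B.deriv.exists_lipschitz
  obtain ⟨K₁, hK₁, m1⟩ := hA.smooth₁.bounded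
  -- The bound `1 / (2 Ka)` keeps both gaps within `η / 2` of `η`, hence positive and at most `2 η`.
  refine ⟨min 1 (min (1 / (2 * Ka)) (min (d₁ / 2) (d₂ / 2))), by positivity,
    K₁ * (C₂ + 64 * b * Ka + 2 * Lb * Ma) + C * (4 * (2 * b + C₂) + 64), by positivity,
    fun ξ η h0 hη => ?_⟩
  have n1 := hη.trans_le (min_le_left _ _)
  have n2 := hη.trans_le ((min_le_right _ _).trans (min_le_left _ _))
  have n3 := hη.trans_le ((min_le_right _ _).trans ((min_le_right _ _).trans (min_le_left _ _)))
  have n4 := hη.trans_le ((min_le_right _ _).trans ((min_le_right _ _).trans (min_le_right _ _)))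
  rw [lt_div_iff₀ (by positivity)] at n2
  obtain ⟨x, hx⟩ : ∃ x, x = ξ + a ξ * η ^ 2 := ⟨_, rfl⟩
  obtain ⟨p, hp⟩ : ∃ p, p = η + (a (ξ + η) - a ξ) * η ^ 2 := ⟨_, rfl⟩
  obtain ⟨m, hm⟩ : ∃ m, m = η + (a ξ - a (ξ - η)) * η ^ 2 := ⟨_, rfl⟩
  have hη2 : 0 < η ^ 2 := by positivity
  have ep : |p - η| ≤ Ka * η ^ 3 := by
    have := la (ξ + η) ξ
    rw [add_sub_cancel_left, abs_of_pos h0] at this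
    rw [hp, add_sub_cancel_left, abs_mul, abs_of_pos hη2]
    calc |a (ξ + η) - a ξ| * η ^ 2 ≤ Ka * η * η ^ 2 := by gcongr
      _ = _ := by ring
  have em : |m - η| ≤ Ka * η ^ 3 := by
    have := la ξ (ξ - η)
    rw [sub_sub_cancel, abs_of_pos h0] at this
    rw [hm, add_sub_cancel_left, abs_mul, abs_of_pos hη2]
    calc |a ξ - a (ξ - η)| * η ^ 2 ≤ Ka * η * η ^ 2 := by gcongr
      _ = _ := by ring
  have hK3 : Ka * η ^ 3 ≤ η / 2 := by
    have : η ^ 2 ≤ η := by nlinarith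
    have : Ka * η ^ 2 ≤ 1 / 2 := by nlinarith
    nlinarith
  have ep' := abs_le.1 (ep.trans hK3)
  have em' := abs_le.1 (em.trans hK3)
  have p0 : 0 < p := by linarith [ep'.1]
  have m0 : 0 < m := by linarith [em'.1]
  have p2 : p ≤ 2 * η := by linarith [ep'.2]
  have m2 : m ≤ 2 * η := by linarith [em'.2]
  have e1 : ξ + η + a (ξ + η) * η ^ 2 = x + p := by rw [hx, hp]; ring
  have e2 : ξ - η + a (ξ - η) * η ^ 2 = x - m := by rw [hx, hm]; ring
  rw [e1, e2, ← hx, hdef x p m p0 (by linarith) m0 (by linarith)]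
  have hr := hrefl x p m (2 * η) p0 m0 p2 m2 (by linarith)
  have u1 : |p - m + 2 * deriv B ξ * η ^ 4| ≤ C₂ * η ^ 6 := by
    have := da ξ η
    rw [a2] at this
    have e : p - m + 2 * deriv B ξ * η ^ 4
        = η ^ 2 * (a (ξ + η) + a (ξ - η) - 2 * a ξ - -2 * deriv B ξ * η ^ 2) := by
      rw [hp, hm]; ring
    rw [e, abs_mul, abs_of_pos hη2]
    calc η ^ 2 * |a (ξ + η) + a (ξ - η) - 2 * a ξ - -2 * deriv B ξ * η ^ 2|
        ≤ η ^ 2 * (C₂ * η ^ 4) := by gcongr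
      _ = _ := by ring
  have hη6 : η ^ 6 ≤ η ^ 4 := pow_le_pow_of_le_one h0.le n1.le (by norm_num)
  have hη4 : 0 < η ^ 4 := by positivity
  have hη60 : 0 < η ^ 6 := by positivity
  have u2 : |p - m| ≤ (2 * b + C₂) * η ^ 4 := by
    have t1 : |2 * deriv B ξ * η ^ 4| ≤ 2 * b * η ^ 4 := by
      rw [abs_mul, abs_mul, abs_of_pos hη4, abs_two]
      have := mb ξ
      rw [Real.norm_eq_abs] at this
      gcongr
    have t2 := abs_sub (p - m + 2 * deriv B ξ * η ^ 4) (2 * deriv B ξ * η ^ 4)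
    rw [add_sub_cancel_right] at t2
    nlinarith
  have pw : ∀ y, 0 < y → y ≤ 2 * η → |y - η| ≤ Ka * η ^ 3 →
      |deriv B x * (y ^ 4 - η ^ 4)| ≤ 32 * b * Ka * η ^ 6 := by
    intro y hy0 hy2 hy
    have t := AngleExpansion.abs_pow_sub_pow_le hy0.le h0.le hy2 (by linarith : η ≤ 2 * η) 4
    norm_num at t
    have := mb x
    rw [Real.norm_eq_abs] at this
    rw [abs_mul]
    calc |deriv B x| * |y ^ 4 - η ^ 4| ≤ b * (4 * (2 * η) ^ 3 * (Ka * η ^ 3)) := by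
          refine mul_le_mul this (t.trans ?_) (abs_nonneg _) hb.le
          gcongr
      _ = _ := by ring
  have u3 : |2 * (deriv B x - deriv B ξ) * η ^ 4| ≤ 2 * Lb * Ma * η ^ 6 := by
    have t := lb x ξ
    rw [hx, add_sub_cancel_left, abs_mul, abs_of_pos hη2, ← hx] at t
    have := ma ξ
    rw [Real.norm_eq_abs] at this
    rw [abs_mul, abs_mul, abs_two, abs_of_pos hη4]
    calc 2 * |deriv B x - deriv B ξ| * η ^ 4 ≤ 2 * (Lb * (Ma * η ^ 2)) * η ^ 4 := by
          gcongr
          exact t.trans (by gcongr)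
      _ = _ := by ring
  have u4 : |(p - m) + deriv B x * (p ^ 4 + m ^ 4)| ≤ (C₂ + 64 * b * Ka + 2 * Lb * Ma) * η ^ 6 := by
    have e : (p - m) + deriv B x * (p ^ 4 + m ^ 4) = (p - m + 2 * deriv B ξ * η ^ 4)
        + deriv B x * (p ^ 4 - η ^ 4) + deriv B x * (m ^ 4 - η ^ 4)
        + 2 * (deriv B x - deriv B ξ) * η ^ 4 := by ring
    rw [e]
    refine ((abs_add_le _ _).trans (add_le_add ((abs_add_le _ _).trans
      (add_le_add (abs_add_le _ _) le_rfl)) le_rfl)).trans ?_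
    linarith [pw p p0 p2 ep, pw m m0 m2 em]
  have u5 : |A₁ x * ((p - m) + deriv B x * (p ^ 4 + m ^ 4))|
      ≤ K₁ * ((C₂ + 64 * b * Ka + 2 * Lb * Ma) * η ^ 6) := by
    rw [abs_mul]
    exact mul_le_mul (m1 x) u4 (abs_nonneg _) hK₁.le
  have u6 : C * ((2 * η) ^ 2 * |p - m| + (2 * η) ^ 6)
      ≤ C * ((2 * η) ^ 2 * ((2 * b + C₂) * η ^ 4) + (2 * η) ^ 6) := by gcongr
  have t := abs_add_le (chordAngle (fun x => γ (S x)) (fun x => deriv γ (S x)) x p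
    + chordAngle (fun x => γ (S x)) (fun x => deriv γ (S x)) x (-m)
    - A₁ x * ((p - m) + deriv B x * (p ^ 4 + m ^ 4)))
    (A₁ x * ((p - m) + deriv B x * (p ^ 4 + m ^ 4)))
  rw [sub_add_cancel] at t
  linarith

theorem LazutkinChart.smoothPeriodic_sub (H : LazutkinChart ℓ γ c r S) :
    SmoothPeriodic fun x => S x - ℓ * x :=
  ⟨H.smooth.sub (contDiff_const.mul contDiff_id), fun x => by simp only [H.add_one]; ring⟩

/-- The witness is `S (ξ + a(ξ) η²)` of order `2`. Its `η²` coefficient is `S' a`, and `η < 1 / (2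
D)` with `|a'| ≤ D` keeps `1 + a' η²` positive. -/
theorem LazutkinChart.isAngularZ1 (H : LazutkinChart ℓ γ c r S) :
    IsAngularZ1 ℓ γ fun ξ => c * r ξ ^ 2 * correction (potential c r) ξ := by
  obtain ⟨δ, hδ, C, hC, hcol⟩ := H.exists_collisionDefect_le
  have hB := smoothPeriodic_potential (c := c) H.curve.smooth_r H.curve.r_pos
  have sa := smoothPeriodic_correction hB
  have ha0 : correction (potential c r) 0 = 0 := correction_zero
  obtain ⟨a, hae⟩ : ∃ a, a = correction (potential c r) := ⟨_, rfl⟩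
  rw [← hae] at sa ha0 hcol ⊢
  obtain ⟨D, hD, hd⟩ := sa.deriv.bounded
  refine ⟨2, le_rfl, min 1 (1 / (2 * D)), by positivity, fun ξ η => S (ξ + a ξ * η ^ 2),
    ⟨?_, ?_, ?_, ?_, ?_, ?_⟩, ?_⟩
  · refine (H.smooth.comp (contDiff_fst.add ((sa.1.comp contDiff_fst).mul
      (contDiff_snd.pow 2)))).contDiffOn
  · intro ξ η _
    simp only [neg_sq]
  · intro ξ η _
    simp only [sa.2 ξ]
    rw [← H.add_one]
    congr 1
    ring
  · intro ξ η hη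
    have h1 : HasDerivAt (fun x => x + a x * η ^ 2) (1 + deriv a ξ * η ^ 2) ξ :=
      (hasDerivAt_id ξ).add ((sa.hasDerivAt ξ).mul_const _)
    have h2 := (H.hasDerivAt (ξ + a ξ * η ^ 2)).scomp ξ h1
    have h3 : deriv (fun x => S (x + a x * η ^ 2)) ξ
        = (1 + deriv a ξ * η ^ 2) • (c * r (ξ + a ξ * η ^ 2) ^ 2) := h2.deriv
    rw [h3, smul_eq_mul]
    have hη' : |η| < min 1 (1 / (2 * D)) := abs_lt.2 hη
    have n1 := hη'.trans_le (min_le_left _ _)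
    have n2 := hη'.trans_le (min_le_right _ _)
    rw [lt_div_iff₀ (by positivity)] at n2
    have n3 : η ^ 2 ≤ |η| := by rw [← sq_abs]; nlinarith [abs_nonneg η]
    have n4 : |deriv a ξ * η ^ 2| ≤ D * |η| := by
      rw [abs_mul, abs_of_nonneg (sq_nonneg η)]
      exact mul_le_mul (hd ξ) n3 (sq_nonneg η) hD.le
    have n5 := (abs_le.1 n4).1
    have hr := H.curve.r_pos (ξ + a ξ * η ^ 2)
    have hc := H.curve.c_pos
    have : 0 < 1 + deriv a ξ * η ^ 2 := by linarith
    positivity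
  · intro η _
    simp only [ha0, zero_mul, add_zero, H.zero]
  · refine ⟨min δ (min 1 (1 / (2 * D))), by positivity, min_le_right _ _, C, fun ξ η h0 hη => ?_⟩
    have hη' := hη.trans_le (min_le_left _ _)
    rcases lt_or_gt_of_ne (abs_pos.1 h0) with hneg | hpos
    · rw [abs_of_neg hneg] at hη' ⊢
      have := hcol ξ (-η) (by linarith) hη'
      rw [collisionDefect_comm]
      simpa [sub_neg_eq_add, ← sub_eq_add_neg] using this
    · rw [abs_of_pos hpos] at hη' ⊢
      exact hcol ξ η hpos hη'
  · intro ξ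
    obtain ⟨C', hC', ht⟩ := SmoothPeriodic.taylor 2 H.smoothPeriodic_sub
    refine IsBigO.of_bound (C' * a ξ ^ 2) (Eventually.of_forall fun η => ?_)
    have h1 := ht ξ (a ξ * η ^ 2)
    have h2 : deriv (fun x => S x - ℓ * x) ξ = c * r ξ ^ 2 - ℓ := by
      have := (H.hasDerivAt ξ).sub ((hasDerivAt_id ξ).const_mul ℓ)
      rw [mul_one] at this
      exact this.deriv
    simp only [Finset.sum_range_succ, Finset.range_zero, Finset.sum_empty, iteratedDeriv_zero,
      iteratedDeriv_one, h2, smul_eq_mul, Real.norm_eq_abs] at h1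
    norm_num at h1
    have e : S (ξ + a ξ * η ^ 2) - (S (ξ + a ξ * 0 ^ 2) + c * r ξ ^ 2 * a ξ * η ^ 2)
        = S (ξ + a ξ * η ^ 2) - ℓ * (ξ + a ξ * η ^ 2)
          - (S ξ - ℓ * ξ + a ξ * η ^ 2 * (c * r ξ ^ 2 - ℓ)) := by
      norm_num; ring
    rw [e, Real.norm_eq_abs, Real.norm_eq_abs, abs_of_nonneg (show 0 ≤ η ^ 4 by positivity)]
    refine h1.trans_eq ?_
    rw [mul_pow, sq_abs]
    ring

/-! ### Uniqueness of the coefficient `Z₁` -/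

/-- Taylor expansion in the second variable, uniform in the first one. -/
theorem exists_taylor_strip {ε : ℝ} (hε : 0 < ε) (n : ℕ) : ∀ {F : ℝ × ℝ → ℝ},
    ContDiffOn ℝ ∞ F (univ ×ˢ Ioo (-ε) ε) → (∀ x, ∀ t ∈ Ioo (-ε) ε, F (x + 1, t) = F (x, t)) →
    ∃ c : ℕ → ℝ → ℝ, (∀ j < n, SmoothPeriodic (c j)) ∧ ∃ C, ∀ x t, |t| ≤ ε / 2 →
      |F (x, t) - ∑ j ∈ Finset.range n, c j x * t ^ j| ≤ C * |t| ^ n := by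
  have hU : IsOpen ((univ : Set ℝ) ×ˢ Ioo (-ε) ε) := isOpen_univ.prod isOpen_Ioo
  have hsub : ∀ t : ℝ, |t| ≤ ε / 2 → t ∈ Ioo (-ε) ε := fun t ht => by
    rw [abs_le] at ht
    constructor <;> linarith [ht.1, ht.2]
  have h0ε : (0 : ℝ) ∈ Ioo (-ε) ε := ⟨by linarith, hε⟩
  induction n with
  | zero =>
    intro F hF hper
    refine ⟨fun _ _ => 0, fun j hj => absurd hj (by omega), ?_⟩
    obtain ⟨C, hC⟩ := ((isCompact_Icc (a := (0 : ℝ)) (b := 1)).prod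
      (isCompact_Icc (a := -(ε / 2)) (b := ε / 2))).exists_bound_of_continuousOn
      (hF.continuousOn.mono (prod_mono (subset_univ _) fun t ht => hsub t (abs_le.2 ht)))
    refine ⟨C, fun x t ht => ?_⟩
    have hp : Function.Periodic (fun x => F (x, t)) 1 := fun x => hper x t (hsub t ht)
    obtain ⟨y, hy, hxy⟩ := hp.exists_mem_Ico₀ one_pos x
    have := hC (y, t) ⟨Ico_subset_Icc_self hy, abs_le.1 ht⟩
    have hxy' : F (x, t) = F (y, t) := hxy
    simpa [hxy'] using this
  | succ n ih =>
    intro F hF hper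
    -- The induction hypothesis is applied to the partial derivative in `t` and integrated, which
    -- turns the coefficient `d j` into `d j / (j + 1)` one order higher.
    obtain ⟨G, hG⟩ : ∃ G : ℝ × ℝ → ℝ, G = fun p => deriv (fun t => F (p.1, t)) p.2 := ⟨_, rfl⟩
    have hd : ∀ x, ∀ t ∈ Ioo (-ε) ε,
        HasDerivAt (fun t => F (x, t)) (fderiv ℝ F (x, t) (0, 1)) t := fun x t ht => by
      have h1 : HasFDerivAt F (fderiv ℝ F (x, t)) (x, t) :=
        ((hF.contDiffAt (hU.mem_nhds ⟨trivial, ht⟩)).differentiableAt (by simp)).hasFDerivAt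
      exact h1.comp_hasDerivAt t ((hasDerivAt_const t x).prodMk (hasDerivAt_id t))
    have hGd : ∀ x, ∀ t ∈ Ioo (-ε) ε, HasDerivAt (fun t => F (x, t)) (G (x, t)) t :=
      fun x t ht => by rw [hG]; exact (hd x t ht).differentiableAt.hasDerivAt
    have hGs : ContDiffOn ℝ ∞ G (univ ×ˢ Ioo (-ε) ε) := by
      have h1 : ContDiffOn ℝ ∞ (fderiv ℝ F) (univ ×ˢ Ioo (-ε) ε) :=
        hF.fderiv_of_isOpen hU (by simp)
      refine (h1.clm_apply (contDiffOn_const (c := ((0 : ℝ), (1 : ℝ))))).congr ?_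
      rintro ⟨x, t⟩ ⟨-, ht⟩
      exact (hGd x t ht).unique (hd x t ht)
    have hGp : ∀ x, ∀ t ∈ Ioo (-ε) ε, G (x + 1, t) = G (x, t) := fun x t ht => by
      rw [hG]
      refine EventuallyEq.deriv_eq ?_
      filter_upwards [isOpen_Ioo.mem_nhds ht] with u hu using hper x u hu
    obtain ⟨d, hds, C, hC⟩ := ih hGs hGp
    refine ⟨fun j => if j = 0 then fun x => F (x, 0) else fun x => d (j - 1) x / j, ?_, C,
      fun x h hh => ?_⟩
    · intro j hj
      rcases Nat.eq_zero_or_pos j with rfl | h0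
      · refine ⟨?_, fun x => hper x 0 h0ε⟩
        simp only [if_true]
        rw [← contDiffOn_univ]
        exact hF.comp (contDiff_id.prodMk contDiff_const).contDiffOn fun x _ => ⟨trivial, h0ε⟩
      · simp only [h0.ne', if_false]
        exact (hds (j - 1) (by omega)).div (smoothPeriodic_const (j : ℝ)) fun _ => by
          exact_mod_cast h0.ne'
    · obtain ⟨R, hR⟩ : ∃ R : ℝ → ℝ, R = fun t => F (x, t) - (F (x, 0)
        + ∑ j ∈ Finset.range n, d j x / ((j : ℝ) + 1) * t ^ (j + 1)) := ⟨_, rfl⟩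
      have hRd : ∀ t ∈ Ioo (-ε) ε,
          HasDerivAt R (G (x, t) - ∑ j ∈ Finset.range n, d j x * t ^ j) t := by
        intro t ht
        rw [hR]
        have h1 := (hGd x t ht).sub ((HasDerivAt.fun_sum (u := Finset.range n) fun j _ =>
          (hasDerivAt_pow (j + 1) t).const_mul (d j x / ((j : ℝ) + 1))).const_add (F (x, 0)))
        refine h1.congr_deriv ?_
        congr 1
        refine Finset.sum_congr rfl fun j _ => ?_
        have : (j : ℝ) + 1 ≠ 0 := by positivity
        push_cast
        field_simp
      have habs : ∀ t ∈ uIcc 0 h, |t| ≤ |h| := fun t ht => by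
        simpa using abs_sub_left_of_mem_uIcc ht
      have hC0 : 0 ≤ C * |h| ^ n := (abs_nonneg _).trans (hC x h hh)
      have key := (convex_uIcc (0 : ℝ) h).norm_image_sub_le_of_norm_hasDerivWithin_le
        (f := R) (C := C * |h| ^ n)
        (fun t ht => (hRd t (hsub t ((habs t ht).trans hh))).hasDerivWithinAt)
        (fun t ht => (hC x t ((habs t ht).trans hh)).trans ?_) left_mem_uIcc right_mem_uIcc
      · have hR0 : R 0 = 0 := by simp [hR]
        rw [hR0, sub_zero, sub_zero, Real.norm_eq_abs, Real.norm_eq_abs, mul_assoc, ← pow_succ,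
          hR] at key
        rw [Finset.sum_range_succ']
        simpa [add_comm] using key
      · have hCn : 0 ≤ C := by
          have := (abs_nonneg _).trans (hC x (ε / 2) (by rw [abs_of_pos]; linarith))
          exact nonneg_of_mul_nonneg_left this (by positivity)
        have := habs t ht
        gcongr

/-- The expansion of an angular function in the Lazutkin parameter. -/
theorem LazutkinChart.exists_angular_expansion (H : LazutkinChart ℓ γ c r S) {k : ℕ} {ε : ℝ}
    (hε : 0 < ε) {Z : ℝ → ℝ → ℝ} (hZ : IsAngularFunction ℓ γ k ε Z) :
    ∃ c₀ c₂ c₄ : ℝ → ℝ, SmoothPeriodic c₀ ∧ SmoothPeriodic c₂ ∧ SmoothPeriodic c₄ ∧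
      c₀ 0 = 0 ∧ c₂ 0 = 0 ∧ (∀ x, lazutkinParam ℓ γ (Z x 0) = x + c₀ x) ∧
      ∃ R : ℝ × ℝ → ℝ, Bdd stripFilter R ∧ ∀ x t, t ≠ 0 → lazutkinParam ℓ γ (Z x t)
        = x + c₀ x + c₂ x * t ^ 2 + c₄ x * t ^ 4 + t ^ 5 * R (x, t) := by
  obtain ⟨F, hF⟩ : ∃ F : ℝ × ℝ → ℝ, F = fun p => lazutkinParam ℓ γ (Z p.1 p.2) - p.1 := ⟨_, rfl⟩
  obtain ⟨d, hd, C, hC⟩ := exists_taylor_strip hε 5 (F := F)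
    (by rw [hF]; exact (H.smooth_param.comp_contDiffOn hZ.smooth).sub contDiff_fst.contDiffOn)
    (fun x t ht => by rw [hF]; simp only [hZ.degree x t ht, H.param_add]; ring)
  have hev : ∀ᶠ a : ℝ × ℝ in stripFilter, |a.2| ≤ ε / 2 :=
    eventually_stripFilter.2 ⟨ε / 2, by positivity, fun _ _ _ h => h.le⟩
  obtain ⟨R, hR⟩ : ∃ R : ℝ × ℝ → ℝ, R = fun a =>
    (F a - ∑ j ∈ Finset.range 5, d j a.1 * a.2 ^ j) / a.2 ^ 5 := ⟨_, rfl⟩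
  have bR : Bdd stripFilter R := by
    rw [hR]
    refine bdd_div_pow_of_le (C := C) ?_
    filter_upwards [hev] with a ha using hC a.1 a.2 ha
  have hFR : ∀ x t, t ≠ 0 → F (x, t) = d 0 x + d 1 x * t + d 2 x * t ^ 2 + d 3 x * t ^ 3
      + d 4 x * t ^ 4 + t ^ 5 * R (x, t) := fun x t h0 => by
    rw [hR]
    simp only [Finset.sum_range_succ, Finset.range_zero, Finset.sum_empty]
    rw [mul_div_cancel₀ _ (pow_ne_zero 5 h0)]
    ring
  have hz : ∀ x, F (x, 0) = d 0 x := fun x => by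
    have := hC x 0 (by rw [abs_zero]; positivity)
    simp only [Finset.sum_range_succ, Finset.range_zero, Finset.sum_empty] at this
    norm_num at this
    linarith [sub_eq_zero.1 this]
  have hl : ∀ᶠ t : ℝ in 𝓝[>] 0, t ∈ Ioo (-ε) ε ∧ t ≠ 0 := by
    filter_upwards [Ioo_mem_nhdsGT hε] with t ht
    exact ⟨⟨by linarith [ht.1], ht.2⟩, ht.1.ne'⟩
  -- Evenness in `η`, read off by comparing the expansions at `t` and `-t`.
  have hodd : ∀ x, d 1 x = 0 ∧ d 3 x = 0 := fun x => by
    have := coeff_eq_zero_of_bdd (c₁ := 2 * d 1 x) (c₂ := 0) (c₃ := 2 * d 3 x) (c₄ := 0)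
      ((((bR.comp tendsto_stripFilter_neg).add bR).mul (bdd_const (-1))).comp
        (tendsto_mk_stripFilter x)) (by
        filter_upwards [hl] with t ⟨ht, h0⟩
        have e1 := hFR x t h0
        have e2 := hFR x (-t) (neg_ne_zero.2 h0)
        have e3 : F (x, -t) = F (x, t) := by rw [hF]; simp only [hZ.even x t ht]
        rw [e3] at e2
        linear_combination e2 - e1)
    exact ⟨by linarith [this.1], by linarith [this.2.2.1]⟩
  have h0ε : (0 : ℝ) ∈ Ioo (-ε) ε := ⟨by linarith, hε⟩
  have hF0 : ∀ t ∈ Ioo (-ε) ε, F (0, t) = 0 := fun t ht => by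
    rw [hF]; simp only [hZ.normalized t ht, H.param_zero, sub_zero]
  have hd0 : d 0 0 = 0 := by rw [← hz, hF0 0 h0ε]
  refine ⟨d 0, d 2, d 4, hd 0 (by norm_num), hd 2 (by norm_num), hd 4 (by norm_num), hd0, ?_, ?_,
    R, bR, ?_⟩
  · have := coeff_eq_zero_of_bdd (c₁ := d 1 0) (c₂ := d 2 0) (c₃ := d 3 0) (c₄ := d 4 0)
      ((bR.mul (bdd_const (-1))).comp (tendsto_mk_stripFilter 0)) (by
        filter_upwards [hl] with t ⟨ht, h0⟩
        have e1 := hFR 0 t h0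
        rw [hF0 t ht, hd0] at e1
        linear_combination -e1)
    exact this.2.1
  · intro x
    rw [← hz x, hF]
    ring
  · intro x t h0
    have e := hFR x t h0
    rw [(hodd x).1, (hodd x).2, hF] at e
    simp only at e
    linear_combination e

/-- The reflection law along an angular function. -/
theorem LazutkinChart.exists_angular_reflection (H : LazutkinChart ℓ γ c r S) {k : ℕ} (hk : 2 ≤ k)
    {ε : ℝ} {Z : ℝ → ℝ → ℝ} (hZ : IsAngularFunction ℓ γ k ε Z) :
    ∃ C > 0, ∃ δ > 0, ∀ ξ t x p m M, x = lazutkinParam ℓ γ (Z ξ t) →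
      p = lazutkinParam ℓ γ (Z (ξ + t) t) - x → m = x - lazutkinParam ℓ γ (Z (ξ - t) t) →
      0 < t → t < δ → p ≤ M → m ≤ M → M < δ → 0 < p ∧ 0 < m ∧
        |(p - m) + deriv (potential c r) x * (p ^ 4 + m ^ 4)|
          ≤ C * (t ^ 6 + M ^ 2 * |p - m| + M ^ 6) := by
  obtain ⟨A₁, A₃, A₅, hA⟩ := H.exists_angleExpansion
  obtain ⟨C₁, hC₁, d₁, hd₁, hrefl⟩ := hA.exists_reflection_bound
  obtain ⟨d₂, hd₂, hdef⟩ := H.exists_collisionDefect_eq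
  obtain ⟨d₃, hd₃, hdε, C₃, hcol⟩ := hZ.pseudocollision
  obtain ⟨κ, hκ, hκ'⟩ := hA.smooth₁.exists_pos_le hA.pos
  refine ⟨(C₁ + |C₃|) / κ, by positivity, min 1 (min d₁ (min d₂ d₃)), by positivity,
    fun ξ t x p m M hx hp hm h0 ht hpM hmM hM => ?_⟩
  have n1 := ht.trans_le (min_le_left _ _)
  have n2 := ht.trans_le ((min_le_right _ _).trans ((min_le_right _ _).trans (min_le_right _ _)))
  have M1 := hM.trans_le ((min_le_right _ _).trans (min_le_left _ _))
  have M2 := hM.trans_le ((min_le_right _ _).trans ((min_le_right _ _).trans (min_le_left _ _)))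
  have hmono : StrictMono fun x => Z x t :=
    strictMono_of_deriv_pos fun x => hZ.deriv_pos x t ⟨by linarith, by linarith⟩
  have p0 : 0 < p := by
    rw [hp, hx, sub_pos]; exact H.strictMono_param (hmono (by linarith))
  have m0 : 0 < m := by
    rw [hm, hx, sub_pos]; exact H.strictMono_param (hmono (by linarith))
  refine ⟨p0, m0, ?_⟩
  have s0 : S x = Z ξ t := by rw [hx, H.apply_param]
  have s1 : S (x + p) = Z (ξ + t) t := by rw [hp, add_sub_cancel, H.apply_param]
  have s2 : S (x - m) = Z (ξ - t) t := by rw [hm, sub_sub_cancel, H.apply_param]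
  have e1 := hcol ξ t (abs_pos.2 h0.ne') (by rwa [abs_of_pos h0])
  rw [← s0, ← s1, ← s2, hdef x p m p0 (by linarith) m0 (by linarith), abs_of_pos h0] at e1
  have e2 := hrefl x p m M p0 m0 hpM hmM M1
  have e3 : C₃ * t ^ (2 * k + 2) ≤ |C₃| * t ^ 6 := by
    have : t ^ (2 * k + 2) ≤ t ^ 6 := pow_le_pow_of_le_one h0.le n1.le (by omega)
    exact mul_le_mul (le_abs_self _) this (by positivity) (abs_nonneg _)
  obtain ⟨D, hD⟩ : ∃ D, D = (p - m) + deriv (potential c r) x * (p ^ 4 + m ^ 4) := ⟨_, rfl⟩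
  rw [← hD] at e2 ⊢
  have e4 : κ * |D| ≤ C₁ * (M ^ 2 * |p - m| + M ^ 6) + |C₃| * t ^ 6 := by
    have f1 : |A₁ x * D| ≤ C₁ * (M ^ 2 * |p - m| + M ^ 6) + |C₃| * t ^ 6 := by
      have := abs_sub (chordAngle (fun x => γ (S x)) (fun x => deriv γ (S x)) x p
        + chordAngle (fun x => γ (S x)) (fun x => deriv γ (S x)) x (-m))
        (chordAngle (fun x => γ (S x)) (fun x => deriv γ (S x)) x p
        + chordAngle (fun x => γ (S x)) (fun x => deriv γ (S x)) x (-m) - A₁ x * D)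
      rw [sub_sub_cancel] at this
      linarith
    rw [abs_mul, abs_of_pos (hA.pos x)] at f1
    exact le_trans (by have := hκ' x; gcongr) f1
  rw [div_mul_eq_mul_div, le_div_iff₀ hκ]
  have q1 : 0 ≤ M ^ 2 * |p - m| := by positivity
  have q2 : 0 ≤ M ^ 6 := by positivity
  have q3 : 0 ≤ t ^ 6 := by positivity
  nlinarith [mul_nonneg (abs_nonneg C₃) q1, mul_nonneg (abs_nonneg C₃) q2, mul_nonneg hC₁.le q3]

theorem tendsto_stripFilter_add_mul (s : ℝ) :
    Tendsto (fun a : ℝ × ℝ => (a.1 + s * a.2, a.2)) stripFilter stripFilter :=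
  tendsto_stripFilter_of_le (C := 1) (by
    filter_upwards [eventually_snd_ne_zero] with a ha
    simpa using ha)

section Expansion

variable {U : ℝ → ℝ → ℝ} {c₀ c₂ c₄ : ℝ → ℝ} {R : ℝ × ℝ → ℝ}

/-- Second differences of a function with an even expansion. -/
theorem exists_second_difference_eq (h₀ : SmoothPeriodic c₀) (h₂ : SmoothPeriodic c₂)
    (h₄ : SmoothPeriodic c₄) (hR : Bdd stripFilter R) (hU : ∀ x t, t ≠ 0 →
      U x t = x + c₀ x + c₂ x * t ^ 2 + c₄ x * t ^ 4 + t ^ 5 * R (x, t)) :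
    ∃ Q : ℝ × ℝ → ℝ, Bdd stripFilter Q ∧ ∀ x t, t ≠ 0 →
      U (x + t) t - U x t - (U x t - U (x - t) t) = deriv (deriv c₀) x * t ^ 2
        + (iteratedDeriv 4 c₀ x / 12 + deriv (deriv c₂) x) * t ^ 4 + t ^ 5 * Q (x, t) := by
  obtain ⟨R₀, b₀, e₀⟩ := h₀.exists_taylor_eq 5
  obtain ⟨R₂, b₂, e₂⟩ := h₂.exists_taylor_eq 3
  obtain ⟨R₄, b₄, e₄⟩ := h₄.exists_taylor_eq 1
  have b₀' := b₀.comp tendsto_stripFilter_neg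
  have b₂' := b₂.comp tendsto_stripFilter_neg
  have b₄' := b₄.comp tendsto_stripFilter_neg
  have bp := hR.comp (tendsto_stripFilter_add_mul 1)
  have bm := hR.comp (tendsto_stripFilter_add_mul (-1))
  refine ⟨fun a => R₀ a - R₀ (a.1, -a.2) + (R₂ a - R₂ (a.1, -a.2)) + (R₄ a - R₄ (a.1, -a.2))
    + (R (a.1 + 1 * a.2, a.2) + R (a.1 + -1 * a.2, a.2) - (R a + R a)), ?_, fun x t h0 => ?_⟩
  · repeat' first | with_reducible assumption | with_reducible apply Bdd.add |
      with_reducible apply Bdd.sub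
  · have f0 := e₀ x t h0
    have f0' := e₀ x (-t) (neg_ne_zero.2 h0)
    have f2 := e₂ x t h0
    have f2' := e₂ x (-t) (neg_ne_zero.2 h0)
    have f4 := e₄ x t h0
    have f4' := e₄ x (-t) (neg_ne_zero.2 h0)
    rw [← sub_eq_add_neg] at f0' f2' f4'
    simp only [Finset.sum_range_succ, Finset.range_zero, Finset.sum_empty, iteratedDeriv_zero,
      iteratedDeriv_one, pow_zero, Nat.factorial] at f0 f0' f2 f2' f4 f4'
    have g : ∀ f : ℝ → ℝ, iteratedDeriv 2 f x = deriv (deriv f) x := fun f => by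
      rw [iteratedDeriv_succ, iteratedDeriv_one]
    rw [g] at f0 f0' f2 f2'
    rw [hU x t h0, hU (x + t) t h0, hU (x - t) t h0, f0, f0', f2, f2', f4, f4']
    push_cast
    simp only [one_mul, neg_one_mul, ← sub_eq_add_neg]
    ring

/-- First differences of a function with an even expansion. -/
theorem exists_first_difference_eq (h₂ : SmoothPeriodic c₂)
    (h₄ : SmoothPeriodic c₄) (hR : Bdd stripFilter R) (hU : ∀ x t, t ≠ 0 →
      U x t = x + c₀ x + c₂ x * t ^ 2 + c₄ x * t ^ 4 + t ^ 5 * R (x, t)) :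
    ∃ P M : ℝ × ℝ → ℝ, Bdd stripFilter P ∧ Bdd stripFilter M ∧ ∀ x t, t ≠ 0 →
      U (x + t) t - U x t = t + (c₀ (x + t) - c₀ x) + t ^ 2 * P (x, t) ∧
      U x t - U (x - t) t = t + (c₀ x - c₀ (x - t)) + t ^ 2 * M (x, t) := by
  have bp := hR.comp (tendsto_stripFilter_add_mul 1)
  have bm := hR.comp (tendsto_stripFilter_add_mul (-1))
  have bh := bdd_snd
  have k2 := h₂.bdd_fst
  have k4 := h₄.bdd_fst
  have k2p : Bdd stripFilter fun a => c₂ (a.1 + a.2) := h₂.bdd_comp _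
  have k4p : Bdd stripFilter fun a => c₄ (a.1 + a.2) := h₄.bdd_comp _
  have k2m : Bdd stripFilter fun a => c₂ (a.1 - a.2) := h₂.bdd_comp _
  have k4m : Bdd stripFilter fun a => c₄ (a.1 - a.2) := h₄.bdd_comp _
  refine ⟨fun a => (c₂ (a.1 + a.2) - c₂ a.1) + (c₄ (a.1 + a.2) - c₄ a.1) * a.2 ^ 2
      + a.2 ^ 3 * (R (a.1 + 1 * a.2, a.2) - R a),
    fun a => (c₂ a.1 - c₂ (a.1 - a.2)) + (c₄ a.1 - c₄ (a.1 - a.2)) * a.2 ^ 2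
      + a.2 ^ 3 * (R a - R (a.1 + -1 * a.2, a.2)), ?_, ?_, fun x t h0 => ⟨?_, ?_⟩⟩
  · repeat' first | with_reducible assumption | apply Bdd.pow | with_reducible apply Bdd.add |
      with_reducible apply Bdd.sub | with_reducible apply Bdd.mul
  · repeat' first | with_reducible assumption | apply Bdd.pow | with_reducible apply Bdd.add |
      with_reducible apply Bdd.sub | with_reducible apply Bdd.mul
  · rw [hU x t h0, hU (x + t) t h0]
    simp only [one_mul]
    ring
  · rw [hU x t h0, hU (x - t) t h0]
    simp only [neg_one_mul, ← sub_eq_add_neg]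
    ring

variable {B : ℝ → ℝ} {C δ : ℝ}

/-- The crude bounds `p, m ≤ K t` already make the second difference `O(t³)`, while its leading term
is `c₀'' t²`. Only once `c₀` is known to vanish can the next order be read. -/
theorem deriv_deriv_eq_zero_of_reflection (h₀ : SmoothPeriodic c₀) (h₂ : SmoothPeriodic c₂)
    (h₄ : SmoothPeriodic c₄) (hB : SmoothPeriodic B) (hR : Bdd stripFilter R) (hU : ∀ x t, t ≠ 0 →
      U x t = x + c₀ x + c₂ x * t ^ 2 + c₄ x * t ^ 4 + t ^ 5 * R (x, t)) (hC : 0 < C) (hδ : 0 < δ)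
    (hrefl : ∀ ξ t x p m M, x = U ξ t → p = U (ξ + t) t - x → m = x - U (ξ - t) t →
      0 < t → t < δ → p ≤ M → m ≤ M → M < δ → 0 < p ∧ 0 < m ∧
        |(p - m) + deriv B x * (p ^ 4 + m ^ 4)| ≤ C * (t ^ 6 + M ^ 2 * |p - m| + M ^ 6)) (ξ : ℝ) :
    deriv (deriv c₀) ξ = 0 := by
  obtain ⟨Q, bQ, hQ⟩ := exists_second_difference_eq h₀ h₂ h₄ hR hU
  obtain ⟨P, N, bP, bN, hPN⟩ := exists_first_difference_eq h₂ h₄ hR hU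
  obtain ⟨K₀, hK₀, l₀⟩ := h₀.exists_lipschitz
  obtain ⟨b, hb, mb⟩ := hB.deriv.bounded
  obtain ⟨C₁, hC₁, d₁, hd₁, k₁⟩ := bP.exists_bound
  obtain ⟨C₂, hC₂, d₂, hd₂, k₂⟩ := bN.exists_bound
  obtain ⟨K, hK⟩ : ∃ K, K = 1 + K₀ + C₁ + C₂ := ⟨_, rfl⟩
  have hK0 : 0 < K := by rw [hK]; positivity
  obtain ⟨τ, hτ, hτ1, hτδ, hτK, hτ₁, hτ₂⟩ :
      ∃ τ > 0, τ ≤ 1 ∧ τ ≤ δ ∧ K * τ ≤ δ ∧ τ ≤ d₁ ∧ τ ≤ d₂ := by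
    refine ⟨min 1 (min δ (min (δ / K) (min d₁ d₂))), by positivity, min_le_left _ _, ?_, ?_, ?_, ?_⟩
    · exact (min_le_right _ _).trans (min_le_left _ _)
    · rw [mul_comm, ← le_div_iff₀ hK0]
      exact (min_le_right _ _).trans ((min_le_right _ _).trans (min_le_left _ _))
    · exact (min_le_right _ _).trans ((min_le_right _ _).trans ((min_le_right _ _).trans
        (min_le_left _ _)))
    · exact (min_le_right _ _).trans ((min_le_right _ _).trans ((min_le_right _ _).trans
        (min_le_right _ _)))
  have hΔ : ∀ t, 0 < t → t < τ → |U (ξ + t) t - U ξ t - (U ξ t - U (ξ - t) t)|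
      ≤ (C * (1 + K ^ 3 + K ^ 6) + 2 * b * K ^ 4) * t ^ 3 := by
    intro t h0 ht
    obtain ⟨e1, e2⟩ := hPN ξ t h0.ne'
    obtain ⟨p, hp⟩ : ∃ p, p = U (ξ + t) t - U ξ t := ⟨_, rfl⟩
    obtain ⟨m, hm⟩ : ∃ m, m = U ξ t - U (ξ - t) t := ⟨_, rfl⟩
    have t2 : t ^ 2 ≤ t := by nlinarith
    have pK : p ≤ K * t := by
      have a1 := (le_abs_self _).trans (l₀ (ξ + t) ξ)
      rw [add_sub_cancel_left, abs_of_pos h0] at a1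
      have a2 : t ^ 2 * P (ξ, t) ≤ t * C₁ :=
        (mul_le_mul_of_nonneg_left ((le_abs_self _).trans
          (k₁ ξ t h0.ne' (by rw [abs_of_pos h0]; linarith)))
          (by positivity)).trans (by gcongr)
      rw [hp, e1, hK]
      nlinarith
    have mK : m ≤ K * t := by
      have a1 := (le_abs_self _).trans (l₀ ξ (ξ - t))
      rw [sub_sub_cancel, abs_of_pos h0] at a1
      have a2 : t ^ 2 * N (ξ, t) ≤ t * C₂ :=
        (mul_le_mul_of_nonneg_left ((le_abs_self _).trans
          (k₂ ξ t h0.ne' (by rw [abs_of_pos h0]; linarith)))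
          (by positivity)).trans (by gcongr)
      rw [hm, e2, hK]
      nlinarith
    obtain ⟨p0, m0, hr⟩ := hrefl ξ t _ p m (K * t) rfl hp hm h0 (by linarith) pK mK (by
      calc K * t < K * τ := by gcongr
        _ ≤ δ := hτK)
    rw [← hp, ← hm]
    have a1 : |p - m| ≤ K * t := abs_le.2 ⟨by linarith, by linarith⟩
    have a2 : |deriv B (U ξ t) * (p ^ 4 + m ^ 4)| ≤ b * (2 * (K * t) ^ 4) := by
      rw [abs_mul, abs_of_pos (show 0 < p ^ 4 + m ^ 4 by positivity)]
      have e1 : p ^ 4 ≤ (K * t) ^ 4 := by gcongr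
      have e2 : m ^ 4 ≤ (K * t) ^ 4 := by gcongr
      exact mul_le_mul (mb _) (by linarith) (by positivity) hb.le
    have a3 := abs_sub ((p - m) + deriv B (U ξ t) * (p ^ 4 + m ^ 4))
      (deriv B (U ξ t) * (p ^ 4 + m ^ 4))
    rw [add_sub_cancel_right] at a3
    have t6 : t ^ 6 ≤ t ^ 3 := pow_le_pow_of_le_one h0.le (by linarith) (by norm_num)
    have t4 : t ^ 4 ≤ t ^ 3 := pow_le_pow_of_le_one h0.le (by linarith) (by norm_num)
    calc |p - m| ≤ C * (t ^ 6 + (K * t) ^ 2 * |p - m| + (K * t) ^ 6) + b * (2 * (K * t) ^ 4) := by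
          linarith
      _ ≤ C * (t ^ 6 + (K * t) ^ 2 * (K * t) + (K * t) ^ 6) + b * (2 * (K * t) ^ 4) := by gcongr
      _ = C * (t ^ 6 + K ^ 3 * t ^ 3 + K ^ 6 * t ^ 6) + 2 * b * K ^ 4 * t ^ 4 := by ring
      _ ≤ C * (t ^ 3 + K ^ 3 * t ^ 3 + K ^ 6 * t ^ 3) + 2 * b * K ^ 4 * t ^ 3 := by gcongr
      _ = _ := by ring
  have bΔ : Bdd (𝓝[>] 0) fun t => (U (ξ + t) t - U ξ t - (U ξ t - U (ξ - t) t)) / t ^ 3 := by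
    refine bdd_of_le (C := C * (1 + K ^ 3 + K ^ 6) + 2 * b * K ^ 4) ?_
    filter_upwards [Ioo_mem_nhdsGT hτ] with t ht
    rw [abs_div, abs_of_pos (pow_pos ht.1 3), div_le_iff₀ (pow_pos ht.1 3)]
    exact hΔ t ht.1 ht.2
  have bh := bdd_snd.comp (tendsto_mk_stripFilter ξ)
  have bQ' := bQ.comp (tendsto_mk_stripFilter ξ)
  -- The identity is multiplied by `t²` so that the coefficient of `t²` occupies the slot of `t⁴`.
  have := coeff_eq_zero_of_bdd (c₁ := 0) (c₂ := 0) (c₃ := 0) (c₄ := deriv (deriv c₀) ξ)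
    (R := fun t => (U (ξ + t) t - U ξ t - (U ξ t - U (ξ - t) t)) / t ^ 3
      - (iteratedDeriv 4 c₀ ξ / 12 + deriv (deriv c₂) ξ) * t - t ^ 2 * Q (ξ, t))
    ((bΔ.sub ((bdd_const _).mul bh)).sub ((bh.pow 2).mul bQ')) (by
      filter_upwards [self_mem_nhdsWithin] with t ht
      have h0 : t ≠ 0 := ne_of_gt ht
      rw [hQ ξ t h0]
      field_simp
      ring)
  exact this.2.2.2

/-- Once `c₀ = 0`, the gaps are `t + O(t²)`, so `p - m = c₂'' t⁴ + O(t⁵)` and `p⁴ + m⁴ = 2 t⁴ +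
O(t⁵)`; the `t⁴` coefficient of the reflection law must vanish. -/
theorem deriv_deriv_eq_of_reflection (h₂ : SmoothPeriodic c₂)
    (h₄ : SmoothPeriodic c₄) (hB : SmoothPeriodic B) (hR : Bdd stripFilter R) (hU : ∀ x t, t ≠ 0 →
      U x t = x + c₂ x * t ^ 2 + c₄ x * t ^ 4 + t ^ 5 * R (x, t)) (hC : 0 < C) (hδ : 0 < δ)
    (hrefl : ∀ ξ t x p m M, x = U ξ t → p = U (ξ + t) t - x → m = x - U (ξ - t) t →
      0 < t → t < δ → p ≤ M → m ≤ M → M < δ → 0 < p ∧ 0 < m ∧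
        |(p - m) + deriv B x * (p ^ 4 + m ^ 4)| ≤ C * (t ^ 6 + M ^ 2 * |p - m| + M ^ 6)) (ξ : ℝ) :
    deriv (deriv c₂) ξ = -2 * deriv B ξ := by
  have hU' : ∀ x t, t ≠ 0 → U x t = x + (fun _ : ℝ => (0 : ℝ)) x + c₂ x * t ^ 2 + c₄ x * t ^ 4
      + t ^ 5 * R (x, t) := fun x t h0 => by rw [hU x t h0]; ring
  obtain ⟨Q, bQ, hQ⟩ := exists_second_difference_eq (smoothPeriodic_const 0) h₂ h₄ hR hU'
  obtain ⟨P, N, bP, bN, hPN⟩ := exists_first_difference_eq h₂ h₄ hR hU'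
  obtain ⟨Lb, hLb, lb⟩ := hB.deriv.exists_lipschitz
  have bh := bdd_snd
  have k2 := h₂.bdd_fst
  have k4 := h₄.bdd_fst
  obtain ⟨V, hV⟩ : ∃ V : ℝ × ℝ → ℝ, V = fun a => (deriv B (U a.1 a.2) - deriv B a.1) / a.2 ^ 1 :=
    ⟨_, rfl⟩
  have bV : Bdd stripFilter V := by
    have b1 : Bdd stripFilter fun a => c₂ a.1 * a.2 + c₄ a.1 * a.2 ^ 3 + a.2 ^ 4 * R a := by
      repeat' first | with_reducible assumption | apply Bdd.pow | with_reducible apply Bdd.add |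
        with_reducible apply Bdd.mul
    obtain ⟨C', -, δ', hδ', hb⟩ := b1.exists_bound
    rw [hV]
    refine bdd_div_pow_of_le (C := Lb * C')
      (eventually_stripFilter.2 ⟨δ', hδ', fun x t h0 ht => ?_⟩)
    refine (lb _ _).trans ?_
    have e : U x t - x = t * (c₂ x * t + c₄ x * t ^ 3 + t ^ 4 * R (x, t)) := by
      rw [hU x t h0]; ring
    simp only
    rw [e, abs_mul, mul_assoc, pow_one, mul_comm C']
    gcongr
    exact hb x t h0 ht
  obtain ⟨C₁, hC₁, d₁, hd₁, k₁⟩ := bP.exists_bound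
  obtain ⟨C₂, hC₂, d₂, hd₂, k₂⟩ := bN.exists_bound
  obtain ⟨C₃, hC₃, d₃, hd₃, k₃⟩ := bQ.exists_bound
  obtain ⟨b, hb, mb⟩ := h₂.deriv.deriv.bounded
  obtain ⟨K, hK⟩ : ∃ K, K = 1 + C₁ + C₂ := ⟨_, rfl⟩
  have hK0 : 0 < K := by rw [hK]; positivity
  obtain ⟨τ, hτ, hτ1, hτδ, hτK, hτ₁, hτ₂, hτ₃⟩ :
      ∃ τ > 0, τ ≤ 1 ∧ τ ≤ δ ∧ K * τ ≤ δ ∧ τ ≤ d₁ ∧ τ ≤ d₂ ∧ τ ≤ d₃ := by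
    refine ⟨min 1 (min δ (min (δ / K) (min d₁ (min d₂ d₃)))), by positivity, min_le_left _ _,
      ?_, ?_, ?_, ?_, ?_⟩
    · exact (min_le_right _ _).trans (min_le_left _ _)
    · rw [mul_comm, ← le_div_iff₀ hK0]
      exact (min_le_right _ _).trans ((min_le_right _ _).trans (min_le_left _ _))
    · exact (min_le_right _ _).trans ((min_le_right _ _).trans ((min_le_right _ _).trans
        (min_le_left _ _)))
    · exact (min_le_right _ _).trans ((min_le_right _ _).trans ((min_le_right _ _).trans
        ((min_le_right _ _).trans (min_le_left _ _))))
    · exact (min_le_right _ _).trans ((min_le_right _ _).trans ((min_le_right _ _).trans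
        ((min_le_right _ _).trans (min_le_right _ _))))
  have hE : ∀ t, 0 < t → t < τ → |U (ξ + t) t - U ξ t - (U ξ t - U (ξ - t) t)
      + deriv B (U ξ t) * ((U (ξ + t) t - U ξ t) ^ 4 + (U ξ t - U (ξ - t) t) ^ 4)|
      ≤ C * (1 + K ^ 2 * (b + C₃) + K ^ 6) * t ^ 5 := by
    intro t h0 ht
    obtain ⟨e1, e2⟩ := hPN ξ t h0.ne'
    have hq := hQ ξ t h0.ne'
    obtain ⟨p, hp⟩ : ∃ p, p = U (ξ + t) t - U ξ t := ⟨_, rfl⟩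
    obtain ⟨m, hm⟩ : ∃ m, m = U ξ t - U (ξ - t) t := ⟨_, rfl⟩
    have habs : |t| = t := abs_of_pos h0
    have t2 : t ^ 2 ≤ t := by nlinarith
    have pK : p ≤ K * t := by
      have a2 : t ^ 2 * P (ξ, t) ≤ t * C₁ :=
        (mul_le_mul_of_nonneg_left ((le_abs_self _).trans (k₁ ξ t h0.ne' (by linarith)))
          (by positivity)).trans (by gcongr)
      rw [hp, e1, hK]
      nlinarith
    have mK : m ≤ K * t := by
      have a2 : t ^ 2 * N (ξ, t) ≤ t * C₂ :=
        (mul_le_mul_of_nonneg_left ((le_abs_self _).trans (k₂ ξ t h0.ne' (by linarith)))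
          (by positivity)).trans (by gcongr)
      rw [hm, e2, hK]
      nlinarith
    obtain ⟨-, -, hr⟩ := hrefl ξ t _ p m (K * t) rfl hp hm h0 (by linarith) pK mK (by
      calc K * t < K * τ := by gcongr
        _ ≤ δ := hτK)
    rw [← hp, ← hm] at hq ⊢
    have t6 : t ^ 6 ≤ t ^ 5 := pow_le_pow_of_le_one h0.le (by linarith) (by norm_num)
    have t5 : t ^ 5 ≤ t ^ 4 := pow_le_pow_of_le_one h0.le (by linarith) (by norm_num)
    -- This improved bound is what makes the error term `M² |p - m|` of order `t⁶`.
    have a1 : |p - m| ≤ (b + C₃) * t ^ 4 := by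
      have z1 : deriv (deriv fun _ : ℝ => (0 : ℝ)) ξ = 0 := by simp
      have z2 : iteratedDeriv 4 (fun _ : ℝ => (0 : ℝ)) ξ = 0 := by simp
      rw [hq, z1, z2]
      have f1 := mb ξ
      rw [Real.norm_eq_abs] at f1
      have f2 := k₃ ξ t h0.ne' (by linarith)
      calc _ = |deriv (deriv c₂) ξ * t ^ 4 + t ^ 5 * Q (ξ, t)| := by congr 1; ring
        _ ≤ |deriv (deriv c₂) ξ| * t ^ 4 + t ^ 5 * |Q (ξ, t)| := by
          refine (abs_add_le _ _).trans_eq ?_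
          rw [abs_mul, abs_mul, abs_of_pos (pow_pos h0 4), abs_of_pos (pow_pos h0 5)]
        _ ≤ b * t ^ 4 + t ^ 4 * C₃ := by gcongr
        _ = _ := by ring
    calc _ ≤ C * (t ^ 6 + (K * t) ^ 2 * |p - m| + (K * t) ^ 6) := hr
      _ ≤ C * (t ^ 6 + (K * t) ^ 2 * ((b + C₃) * t ^ 4) + (K * t) ^ 6) := by gcongr
      _ = C * (1 + K ^ 2 * (b + C₃) + K ^ 6) * t ^ 6 := by ring
      _ ≤ _ := by gcongr
  have bE : Bdd (𝓝[>] 0) fun t => (U (ξ + t) t - U ξ t - (U ξ t - U (ξ - t) t)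
      + deriv B (U ξ t) * ((U (ξ + t) t - U ξ t) ^ 4 + (U ξ t - U (ξ - t) t) ^ 4)) / t ^ 5 := by
    refine bdd_of_le (C := C * (1 + K ^ 2 * (b + C₃) + K ^ 6)) ?_
    filter_upwards [Ioo_mem_nhdsGT hτ] with t ht
    rw [abs_div, abs_of_pos (pow_pos ht.1 5), div_le_iff₀ (pow_pos ht.1 5)]
    exact hE t ht.1 ht.2
  have hl := tendsto_mk_stripFilter ξ
  have lh := bh.comp hl
  have lQ := bQ.comp hl
  have lV := bV.comp hl
  have lP := bP.comp hl
  have lN := bN.comp hl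
  simp only at lh
  have := coeff_eq_zero_of_bdd (c₁ := 0) (c₂ := 0) (c₃ := 0)
    (c₄ := deriv (deriv c₂) ξ + 2 * deriv B ξ)
    (R := fun t => (U (ξ + t) t - U ξ t - (U ξ t - U (ξ - t) t)
      + deriv B (U ξ t) * ((U (ξ + t) t - U ξ t) ^ 4 + (U ξ t - U (ξ - t) t) ^ 4)) / t ^ 5
      - Q (ξ, t) - V (ξ, t) * ((1 + t * P (ξ, t)) ^ 4 + (1 + t * N (ξ, t)) ^ 4)
      - deriv B ξ * (P (ξ, t) * (4 + 6 * (t * P (ξ, t)) + 4 * (t * P (ξ, t)) ^ 2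
          + (t * P (ξ, t)) ^ 3) + N (ξ, t) * (4 + 6 * (t * N (ξ, t)) + 4 * (t * N (ξ, t)) ^ 2
          + (t * N (ξ, t)) ^ 3)))
    (by
      repeat' first | with_reducible assumption | with_reducible exact bdd_const _ |
        apply Bdd.pow | with_reducible apply Bdd.add | with_reducible apply Bdd.sub |
        with_reducible apply Bdd.mul) (by
      filter_upwards [self_mem_nhdsWithin] with t ht
      have h0 : t ≠ 0 := ne_of_gt ht
      obtain ⟨e1, e2⟩ := hPN ξ t h0
      have hq := hQ ξ t h0
      have z1 : deriv (deriv fun _ : ℝ => (0 : ℝ)) ξ = 0 := by simp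
      have z2 : iteratedDeriv 4 (fun _ : ℝ => (0 : ℝ)) ξ = 0 := by simp
      rw [z1, z2] at hq
      have hv : deriv B (U ξ t) = deriv B ξ + t * V (ξ, t) := by
        rw [hV]; field_simp; ring
      rw [hq, hv, e1, e2]
      field_simp
      ring)
  linarith [this.2.2.2]

end Expansion

/-- In the Lazutkin parameter the function expands as `ξ + c₂ η² + O(η⁴)` with `c₂ = a`. Composition
with `S` multiplies the `η²` coefficient by `S' = c r²`. -/
theorem LazutkinChart.eq_of_isAngularZ1 (H : LazutkinChart ℓ γ c r S) {Z₁ : ℝ → ℝ}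
    (hZ₁ : IsAngularZ1 ℓ γ Z₁) : Z₁ = fun ξ => c * r ξ ^ 2 * correction (potential c r) ξ := by
  obtain ⟨k, hk, ε, hε, Z, hZ, hexp⟩ := hZ₁
  have hB := smoothPeriodic_potential (c := c) H.curve.smooth_r H.curve.r_pos
  obtain ⟨c₀, c₂, c₄, h₀, h₂, h₄, hc₀, hc₂, hz, R, bR, hU⟩ := H.exists_angular_expansion hε hZ
  obtain ⟨C, hC, δ, hδ, hrefl⟩ := H.exists_angular_reflection hk hZ
  have hz₀ : ∀ x, c₀ x = 0 := eq_zero_of_deriv_deriv_eq_zero h₀.1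
    (deriv_deriv_eq_zero_of_reflection h₀ h₂ h₄ hB bR hU hC hδ hrefl) hc₀
    (by rw [← hc₀]; simpa using h₀.2 0)
  simp only [hz₀, add_zero] at hU hz
  have hcor : ∀ x, c₂ x = correction (potential c r) x := eq_correction hB h₂
    (deriv_deriv_eq_of_reflection h₂ h₄ hB bR hU hC hδ hrefl) hc₂
  funext ξ
  obtain ⟨g, hg⟩ : ∃ g : ℝ → ℝ, g = fun t => c₂ ξ + c₄ ξ * t ^ 2 + t ^ 3 * R (ξ, t) := ⟨_, rfl⟩
  have lh : Bdd (𝓝[>] 0) fun t : ℝ => t := bdd_snd.comp (tendsto_mk_stripFilter ξ)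
  have lR := bR.comp (tendsto_mk_stripFilter ξ)
  have bg : Bdd (𝓝[>] 0) g := by
    rw [hg]
    repeat' first | with_reducible assumption | with_reducible exact bdd_const _ |
      apply Bdd.pow | with_reducible apply Bdd.add | with_reducible apply Bdd.mul
  have hUg : ∀ t, t ≠ 0 → Z ξ t = S (ξ + t ^ 2 * g t) := fun t h0 => by
    rw [← H.apply_param (Z ξ t), hU ξ t h0, hg]
    congr 1
    ring
  have hZ0 : Z ξ 0 = S ξ := by rw [← H.apply_param (Z ξ 0), hz ξ]
  obtain ⟨C', -, ht⟩ := SmoothPeriodic.taylor 2 H.smoothPeriodic_sub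
  have hd : deriv (fun x => S x - ℓ * x) ξ = c * r ξ ^ 2 - ℓ := by
    have := (H.hasDerivAt ξ).sub ((hasDerivAt_id ξ).const_mul ℓ)
    rw [mul_one] at this
    exact this.deriv
  have hpos : ∀ᶠ t : ℝ in 𝓝[>] 0, 0 < t := self_mem_nhdsWithin
  obtain ⟨M, hM⟩ := IsBigO.bound bg
  have bS : Bdd (𝓝[>] 0) fun t => (Z ξ t - Z ξ 0 - c * r ξ ^ 2 * (t ^ 2 * g t)) / t ^ 4 := by
    refine bdd_of_le (C := |C'| * M ^ 2) ?_
    filter_upwards [hpos, hM] with t h0 hgt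
    rw [abs_div, abs_of_pos (pow_pos h0 4), div_le_iff₀ (pow_pos h0 4), hUg t h0.ne', hZ0]
    have h1 := ht ξ (t ^ 2 * g t)
    simp only [Finset.sum_range_succ, Finset.range_zero, Finset.sum_empty, iteratedDeriv_zero,
      iteratedDeriv_one, hd, smul_eq_mul, Real.norm_eq_abs] at h1
    norm_num at h1 hgt
    have e : S (ξ + t ^ 2 * g t) - S ξ - c * r ξ ^ 2 * (t ^ 2 * g t)
        = S (ξ + t ^ 2 * g t) - ℓ * (ξ + t ^ 2 * g t)
          - (S ξ - ℓ * ξ + t ^ 2 * g t * (c * r ξ ^ 2 - ℓ)) := by ring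
    rw [e]
    calc _ ≤ C' * (t ^ 2 * |g t|) ^ 2 := h1
      _ ≤ |C'| * (t ^ 2 * M) ^ 2 := by
        gcongr
        exact le_abs_self _
      _ = _ := by ring
  have bZ : Bdd (𝓝[>] 0) fun t => (Z ξ t - (Z ξ 0 + Z₁ ξ * t ^ 2)) / t ^ 4 := by
    obtain ⟨D, hD⟩ := IsBigO.bound ((hexp ξ).mono (nhdsWithin_le_nhds (s := Ioi 0)))
    refine bdd_of_le (C := D) ?_
    filter_upwards [hD, hpos] with t hDt h0
    rw [abs_div, abs_of_pos (pow_pos h0 4), div_le_iff₀ (pow_pos h0 4)]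
    simpa [abs_of_pos h0] using hDt
  -- Here the `t²` identity is multiplied by `t`, so that its coefficient occupies the slot of `t³`.
  have := coeff_eq_zero_of_bdd (c₁ := 0) (c₂ := 0) (c₃ := Z₁ ξ - c * r ξ ^ 2 * c₂ ξ) (c₄ := 0)
    (R := fun t => (Z ξ t - Z ξ 0 - c * r ξ ^ 2 * (t ^ 2 * g t)) / t ^ 4
      - (Z ξ t - (Z ξ 0 + Z₁ ξ * t ^ 2)) / t ^ 4 + c * r ξ ^ 2 * (c₄ ξ + t * R (ξ, t)))
    ((bS.sub bZ).add ((bdd_const _).mul ((bdd_const _).add (lh.mul lR)))) (by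
      filter_upwards [hpos] with t h0
      have := h0.ne'
      rw [hg]
      field_simp
      ring)
  rw [← hcor ξ]
  linarith [this.2.2.1]

end Billiard

/-! ### The three characterizations of the disc -/

theorem mainTheorem1 (Ω : Set ℂ) (ℓ : ℝ) (γ : ℝ → ℂ) (hΩ : Billiard.IsBilliardDomain Ω ℓ γ) :
    ((∃! X₁ : ℝ → ℝ, Billiard.IsLazutkinX1 ℓ γ X₁) ∧
      ∀ X₁ : ℝ → ℝ, Billiard.IsLazutkinX1 ℓ γ X₁ →
        (Billiard.IsDisc Ω ↔ ∀ s, X₁ s = 0)) ∧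
    ((∃! Z₁ : ℝ → ℝ, Billiard.IsAngularZ1 ℓ γ Z₁) ∧
      ∀ Z₁ : ℝ → ℝ, Billiard.IsAngularZ1 ℓ γ Z₁ →
        (Billiard.IsDisc Ω ↔ ∀ ξ, Z₁ ξ = 0)) ∧
    (Billiard.IsAxiallySymmetric γ →
      (∃! α : ℝ → ℝ, Billiard.IsOrbitCorrection ℓ γ α) ∧
      ∀ α : ℝ → ℝ, Billiard.IsOrbitCorrection ℓ γ α →
        (Billiard.IsDisc Ω ↔ ∀ x, α x = 0)) := by
  obtain ⟨c, r, S, H⟩ := hΩ.exists_lazutkinChart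
  obtain ⟨A₁, A₃, A₅, hA⟩ := H.exists_angleExpansion
  have hdisc : Billiard.IsDisc Ω ↔ ∀ x, Billiard.correction (Billiard.potential c r) x = 0 :=
    (H.isDisc_iff hΩ).trans (Billiard.correction_eq_zero_iff hA.smooth_B).symm
  refine ⟨⟨⟨_, H.isLazutkinX1 hΩ hA, fun _ h => H.eq_of_isLazutkinX1 hA h⟩, ?_⟩,
    ⟨⟨_, H.isAngularZ1, fun _ h => H.eq_of_isAngularZ1 h⟩, ?_⟩, fun hsym =>
    ⟨⟨_, H.isOrbitCorrection_correction hΩ,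
      fun _ h => hΩ.isOrbitCorrection_unique hsym h (H.isOrbitCorrection_correction hΩ)⟩, ?_⟩⟩
  · intro X₁ h
    rw [hdisc, H.eq_of_isLazutkinX1 hA h]
    have hA0 : ∀ x, A₁ x ^ 2 ≠ 0 := fun x => pow_ne_zero 2 (hA.pos x).ne'
    simp only [div_eq_zero_iff, neg_eq_zero, hA0, or_false]
    exact ⟨fun h s => h _, fun h x => by simpa only [H.param_apply] using h (S x)⟩
  · intro Z₁ h
    rw [hdisc, H.eq_of_isAngularZ1 h]
    have h0 : ∀ x, c * r x ^ 2 ≠ 0 := fun x =>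
      (mul_pos H.curve.c_pos (pow_pos (H.curve.r_pos x) 2)).ne'
    simp only [mul_eq_zero, h0, false_or]
  · intro α h
    rw [hdisc, hΩ.isOrbitCorrection_unique hsym h (H.isOrbitCorrection_correction hΩ)]
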